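/- **Conventions.** All syntax is taken up to renaming of bound names; $\mathrm{fv}$ denotes free names and $\{w/y\}$ capture-avoiding substitution. In every reduction rule below that removes a restriction $(\nu xy)$, the result is required not to mention $x$ and $y$. Priorities $o$ are natural numbers. **Priority CP (PCP).** *Types*: $A,B ::= A\otimes^o B \mid A\,⅋^o B \mid \mathbf 1^o \mid \bot^o \mid A\oplus^o B \mid A\,\&^o B \mid \mathbf 0^o \mid \top^o$. Duality $A^\perp$ preserves priorities and exchanges $\otimes/⅋$, $\mathbf 1/\bot$, $\oplus/\&$, $\mathbf 0/\top$ (acting on both components). $\mathrm{pr}(A)$ is the priority of the topmost connective of $A$; $\mathrm{pr}(\Gamma)$ is the minimum of the priorities of the types in the environment $\Gamma$ (a finite partial map from names to types), and $\infty$ if $\Gamma=\varnothing$. $\Gamma,\Delta$ is defined only when the names are distinct. *Processes*: $P,Q ::= x\leftrightarrow y \mid (\nu xy)P \mid P\parallel Q \mid 0 \mid x[y].P \mid x[\,].P \mid x(y).P \mid x().P \mid x\triangleleft \mathrm{inl}.P \mid x\triangleleft \mathrm{inr}.P \mid x\triangleright\{\mathrm{inl}{:}P;\mathrm{inr}{:}Q\}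 \mid x\triangleright\{\}$, where $(\nu xy)$ binds $x,y$, and $x[y].P$ and $x(y).P$ bind $y$ in $P$. *Typing* $P\vdash\Gamma$ is generated by: - $x\leftrightarrow y\vdash x{:}A,y{:}A^\perp$ and $0\vdash\varnothing$; - if $P\vdash\Gamma,x{:}A,y{:}A^\perp$ then $(\nu xy)P\vdash\Gamma$; if $P\vdash\Gamma$ and $Q\vdash\Delta$ then $P\parallel Q\vdash\Gamma,\Delta$; - if $P\vdash\Gamma,y{:}A,x{:}B$ and $o<\min(\mathrm{pr}\,\Gamma,\mathrm{pr}\,A,\mathrm{pr}\,B)$ then $x[y].P\vdash\Gamma,x{:}A\otimes^oB$ and $x(y).P\vdash\Gamma,x{:}A\,⅋^oB$; - if $P\vdash\Gamma$ and $o<\mathrm{pr}\,\Gamma$ then $x[\,].P\vdash\Gamma,x{:}\mathbf 1^o$ and $x().P\vdash\Gamma,x{:}\bot^o$; - if $P\vdash\Gamma,x{:}A$ (respectively $P\vdash\Gamma,x{:}B$), $o<\min(\mathrm{pr}\,\Gamma,\mathrm{pr}\,A,\mathrm{pr}\,B)$ and $\mathrm{pr}\,A=\mathrm{pr}\,B$,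 then $x\triangleleft\mathrm{inl}.P$ (respectively $x\triangleleft\mathrm{inr}.P$) $\vdash\Gamma,x{:}A\oplus^oB$; - if $P\vdash\Gamma,x{:}A$, $Q\vdash\Gamma,x{:}B$ and $o<\min(\mathrm{pr}\,\Gamma,\mathrm{pr}\,A,\mathrm{pr}\,B)$ then $x\triangleright\{\mathrm{inl}{:}P;\mathrm{inr}{:}Q\}\vdash\Gamma,x{:}A\,\&^oB$; if $o<\mathrm{pr}\,\Gamma$ then $x\triangleright\{\}\vdash\Gamma,x{:}\top^o$. *Structural congruence* $\equiv$ is the least equivalence closed under $(\nu xy)$ and $\parallel$ with $x\leftrightarrow y\equiv y\leftrightarrow x$; $(\nu xy)\,x\leftrightarrow y\equiv 0$; $(\nu xy)P\equiv(\nu yx)P$; $(\nu xy)(\nu zw)P\equiv(\nu zw)(\nu xy)P$ for $\{x,y\}\cap\{z,w\}=\varnothing$; $(\nu xy)(P\parallel Q)\equiv P\parallel(\nu xy)Q$ for $x,y\notin\mathrm{fv}(P)$; $P\parallel 0\equiv P$; $\parallel$ commutative and associative. *Reduction* $\longrightarrow$ is the least relation closed under $(\nu xy)$, under $\parallel$ on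 the left, and under $\equiv$ on both sides (if $P\equiv P'\longrightarrow Q'\equiv Q$ then $P\longrightarrow Q$), with - $(\nu xy)(w\leftrightarrow x\parallel P)\longrightarrow P\{w/y\}$; - $(\nu xy)(x[z].P\parallel y(w).Q)\longrightarrow(\nu xy)(\nu zw)(P\parallel Q)$; - $(\nu xy)(x[\,].P\parallel y().Q)\longrightarrow P\parallel Q$; - $(\nu xy)(x\triangleleft\mathrm{inl}.P\parallel y\triangleright\{\mathrm{inl}{:}Q;\mathrm{inr}{:}R\})\longrightarrow(\nu xy)(P\parallel Q)$, and with $\mathrm{inr}$ to $(\nu xy)(P\parallel R)$. **Priority GV (PGV).** *Terms*: $L,M,N ::= x\mid K\mid\lambda x.M\mid M\,N\mid()\mid M;N\mid(M,N)\mid\mathsf{let}\,(x,y)=M\,\mathsf{in}\,N\mid\mathsf{inl}\,M\mid\mathsf{inr}\,M\mid\mathsf{case}\,L\,\{\mathsf{inl}\,x\mapsto M;\mathsf{inr}\,y\mapsto N\}\mid\mathsf{absurd}\,M$ with $K\in\{\mathsf{link},\mathsf{new},\mathsf{spawn},\mathsf{send},\mathsf{recv},\mathsf{close},\mathsf{wait}\}$.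 *Values*: $V,W ::= x\mid K\mid\lambda x.M\mid()\mid(V,W)\mid\mathsf{inl}\,V\mid\mathsf{inr}\,V$. *Evaluation contexts*: $E ::= \square\mid E\,M\mid V\,E\mid E;N\mid(E,M)\mid(V,E)\mid\mathsf{let}\,(x,y)=E\,\mathsf{in}\,M\mid\mathsf{inl}\,E\mid\mathsf{inr}\,E\mid\mathsf{case}\,E\,\{\ldots\}\mid\mathsf{absurd}\,E$. *Term reduction* $\longrightarrow_M$ is closed under evaluation contexts and generated by $(\lambda x.M)V\to M\{V/x\}$; $();M\to M$; $\mathsf{let}\,(x,y)=(V,W)\,\mathsf{in}\,M\to M\{V/x\}\{W/y\}$; and the two usual rules for $\mathsf{case}$ of $\mathsf{inl}\,V$ and of $\mathsf{inr}\,V$. *Configurations*: $C,D ::= \phi\,M\mid C\parallel D\mid(\nu xy)C$ with a flag $\phi\in\{\bullet,\circ\}$ (main, child); thread contexts are $F ::= \phi\,E$. *Structural congruence* is the least equivalence closed under $(\nu xy)$ and $\parallel$ with $F[\mathsf{link}\,(x,y)]\equiv F[\mathsf{link}\,(y,x)]$; $(\nu xy)(\phi\,\mathsf{link}\,(x,y))\equiv\phi\,()$;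 $C\parallel\circ\,()\equiv C$; and the axioms for swapping, commuting and extending restrictions and for commutativity and associativity of $\parallel$, as for PCP. *Reduction* $\longrightarrow$ of configurations is the least relation closed under $(\nu xy)$, under $\parallel$ on the left, and under $\equiv$ on both sides, with $F[M]\longrightarrow F[M']$ whenever $M\longrightarrow_M M'$, and - $(\nu xy)(F[\mathsf{link}\,(w,x)]\parallel C)\longrightarrow F[()]\parallel C\{w/y\}$; - $F[\mathsf{new}\,()]\longrightarrow(\nu xy)F[(x,y)]$ for $x,y\notin\mathrm{fv}(F)$; - $F[\mathsf{spawn}\,V]\longrightarrow F[()]\parallel\circ\,(V\,())$; - $(\nu xy)(F[\mathsf{send}\,(V,x)]\parallel F'[\mathsf{recv}\,y])\longrightarrow(\nu xy)(F[x]\parallel F'[(V,y)])$; - $(\nu xy)(F[\mathsf{wait}\,x]\parallel F'[\mathsf{close}\,y])\longrightarrow F[()]\parallel F'[()]$. **Translation.** Write $\mathsf{let}\,x=M\,\mathsf{in}\,N$ for $(\lambda x.N)\,M$ and $\lambda().M$ for $\lambda z.(z;M)$. The names $z$ and $w$ (and $y$, in the clauses for selection) introduced below are fresh, and $\ell$ ranges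 over $\{\mathrm{inl},\mathrm{inr}\}$. Processes are translated to terms by - $⟦x\leftrightarrow y⟧_M=\mathsf{link}\,(x,y)$; $⟦(\nu xy)P⟧_M=\mathsf{let}\,(x,y)=\mathsf{new}\,()\,\mathsf{in}\,⟦P⟧_M$; $⟦P\parallel Q⟧_M=\mathsf{spawn}\,(\lambda().⟦P⟧_M);⟦Q⟧_M$; $⟦0⟧_M=()$; - $⟦x[y].P⟧_M=\mathsf{let}\,(y,z)=\mathsf{new}\,()\,\mathsf{in}\,\mathsf{let}\,x=\mathsf{send}\,(z,x)\,\mathsf{in}\,⟦P⟧_M$; $⟦x[\,].P⟧_M=\mathsf{close}\,x;⟦P⟧_M$; - $⟦x(y).P⟧_M=\mathsf{let}\,(y,x)=\mathsf{recv}\,x\,\mathsf{in}\,⟦P⟧_M$; $⟦x().P⟧_M=\mathsf{wait}\,x;⟦P⟧_M$; - $⟦x\triangleleft\ell.P⟧_M=\mathsf{let}\,x=(\lambda x.\,\mathsf{let}\,(y,z)=\mathsf{new}\,()\,\mathsf{in}\,(\mathsf{close}\,(\mathsf{send}\,(\ell\,y,x));z))\,x\,\mathsf{in}\,⟦P⟧_M$;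 - $⟦x\triangleright\{\mathrm{inl}{:}P;\mathrm{inr}{:}Q\}⟧_M=\mathsf{let}\,(z,w)=\mathsf{recv}\,x\,\mathsf{in}\,(\mathsf{wait}\,w;\mathsf{case}\,z\,\{\mathsf{inl}\,x\mapsto⟦P⟧_M;\mathsf{inr}\,x\mapsto⟦Q⟧_M\})$; $⟦x\triangleright\{\}⟧_M=\mathsf{let}\,(z,w)=\mathsf{recv}\,x\,\mathsf{in}\,(\mathsf{wait}\,w;\mathsf{absurd}\,z)$. They are translated to configurations by $⟦(\nu xy)P⟧=(\nu xy)⟦P⟧$; $⟦P\parallel Q⟧=⟦P⟧\parallel⟦Q⟧$; $⟦x[y].P⟧=(\nu yz)(\circ\,\mathsf{let}\,x=\mathsf{send}\,(z,x)\,\mathsf{in}\,⟦P⟧_M)$; $⟦x\triangleleft\ell.P⟧=(\nu yz)(\circ\,\mathsf{let}\,x=(\mathsf{close}\,(\mathsf{send}\,(\ell\,y,x));z)\,\mathsf{in}\,⟦P⟧_M)$; and $⟦P⟧=\circ\,⟦P⟧_M$ for every other process. **Theorem (Operational Correspondence, Soundness).** If $P\vdash\Gamma$ in PCP and $⟦P⟧\longrightarrow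 C$ in PGV, then there is a PCP process $Q$ such that $P\longrightarrow^+Q$ in PCP and $C\longrightarrow^\star⟦Q⟧$ in PGV, where $\longrightarrow^+$ and $\longrightarrow^\star$ are the transitive and the reflexive-transitive closures. -/

import Mathlib

/-
Names and binders.  Both calculi are represented up to renaming of bound names, with well-scoped
de Bruijn indices: an object in scope `n` has the free names `0, ..., n - 1`, and a binder adds
its bound names in front.  A binder of one name binds the index `0`; a binder of two names,
`(ν x y)` or `let (x, y) = M in N`, binds `x` as the index `0` and `y` as the index `1`.
-/

/-- The family on `Fin (n + 1)` that has `a` in front of `f`. -/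
def scons {α : Type} {n : ℕ} (a : α) (f : Fin n → α) : Fin (n + 1) → α :=
  fun i => Fin.cases (motive := fun _ => α) a f i

/-- A renaming, extended below a binder of one name. -/
def lift {n m : ℕ} (ρ : Fin n → Fin m) : Fin (n + 1) → Fin (m + 1) :=
  scons 0 (fun i => (ρ i).succ)

/-- A renaming, extended below a binder of two names. -/
def lift2 {n m : ℕ} (ρ : Fin n → Fin m) : Fin (n + 2) → Fin (m + 2) :=
  lift (lift ρ)

/-- The inclusion of a scope into the scope below a binder of two names. Hence an object in scope
`n + 2` mentions neither of the two names bound last iff it is a renaming along `wk2`. -/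
def wk2 {n : ℕ} : Fin n → Fin (n + 2) := fun i => i.succ.succ

/-- Exchanges the two names bound last. -/
def swap2 {n : ℕ} : Fin (n + 2) → Fin (n + 2) :=
  scons 1 (scons 0 wk2)

/-- Exchanges the two pairs of names bound last. -/
def exch22 {n : ℕ} : Fin (n + 4) → Fin (n + 4) :=
  scons 2 (scons 3 (scons 0 (scons 1 (fun i => wk2 (wk2 i)))))

/-- The substitution of the name `w` for the name `y`. -/
def replace {n : ℕ} (w y : Fin n) : Fin n → Fin n := Function.update id y w

/-- Binds the name `x` again, shadowing it: below the new binder, `x` denotes the new name. -/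
def rebind {n : ℕ} (x : Fin n) : Fin n → Fin (n + 1) := fun i => if i = x then 0 else i.succ

/-! ### Priority CP -/

namespace PCP

/-- Types, each connective annotated with a priority. -/
inductive Ty : Type
  | tens (o : ℕ) (A B : Ty)
  | parr (o : ℕ) (A B : Ty)
  | one (o : ℕ)
  | bot (o : ℕ)
  | plus (o : ℕ) (A B : Ty)
  | amp (o : ℕ) (A B : Ty)
  | nil (o : ℕ)
  | top (o : ℕ)

/-- Duality. -/
def Ty.dual : Ty → Ty
  | .tens o A B => .parr o A.dual B.dual
  | .parr o A B => .tens o A.dual B.dual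
  | .one o => .bot o
  | .bot o => .one o
  | .plus o A B => .amp o A.dual B.dual
  | .amp o A B => .plus o A.dual B.dual
  | .nil o => .top o
  | .top o => .nil o

/-- The priority of a type, that of its topmost connective. -/
def Ty.pr : Ty → ℕ
  | .tens o _ _ => o
  | .parr o _ _ => o
  | .one o => o
  | .bot o => o
  | .plus o _ _ => o
  | .amp o _ _ => o
  | .nil o => o
  | .top o => o

/-- Processes with `n` free names. -/
inductive Proc : ℕ → Type
  /-- `x ↔ y` -/
  | link {n : ℕ} (x y : Fin n) : Proc n
  /-- `(ν x y) P` -/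
  | res {n : ℕ} (P : Proc (n + 2)) : Proc n
  /-- `P ∥ Q` -/
  | par {n : ℕ} (P Q : Proc n) : Proc n
  /-- `0` -/
  | halt {n : ℕ} : Proc n
  /-- `x[y].P`, binding `y` in `P` -/
  | send {n : ℕ} (x : Fin n) (P : Proc (n + 1)) : Proc n
  /-- `x[].P` -/
  | close {n : ℕ} (x : Fin n) (P : Proc n) : Proc n
  /-- `x(y).P`, binding `y` in `P` -/
  | recv {n : ℕ} (x : Fin n) (P : Proc (n + 1)) : Proc n
  /-- `x().P` -/
  | wait {n : ℕ} (x : Fin n) (P : Proc n) : Proc n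
  /-- `x ◁ inl.P` -/
  | inl {n : ℕ} (x : Fin n) (P : Proc n) : Proc n
  /-- `x ◁ inr.P` -/
  | inr {n : ℕ} (x : Fin n) (P : Proc n) : Proc n
  /-- `x ▷ {inl: P; inr: Q}` -/
  | offer {n : ℕ} (x : Fin n) (P Q : Proc n) : Proc n
  /-- `x ▷ {}` -/
  | absurd {n : ℕ} (x : Fin n) : Proc n

/-- Renaming of free names. -/
def Proc.rename {n m : ℕ} (ρ : Fin n → Fin m) : Proc n → Proc m
  | .link x y => .link (ρ x) (ρ y)
  | .res P => .res (P.rename (lift2 ρ))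
  | .par P Q => .par (P.rename ρ) (Q.rename ρ)
  | .halt => .halt
  | .send x P => .send (ρ x) (P.rename (lift ρ))
  | .close x P => .close (ρ x) (P.rename ρ)
  | .recv x P => .recv (ρ x) (P.rename (lift ρ))
  | .wait x P => .wait (ρ x) (P.rename ρ)
  | .inl x P => .inl (ρ x) (P.rename ρ)
  | .inr x P => .inr (ρ x) (P.rename ρ)
  | .offer x P Q => .offer (ρ x) (P.rename ρ) (Q.rename ρ)
  | .absurd x => .absurd (ρ x)

/-- Structural congruence: the least equivalence that contains the axioms and is preserved by
restriction and parallel composition. -/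
inductive SC : {n : ℕ} → Proc n → Proc n → Prop
  | linkSwap {n : ℕ} (x y : Fin n) : SC (.link x y) (.link y x)
  | resLink {n : ℕ} : SC (.res (.link 0 1) : Proc n) .halt
  | resSwap {n : ℕ} (P : Proc (n + 2)) : SC (.res P) (.res (P.rename swap2))
  | resComm {n : ℕ} (P : Proc (n + 4)) : SC (.res (.res P)) (.res (.res (P.rename exch22)))
  | resExt {n : ℕ} (P : Proc n) (Q : Proc (n + 2)) :
      SC (.res (.par (P.rename wk2) Q)) (.par P (.res Q))
  | parNil {n : ℕ} (P : Proc n) : SC (.par P .halt) P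
  | parComm {n : ℕ} (P Q : Proc n) : SC (.par P Q) (.par Q P)
  | parAssoc {n : ℕ} (P Q R : Proc n) : SC (.par P (.par Q R)) (.par (.par P Q) R)
  | refl {n : ℕ} (P : Proc n) : SC P P
  | symm {n : ℕ} {P Q : Proc n} : SC P Q → SC Q P
  | trans {n : ℕ} {P Q R : Proc n} : SC P Q → SC Q R → SC P R
  | congRes {n : ℕ} {P P' : Proc (n + 2)} : SC P P' → SC (.res P) (.res P')
  | congPar {n : ℕ} {P P' Q Q' : Proc n} : SC P P' → SC Q Q' → SC (.par P Q) (.par P' Q')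

/-- Reduction. -/
inductive Red : {n : ℕ} → Proc n → Proc n → Prop
  /-- `(ν x y) (w ↔ x ∥ P) ⟶ P{w/y}`. The side condition says that `Q` is `P{w/y}`, and that
  this process mentions neither `x` nor `y`, so that it makes sense outside their scope. The name
  `w` may be `y`. -/
  | link {n : ℕ} (w : Fin (n + 2)) (P : Proc (n + 2)) (Q : Proc n)
      (h : P.rename (replace w 1) = Q.rename wk2) :
      Red (.res (.par (.link w 0) P)) Q
  /-- `(ν x y) (x[z].P ∥ y(w).Q) ⟶ (ν x y) (ν z w) (P ∥ Q)` -/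
  | send {n : ℕ} (P Q : Proc (n + 3)) :
      Red (.res (.par (.send 0 P) (.recv 1 Q)) : Proc n)
        (.res (.res (.par (P.rename (lift Fin.succ)) (Q.rename Fin.succ))))
  /-- `(ν x y) (x[].P ∥ y().Q) ⟶ P ∥ Q`, where `P` and `Q` mention neither `x` nor `y` -/
  | close {n : ℕ} (P Q : Proc n) :
      Red (.res (.par (.close 0 (P.rename wk2)) (.wait 1 (Q.rename wk2)))) (.par P Q)
  | selectInl {n : ℕ} (P Q R : Proc (n + 2)) :
      Red (.res (.par (.inl 0 P) (.offer 1 Q R))) (.res (.par P Q))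
  | selectInr {n : ℕ} (P Q R : Proc (n + 2)) :
      Red (.res (.par (.inr 0 P) (.offer 1 Q R))) (.res (.par P R))
  | liftRes {n : ℕ} {P P' : Proc (n + 2)} : Red P P' → Red (.res P) (.res P')
  | liftPar {n : ℕ} {P P' : Proc n} (Q : Proc n) : Red P P' → Red (.par P Q) (.par P' Q)
  | liftSC {n : ℕ} {P P' Q' Q : Proc n} : SC P P' → Red P' Q' → SC Q' Q → Red P Q

/-- Typing environments for processes with `n` free names: finite partial maps from names to
types. -/
abbrev Env (n : ℕ) : Type := Fin n → Option Ty

/-- The empty environment. -/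
def Env.empty {n : ℕ} : Env n := fun _ => none

/-- The environment `Γ, x : A` (used where `x` is not in `Γ`). -/
def Env.ext {n : ℕ} (Γ : Env n) (x : Fin n) (A : Ty) : Env n := Function.update Γ x (some A)

/-- The environment `Γ, y : A` for a newly bound name `y`. -/
def Env.bind {n : ℕ} (A : Ty) (Γ : Env n) : Env (n + 1) := scons (some A) Γ

/-- The names of the two environments are distinct. -/
def Env.Disjoint {n : ℕ} (Γ Δ : Env n) : Prop := ∀ i, Γ i = none ∨ Δ i = none

/-- The environment `Γ, Δ` (used where the names of `Γ` and `Δ` are distinct). -/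
def Env.union {n : ℕ} (Γ Δ : Env n) : Env n := fun i => (Γ i).or (Δ i)

/-- The smallest priority in an environment, `⊤` if there is none. -/
noncomputable def Env.minpr {n : ℕ} (Γ : Env n) : ℕ∞ :=
  Finset.univ.inf fun i => (Γ i).elim ⊤ fun A => (A.pr : ℕ∞)

/-- Typing: `Typed P Γ` is the judgement `P ⊢ Γ`. -/
inductive Typed : {n : ℕ} → Proc n → Env n → Prop
  | link {n : ℕ} (x y : Fin n) (A : Ty) : x ≠ y →
      Typed (.link x y) ((Env.empty.ext x A).ext y A.dual)
  | res {n : ℕ} {P : Proc (n + 2)} {Γ : Env n} (A : Ty) :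
      Typed P (Env.bind A (Env.bind A.dual Γ)) → Typed (.res P) Γ
  | par {n : ℕ} {P Q : Proc n} {Γ Δ : Env n} : Γ.Disjoint Δ →
      Typed P Γ → Typed Q Δ → Typed (.par P Q) (Γ.union Δ)
  | halt {n : ℕ} : Typed (.halt : Proc n) Env.empty
  | send {n : ℕ} {x : Fin n} {P : Proc (n + 1)} {Γ : Env n} {o : ℕ} {A B : Ty} : Γ x = none →
      Typed P (Env.bind A (Γ.ext x B)) → (o : ℕ∞) < Γ.minpr ⊓ A.pr ⊓ B.pr →
      Typed (.send x P) (Γ.ext x (.tens o A B))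
  | close {n : ℕ} {x : Fin n} {P : Proc n} {Γ : Env n} {o : ℕ} : Γ x = none →
      Typed P Γ → (o : ℕ∞) < Γ.minpr →
      Typed (.close x P) (Γ.ext x (.one o))
  | recv {n : ℕ} {x : Fin n} {P : Proc (n + 1)} {Γ : Env n} {o : ℕ} {A B : Ty} : Γ x = none →
      Typed P (Env.bind A (Γ.ext x B)) → (o : ℕ∞) < Γ.minpr ⊓ A.pr ⊓ B.pr →
      Typed (.recv x P) (Γ.ext x (.parr o A B))
  | wait {n : ℕ} {x : Fin n} {P : Proc n} {Γ : Env n} {o : ℕ} : Γ x = none →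
      Typed P Γ → (o : ℕ∞) < Γ.minpr →
      Typed (.wait x P) (Γ.ext x (.bot o))
  | inl {n : ℕ} {x : Fin n} {P : Proc n} {Γ : Env n} {o : ℕ} {A B : Ty} : Γ x = none →
      Typed P (Γ.ext x A) → (o : ℕ∞) < Γ.minpr ⊓ A.pr ⊓ B.pr → A.pr = B.pr →
      Typed (.inl x P) (Γ.ext x (.plus o A B))
  | inr {n : ℕ} {x : Fin n} {P : Proc n} {Γ : Env n} {o : ℕ} {A B : Ty} : Γ x = none →
      Typed P (Γ.ext x B) → (o : ℕ∞) < Γ.minpr ⊓ A.pr ⊓ B.pr → A.pr = B.pr →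
      Typed (.inr x P) (Γ.ext x (.plus o A B))
  | offer {n : ℕ} {x : Fin n} {P Q : Proc n} {Γ : Env n} {o : ℕ} {A B : Ty} : Γ x = none →
      Typed P (Γ.ext x A) → Typed Q (Γ.ext x B) → (o : ℕ∞) < Γ.minpr ⊓ A.pr ⊓ B.pr →
      Typed (.offer x P Q) (Γ.ext x (.amp o A B))
  | absurd {n : ℕ} {x : Fin n} {Γ : Env n} {o : ℕ} : Γ x = none →
      (o : ℕ∞) < Γ.minpr →
      Typed (.absurd x) (Γ.ext x (.top o))

end PCP

/-! ### Priority GV -/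

namespace PGV

/-- The communication primitives. -/
inductive Const : Type
  | link | new | spawn | send | recv | close | wait

/-- Terms with `n` free variables. -/
inductive Term : ℕ → Type
  | var {n : ℕ} (x : Fin n) : Term n
  | const {n : ℕ} (K : Const) : Term n
  /-- `λ x. M` -/
  | lam {n : ℕ} (M : Term (n + 1)) : Term n
  | app {n : ℕ} (M N : Term n) : Term n
  /-- `()` -/
  | unit {n : ℕ} : Term n
  /-- `M; N` -/
  | andThen {n : ℕ} (M N : Term n) : Term n
  | pair {n : ℕ} (M N : Term n) : Term n
  /-- `let (x, y) = M in N` -/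
  | letPair {n : ℕ} (M : Term n) (N : Term (n + 2)) : Term n
  | inl {n : ℕ} (M : Term n) : Term n
  | inr {n : ℕ} (M : Term n) : Term n
  /-- `case L {inl x ↦ M; inr y ↦ N}` -/
  | caseSum {n : ℕ} (L : Term n) (M N : Term (n + 1)) : Term n
  | absurd {n : ℕ} (M : Term n) : Term n

/-- Renaming of free variables. -/
def Term.rename {n m : ℕ} (ρ : Fin n → Fin m) : Term n → Term m
  | .var x => .var (ρ x)
  | .const K => .const K
  | .lam M => .lam (M.rename (lift ρ))
  | .app M N => .app (M.rename ρ) (N.rename ρ)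
  | .unit => .unit
  | .andThen M N => .andThen (M.rename ρ) (N.rename ρ)
  | .pair M N => .pair (M.rename ρ) (N.rename ρ)
  | .letPair M N => .letPair (M.rename ρ) (N.rename (lift2 ρ))
  | .inl M => .inl (M.rename ρ)
  | .inr M => .inr (M.rename ρ)
  | .caseSum L M N => .caseSum (L.rename ρ) (M.rename (lift ρ)) (N.rename (lift ρ))
  | .absurd M => .absurd (M.rename ρ)

/-- A simultaneous substitution, extended below a binder of one variable. -/
def liftSubst {n m : ℕ} (σ : Fin n → Term m) : Fin (n + 1) → Term (m + 1) :=
  scons (.var 0) (fun i => (σ i).rename Fin.succ)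

/-- Simultaneous capture-avoiding substitution. -/
def Term.subst {n m : ℕ} (σ : Fin n → Term m) : Term n → Term m
  | .var x => σ x
  | .const K => .const K
  | .lam M => .lam (M.subst (liftSubst σ))
  | .app M N => .app (M.subst σ) (N.subst σ)
  | .unit => .unit
  | .andThen M N => .andThen (M.subst σ) (N.subst σ)
  | .pair M N => .pair (M.subst σ) (N.subst σ)
  | .letPair M N => .letPair (M.subst σ) (N.subst (liftSubst (liftSubst σ)))
  | .inl M => .inl (M.subst σ)
  | .inr M => .inr (M.subst σ)
  | .caseSum L M N => .caseSum (L.subst σ) (M.subst (liftSubst σ)) (N.subst (liftSubst σ))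
  | .absurd M => .absurd (M.subst σ)

/-- `M{V/x}`, for the variable `x` bound last. -/
def Term.inst {n : ℕ} (M : Term (n + 1)) (V : Term n) : Term n :=
  M.subst (scons V .var)

/-- `M{V/x}{W/y}`, for the pair of variables `x`, `y` bound last. -/
def Term.inst2 {n : ℕ} (M : Term (n + 2)) (V W : Term n) : Term n :=
  M.subst (scons V (scons W .var))

/-- Values. -/
inductive IsValue : {n : ℕ} → Term n → Prop
  | var {n : ℕ} (x : Fin n) : IsValue (.var x)
  | const {n : ℕ} (K : Const) : IsValue (.const K : Term n)
  | lam {n : ℕ} (M : Term (n + 1)) : IsValue (.lam M)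
  | unit {n : ℕ} : IsValue (.unit : Term n)
  | pair {n : ℕ} {V W : Term n} : IsValue V → IsValue W → IsValue (.pair V W)
  | inl {n : ℕ} {V : Term n} : IsValue V → IsValue (.inl V)
  | inr {n : ℕ} {V : Term n} : IsValue V → IsValue (.inr V)

theorem IsValue.rename {n m : ℕ} (ρ : Fin n → Fin m) {V : Term n} (h : IsValue V) :
    IsValue (V.rename ρ) := by
  induction h generalizing m with
  | var x => exact .var _
  | const K => exact .const K
  | lam M => exact .lam _
  | unit => exact .unit
  | pair _ _ ih₁ ih₂ => exact .pair (ih₁ ρ) (ih₂ ρ)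
  | inl _ ih => exact .inl (ih ρ)
  | inr _ ih => exact .inr (ih ρ)

/-- Evaluation contexts. The hole is never below a binder. -/
inductive ECtx (n : ℕ) : Type
  | hole : ECtx n
  | appL (E : ECtx n) (M : Term n) : ECtx n
  | appR (V : Term n) (hV : IsValue V) (E : ECtx n) : ECtx n
  | andThen (E : ECtx n) (N : Term n) : ECtx n
  | pairL (E : ECtx n) (M : Term n) : ECtx n
  | pairR (V : Term n) (hV : IsValue V) (E : ECtx n) : ECtx n
  | letPair (E : ECtx n) (M : Term (n + 2)) : ECtx n
  | inl (E : ECtx n) : ECtx n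
  | inr (E : ECtx n) : ECtx n
  | caseSum (E : ECtx n) (M N : Term (n + 1)) : ECtx n
  | absurd (E : ECtx n) : ECtx n

/-- `E[L]`. -/
def ECtx.plug {n : ℕ} (L : Term n) : ECtx n → Term n
  | .hole => L
  | .appL E M => .app (E.plug L) M
  | .appR V _ E => .app V (E.plug L)
  | .andThen E N => .andThen (E.plug L) N
  | .pairL E M => .pair (E.plug L) M
  | .pairR V _ E => .pair V (E.plug L)
  | .letPair E M => .letPair (E.plug L) M
  | .inl E => .inl (E.plug L)
  | .inr E => .inr (E.plug L)
  | .caseSum E M N => .caseSum (E.plug L) M N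
  | .absurd E => .absurd (E.plug L)

/-- Renaming of free variables in an evaluation context. -/
def ECtx.rename {n m : ℕ} (ρ : Fin n → Fin m) : ECtx n → ECtx m
  | .hole => .hole
  | .appL E M => .appL (E.rename ρ) (M.rename ρ)
  | .appR V hV E => .appR (V.rename ρ) (hV.rename ρ) (E.rename ρ)
  | .andThen E N => .andThen (E.rename ρ) (N.rename ρ)
  | .pairL E M => .pairL (E.rename ρ) (M.rename ρ)
  | .pairR V hV E => .pairR (V.rename ρ) (hV.rename ρ) (E.rename ρ)
  | .letPair E M => .letPair (E.rename ρ) (M.rename (lift2 ρ))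
  | .inl E => .inl (E.rename ρ)
  | .inr E => .inr (E.rename ρ)
  | .caseSum E M N => .caseSum (E.rename ρ) (M.rename (lift ρ)) (N.rename (lift ρ))
  | .absurd E => .absurd (E.rename ρ)

/-- Term reduction. -/
inductive TRed : {n : ℕ} → Term n → Term n → Prop
  | lam {n : ℕ} (M : Term (n + 1)) {V : Term n} : IsValue V → TRed (.app (.lam M) V) (M.inst V)
  | unit {n : ℕ} (M : Term n) : TRed (.andThen .unit M) M
  | pair {n : ℕ} {V W : Term n} (M : Term (n + 2)) : IsValue V → IsValue W →
      TRed (.letPair (.pair V W) M) (M.inst2 V W)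
  | inl {n : ℕ} {V : Term n} (M N : Term (n + 1)) : IsValue V →
      TRed (.caseSum (.inl V) M N) (M.inst V)
  | inr {n : ℕ} {V : Term n} (M N : Term (n + 1)) : IsValue V →
      TRed (.caseSum (.inr V) M N) (N.inst V)
  | lift {n : ℕ} (E : ECtx n) {M M' : Term n} : TRed M M' → TRed (E.plug M) (E.plug M')

/-- Thread flags: the main thread, marked `●`, and child threads, marked `○`. -/
inductive Flag : Type
  | main | child

/-- Configurations with `n` free names. -/
inductive Conf : ℕ → Type
  /-- `φ M` -/
  | thread {n : ℕ} (φ : Flag) (M : Term n) : Conf n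
  /-- `C ∥ D` -/
  | par {n : ℕ} (C D : Conf n) : Conf n
  /-- `(ν x y) C` -/
  | res {n : ℕ} (C : Conf (n + 2)) : Conf n

/-- Renaming of free names. -/
def Conf.rename {n m : ℕ} (ρ : Fin n → Fin m) : Conf n → Conf m
  | .thread φ M => .thread φ (M.rename ρ)
  | .par C D => .par (C.rename ρ) (D.rename ρ)
  | .res C => .res (C.rename (lift2 ρ))

/-- Thread evaluation contexts `φ E`. -/
structure TCtx (n : ℕ) : Type where
  flag : Flag
  ctx : ECtx n

/-- `F[M]`. -/
def TCtx.plug {n : ℕ} (F : TCtx n) (M : Term n) : Conf n := .thread F.flag (F.ctx.plug M)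

/-- Renaming of free names in a thread evaluation context. -/
def TCtx.rename {n m : ℕ} (ρ : Fin n → Fin m) (F : TCtx n) : TCtx m := ⟨F.flag, F.ctx.rename ρ⟩

/-- The term `K M`. -/
def Term.capp {n : ℕ} (K : Const) (M : Term n) : Term n := .app (.const K) M

/-- The term `link (x, y)` for names `x` and `y`. -/
def Term.linkVars {n : ℕ} (x y : Fin n) : Term n := .capp .link (.pair (.var x) (.var y))

/-- Structural congruence: the least equivalence that contains the axioms and is preserved by
restriction and parallel composition. -/
inductive SC : {n : ℕ} → Conf n → Conf n → Prop
  | linkSwap {n : ℕ} (F : TCtx n) (x y : Fin n) :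
      SC (F.plug (.linkVars x y)) (F.plug (.linkVars y x))
  | resLink {n : ℕ} (φ : Flag) :
      SC (.res (.thread φ (.linkVars 0 1)) : Conf n) (.thread φ .unit)
  | resSwap {n : ℕ} (C : Conf (n + 2)) : SC (.res C) (.res (C.rename swap2))
  | resComm {n : ℕ} (C : Conf (n + 4)) : SC (.res (.res C)) (.res (.res (C.rename exch22)))
  | resExt {n : ℕ} (C : Conf n) (D : Conf (n + 2)) :
      SC (.res (.par (C.rename wk2) D)) (.par C (.res D))
  | parNil {n : ℕ} (C : Conf n) : SC (.par C (.thread .child .unit)) C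
  | parComm {n : ℕ} (C D : Conf n) : SC (.par C D) (.par D C)
  | parAssoc {n : ℕ} (C D E : Conf n) : SC (.par C (.par D E)) (.par (.par C D) E)
  | refl {n : ℕ} (C : Conf n) : SC C C
  | symm {n : ℕ} {C D : Conf n} : SC C D → SC D C
  | trans {n : ℕ} {C D E : Conf n} : SC C D → SC D E → SC C E
  | congRes {n : ℕ} {C C' : Conf (n + 2)} : SC C C' → SC (.res C) (.res C')
  | congPar {n : ℕ} {C C' D D' : Conf n} : SC C C' → SC D D' → SC (.par C D) (.par C' D')

/-- Configuration reduction. Reduction under a configuration context, built from restrictions and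
parallel compositions, is given by `liftPar` and `liftRes`. -/
inductive CRed : {n : ℕ} → Conf n → Conf n → Prop
  /-- `(ν x y) (F[link (w, x)] ∥ C) ⟶ F[()] ∥ C{w/y}`. The side condition says that `D` is
  `C{w/y}`, and that this configuration mentions neither `x` nor `y`, so that it makes sense
  outside their scope; nor does `F` mention them. The name `w` may be `y`. -/
  | link {n : ℕ} (F : TCtx n) (w : Fin (n + 2)) (C : Conf (n + 2)) (D : Conf n)
      (h : C.rename (replace w 1) = D.rename wk2) :
      CRed (.res (.par ((F.rename wk2).plug (.linkVars w 0)) C)) (.par (F.plug .unit) D)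
  /-- `F[new ()] ⟶ (ν x y) F[(x, y)]`, for fresh `x` and `y` -/
  | new {n : ℕ} (F : TCtx n) :
      CRed (F.plug (.capp .new .unit)) (.res ((F.rename wk2).plug (.pair (.var 0) (.var 1))))
  /-- `F[spawn V] ⟶ F[()] ∥ ○ V ()` -/
  | spawn {n : ℕ} (F : TCtx n) {V : Term n} : IsValue V →
      CRed (F.plug (.capp .spawn V)) (.par (F.plug .unit) (.thread .child (.app V .unit)))
  /-- `(ν x y) (F[send (V, x)] ∥ F'[recv y]) ⟶ (ν x y) (F[x] ∥ F'[(V, y)])` -/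
  | send {n : ℕ} (F F' : TCtx (n + 2)) {V : Term (n + 2)} : IsValue V →
      CRed (.res (.par (F.plug (.capp .send (.pair V (.var 0)))) (F'.plug (.capp .recv (.var 1)))))
        (.res (.par (F.plug (.var 0)) (F'.plug (.pair V (.var 1)))))
  /-- `(ν x y) (F[wait x] ∥ F'[close y]) ⟶ F[()] ∥ F'[()]`, where `F` and `F'` mention neither
  `x` nor `y` -/
  | close {n : ℕ} (F F' : TCtx n) :
      CRed (.res (.par ((F.rename wk2).plug (.capp .wait (.var 0)))
          ((F'.rename wk2).plug (.capp .close (.var 1)))))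
        (.par (F.plug .unit) (F'.plug .unit))
  | liftPar {n : ℕ} {C C' : Conf n} (D : Conf n) : CRed C C' → CRed (.par C D) (.par C' D)
  | liftRes {n : ℕ} {C C' : Conf (n + 2)} : CRed C C' → CRed (.res C) (.res C')
  | liftM {n : ℕ} (F : TCtx n) {M M' : Term n} : TRed M M' → CRed (F.plug M) (F.plug M')
  | liftSC {n : ℕ} {C C' D' D : Conf n} : SC C C' → CRed C' D' → SC D' D → CRed C D

/-! Syntactic sugar -/

/-- `let x = M in N`, i.e. `(λ x. N) M`, where the variable `x` of the surrounding scope is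
shadowed in `N`. -/
def Term.letShadow {n : ℕ} (x : Fin n) (M N : Term n) : Term n :=
  .app (.lam (N.rename (rebind x))) M

/-- `λ (). M`, i.e. `λ z. (z; M)`. -/
def Term.lamUnit {n : ℕ} (M : Term n) : Term n :=
  .lam (.andThen (.var 0) (M.rename Fin.succ))

/-- `select inl`, i.e. `λ x. let (y, z) = new () in (close (send (inl y, x)); z)`. -/
def Term.selectInl {n : ℕ} : Term n :=
  .lam (.letPair (.capp .new .unit)
    (.andThen (.capp .close (.capp .send (.pair (.inl (.var 0)) (.var 2)))) (.var 1)))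

/-- `select inr`, i.e. `λ x. let (y, z) = new () in (close (send (inr y, x)); z)`. -/
def Term.selectInr {n : ℕ} : Term n :=
  .lam (.letPair (.capp .new .unit)
    (.andThen (.capp .close (.capp .send (.pair (.inr (.var 0)) (.var 2)))) (.var 1)))

/-- `offer L {inl x ↦ M; inr x ↦ N}`, i.e.
`let (z, w) = recv L in (wait w; case z {inl x ↦ M; inr x ↦ N})`, where the variable `x` of the
surrounding scope is shadowed in `M` and `N`. -/
def Term.offerShadow {n : ℕ} (L : Term n) (x : Fin n) (M N : Term n) : Term n :=
  .letPair (.capp .recv L)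
    (.andThen (.capp .wait (.var 1))
      (.caseSum (.var 0) ((M.rename wk2).rename (rebind (wk2 x)))
        ((N.rename wk2).rename (rebind (wk2 x)))))

/-- `offer L {}`, i.e. `let (z, w) = recv L in (wait w; absurd z)`. -/
def Term.offerEmpty {n : ℕ} (L : Term n) : Term n :=
  .letPair (.capp .recv L) (.andThen (.capp .wait (.var 1)) (.absurd (.var 0)))

end PGV

/-! ### The translation of Priority CP into Priority GV -/

open PGV in
/-- `let x = send (z, x) in M`, in the scope of the names `y` (the index `0`), `z` (the index `1`)
and those of the surrounding scope, for a term `M` that mentions `y` and names of the surrounding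
scope, among them `x`. -/
def sendCont {n : ℕ} (x : Fin n) (M : Term (n + 1)) : Term (n + 2) :=
  .letShadow (wk2 x) (.capp .send (.pair (.var 1) (.var (wk2 x)))) (M.rename (lift Fin.succ))

open PGV in
/-- The translation of processes to terms:
* `x ↔ y` to `link (x, y)`;
* `(ν x y) P` to `let (x, y) = new () in ⟦P⟧`;
* `P ∥ Q` to `spawn (λ (). ⟦P⟧); ⟦Q⟧`;
* `0` to `()`;
* `x[y].P` to `let (y, z) = new () in let x = send (z, x) in ⟦P⟧`;
* `x[].P` to `close x; ⟦P⟧`;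
* `x(y).P` to `let (y, x) = recv x in ⟦P⟧`;
* `x().P` to `wait x; ⟦P⟧`;
* `x ◁ ℓ.P` to `let x = select ℓ x in ⟦P⟧`;
* `x ▷ {inl: P; inr: Q}` to `offer x {inl x ↦ ⟦P⟧; inr x ↦ ⟦Q⟧}`;
* `x ▷ {}` to `offer x {}`. -/
def transM : {n : ℕ} → PCP.Proc n → Term n
  | _, .link x y => .linkVars x y
  | _, .res P => .letPair (.capp .new .unit) (transM P)
  | _, .par P Q => .andThen (.capp .spawn (.lamUnit (transM P))) (transM Q)
  | _, .halt => .unit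
  | _, .send x P => .letPair (.capp .new .unit) (sendCont x (transM P))
  | _, .close x P => .andThen (.capp .close (.var x)) (transM P)
  | _, .recv x P => .letPair (.capp .recv (.var x))
      ((transM P).rename (scons 0 (fun i => if i = x then 1 else wk2 i)))
  | _, .wait x P => .andThen (.capp .wait (.var x)) (transM P)
  | _, .inl x P => .letShadow x (.app .selectInl (.var x)) (transM P)
  | _, .inr x P => .letShadow x (.app .selectInr (.var x)) (transM P)
  | _, .offer x P Q => .offerShadow (.var x) x (transM P) (transM Q)
  | _, .absurd x => .offerEmpty (.var x)

open PGV in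
/-- The translation of processes to configurations:
* `(ν x y) P` to `(ν x y) ⟦P⟧`;
* `P ∥ Q` to `⟦P⟧ ∥ ⟦Q⟧`;
* `x[y].P` to `(ν y z) (○ let x = send (z, x) in ⟦P⟧)`, with the inner `P` translated to a term;
* `x ◁ ℓ.P` to `(ν y z) (○ let x = (close (send (ℓ y, x)); z) in ⟦P⟧)`, likewise;
* any other process `P` to `○ ⟦P⟧`, likewise. -/
def transC : {n : ℕ} → PCP.Proc n → Conf n
  | _, .res P => .res (transC P)
  | _, .par P Q => .par (transC P) (transC Q)
  | _, .send x P => .res (.thread .child (sendCont x (transM P)))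
  | _, .inl x P => .res (.thread .child (.letShadow (wk2 x)
      (.andThen (.capp .close (.capp .send (.pair (.inl (.var 0)) (.var (wk2 x))))) (.var 1))
      ((transM P).rename wk2)))
  | _, .inr x P => .res (.thread .child (.letShadow (wk2 x)
      (.andThen (.capp .close (.capp .send (.pair (.inr (.var 0)) (.var (wk2 x))))) (.var 1))
      ((transM P).rename wk2)))
  | _, .link x y => .thread .child (transM (.link x y))
  | _, .halt => .thread .child (transM .halt)
  | _, .close x P => .thread .child (transM (.close x P))
  | _, .recv x P => .thread .child (transM (.recv x P))
  | _, .wait x P => .thread .child (transM (.wait x P))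
  | _, .offer x P Q => .thread .child (transM (.offer x P Q))
  | _, .absurd x => .thread .child (transM (.absurd x))

/-! ### Names and renamings -/

/-! In `transC P` every thread is either finished or blocked on exactly one redex `K V`, where `K`
is one of `link`, `send`, `recv`, `close`, `wait`. No term reduction, `new` or `spawn` is possible,
because the translation to configurations has already performed all of them. A reduction of `transC
P` is therefore, up to structural congruence, one of the three communication rules, and the two
threads involved reveal the prefixes of `P` that meet. It remains to run the continuations until
they are translations again, and to find the matching reduction of `P`.

The obstacle is structural congruence. An output or a selection is translated with an extra
restriction `(ν y z)` that has no counterpart in `P`, and the congruence can move this restriction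
anywhere above its thread. The relation `Represents ρ Δ C P` allows this: `Δ` lists the extra pairs
whose restriction lies outside of `C`, and `ρ` embeds the names of the process in those of the
configuration. Congruent configurations represent congruent processes (`Represents.sC`), so the
relation survives the closure of reduction under congruence.

When an output meets an input, its pair `(y, z)` becomes the new channel of the reduct. When a
selection meets a branching, the old channel is consumed by the closing signal and the pair replaces
it. In both cases an extra restriction turns into a restriction of the process; the second
alternative of `Simulated` keeps track of this until the induction (`simulated_of_cRed`) reaches the
restriction of that pair.

Typing enters through `Consistent`: dual types at the two ends of a channel exclude, for example, an
output meeting a branching, although both inputs and branchings are translated to `recv`; and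
parallel processes have no names in common, so that substitutions of names do not cause capture.

At the end, all extra restrictions are pushed back to their threads (`Represents.sC_transC`), which
gives a configuration congruent to `transC Q`. This congruence counts as a reduction step, because a
forwarder that is used nowhere else can be created by congruence and then reduced (`SC.cRed`). -/

@[simp] theorem scons_zero {α : Type} {n : ℕ} (a : α) (f : Fin n → α) : scons a f 0 = a := rfl

@[simp] theorem scons_succ {α : Type} {n : ℕ} (a : α) (f : Fin n → α) (i : Fin n) :
    scons a f i.succ = f i := rfl

@[simp] theorem scons_one {α : Type} {n : ℕ} (a b : α) (f : Fin n → α) :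
    scons a (scons b f) 1 = b := rfl

@[simp] theorem scons_wk2 {α : Type} {n : ℕ} (a b : α) (f : Fin n → α) (i : Fin n) :
    scons a (scons b f) (wk2 i) = f i := rfl

@[simp] theorem lift_zero {n m : ℕ} (ρ : Fin n → Fin m) : lift ρ 0 = 0 := rfl

@[simp] theorem lift_succ {n m : ℕ} (ρ : Fin n → Fin m) (i : Fin n) :
    lift ρ i.succ = (ρ i).succ := rfl

@[simp] theorem lift2_zero {n m : ℕ} (ρ : Fin n → Fin m) : lift2 ρ 0 = 0 := rfl

@[simp] theorem lift2_one {n m : ℕ} (ρ : Fin n → Fin m) : lift2 ρ 1 = 1 := rfl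

@[simp] theorem lift2_wk2 {n m : ℕ} (ρ : Fin n → Fin m) (i : Fin n) :
    lift2 ρ (wk2 i) = wk2 (ρ i) := rfl

@[simp] theorem swap2_zero {n : ℕ} : (swap2 : Fin (n + 2) → Fin (n + 2)) 0 = 1 := rfl

@[simp] theorem swap2_one {n : ℕ} : (swap2 : Fin (n + 2) → Fin (n + 2)) 1 = 0 := rfl

@[simp] theorem swap2_wk2 {n : ℕ} (i : Fin n) : swap2 (wk2 i) = wk2 i := rfl

@[simp] theorem exch22_zero {n : ℕ} : (exch22 : Fin (n + 4) → Fin (n + 4)) 0 = wk2 0 := rfl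

@[simp] theorem exch22_one {n : ℕ} : (exch22 : Fin (n + 4) → Fin (n + 4)) 1 = wk2 1 := rfl

@[simp] theorem exch22_wk2_zero {n : ℕ} :
    (exch22 : Fin (n + 4) → Fin (n + 4)) (wk2 (0 : Fin (n + 2))) = 0 := rfl

@[simp] theorem exch22_wk2_one {n : ℕ} :
    (exch22 : Fin (n + 4) → Fin (n + 4)) (wk2 (1 : Fin (n + 2))) = 1 := rfl

@[simp] theorem exch22_wk2_wk2 {n : ℕ} (i : Fin n) :
    exch22 (wk2 (wk2 i)) = wk2 (wk2 i) := rfl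

/-- Case distinction on the names below a binder of two names. -/
theorem forall_fin2 {n : ℕ} {p : Fin (n + 2) → Prop} :
    (∀ i, p i) ↔ p 0 ∧ p 1 ∧ ∀ i, p (wk2 i) :=
  ⟨fun h => ⟨h 0, h 1, fun _ => h _⟩,
    fun ⟨h0, h1, h⟩ i => Fin.cases h0 (fun i => Fin.cases h1 h i) i⟩

theorem forall_fin1 {n : ℕ} {p : Fin (n + 1) → Prop} :
    (∀ i, p i) ↔ p 0 ∧ ∀ i : Fin n, p i.succ :=
  ⟨fun h => ⟨h 0, fun _ => h _⟩, fun ⟨h0, h⟩ i => Fin.cases h0 h i⟩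

theorem wk2_injective {n : ℕ} : Function.Injective (wk2 : Fin n → Fin (n + 2)) :=
  fun _ _ h => Fin.succ_injective _ (Fin.succ_injective _ h)

@[simp] theorem wk2_inj {n : ℕ} {i j : Fin n} : wk2 i = wk2 j ↔ i = j := wk2_injective.eq_iff

@[simp] theorem wk2_ne_zero {n : ℕ} (i : Fin n) : wk2 i ≠ 0 := Fin.succ_ne_zero _

@[simp] theorem wk2_ne_one {n : ℕ} (i : Fin n) : wk2 i ≠ 1 :=
  fun h => Fin.succ_ne_zero i (Fin.succ_injective _ h)

@[simp] theorem zero_ne_wk2 {n : ℕ} (i : Fin n) : 0 ≠ wk2 i := (wk2_ne_zero i).symm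

@[simp] theorem one_ne_wk2 {n : ℕ} (i : Fin n) : 1 ≠ wk2 i := (wk2_ne_one i).symm

@[simp] theorem zero_ne_succ {n : ℕ} (i : Fin n) : (0 : Fin (n + 1)) ≠ i.succ :=
  (Fin.succ_ne_zero i).symm

theorem lift_id {n : ℕ} : lift (id : Fin n → Fin n) = id := by
  funext i; revert i; simp [forall_fin1]

theorem lift2_id {n : ℕ} : lift2 (id : Fin n → Fin n) = id := by
  simp [lift2, lift_id]

theorem lift_comp {n m k : ℕ} (σ : Fin m → Fin k) (ρ : Fin n → Fin m) :
    lift (σ ∘ ρ) = lift σ ∘ lift ρ := by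
  funext i; revert i; simp [forall_fin1]

theorem lift2_comp {n m k : ℕ} (σ : Fin m → Fin k) (ρ : Fin n → Fin m) :
    lift2 (σ ∘ ρ) = lift2 σ ∘ lift2 ρ := by
  simp [lift2, lift_comp]

theorem lift2_eq {n m : ℕ} (ρ : Fin n → Fin m) :
    lift2 ρ = scons 0 (scons 1 (fun i => wk2 (ρ i))) := by
  funext i; revert i; simp [forall_fin2]

theorem lift2_comp_wk2 {n m : ℕ} (ρ : Fin n → Fin m) : lift2 ρ ∘ wk2 = wk2 ∘ ρ := rfl

theorem swap2_comp_swap2 {n : ℕ} : (swap2 ∘ swap2 : Fin (n + 2) → Fin (n + 2)) = id := by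
  funext i; revert i; simp [forall_fin2]

theorem exch22_comp_exch22 {n : ℕ} : (exch22 ∘ exch22 : Fin (n + 4) → Fin (n + 4)) = id := by
  funext i; revert i; simp [forall_fin2]

theorem lift_injective {n m : ℕ} {ρ : Fin n → Fin m} (h : Function.Injective ρ) :
    Function.Injective (lift ρ) := by
  simp only [Function.Injective, forall_fin1]
  simp [Fin.succ_ne_zero, h.eq_iff]

theorem lift2_injective {n m : ℕ} {ρ : Fin n → Fin m} (h : Function.Injective ρ) :
    Function.Injective (lift2 ρ) := lift_injective (lift_injective h)

/-! ### Renaming of processes -/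

namespace PCP

theorem Proc.rename_id {n : ℕ} (P : Proc n) : P.rename id = P := by
  induction P <;> simp_all [Proc.rename, lift_id, lift2_id]

theorem Proc.rename_rename {n m k : ℕ} (σ : Fin m → Fin k) (ρ : Fin n → Fin m) (P : Proc n) :
    (P.rename ρ).rename σ = P.rename (σ ∘ ρ) := by
  induction P generalizing m k <;> simp_all [Proc.rename, lift_comp, lift2_comp]

/-- The free names of a process. -/
def Proc.fv : {n : ℕ} → Proc n → Set (Fin n)
  | _, .link x y => {x, y}
  | _, .res P => wk2 ⁻¹' P.fv
  | _, .par P Q => P.fv ∪ Q.fv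
  | _, .halt => ∅
  | _, .send x P => {x} ∪ Fin.succ ⁻¹' P.fv
  | _, .close x P => {x} ∪ P.fv
  | _, .recv x P => {x} ∪ Fin.succ ⁻¹' P.fv
  | _, .wait x P => {x} ∪ P.fv
  | _, .inl x P => {x} ∪ P.fv
  | _, .inr x P => {x} ∪ P.fv
  | _, .offer x P Q => {x} ∪ (P.fv ∪ Q.fv)
  | _, .absurd x => {x}

end PCP

theorem preimage_succ_image_lift {n m : ℕ} (ρ : Fin n → Fin m) (s : Set (Fin (n + 1))) :
    Fin.succ ⁻¹' (lift ρ '' s) = ρ '' (Fin.succ ⁻¹' s) := by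
  ext i
  simp only [Set.mem_preimage, Set.mem_image]
  constructor
  · rintro ⟨j, hj, h⟩
    revert hj h; revert j
    simp only [forall_fin1]
    refine ⟨by simp, fun j hj h => ⟨j, hj, by simpa using h⟩⟩
  · rintro ⟨j, hj, rfl⟩; exact ⟨_, hj, rfl⟩

theorem preimage_wk2_image_lift2 {n m : ℕ} (ρ : Fin n → Fin m) (s : Set (Fin (n + 2))) :
    wk2 ⁻¹' (lift2 ρ '' s) = ρ '' (wk2 ⁻¹' s) := by
  have h : ∀ k (t : Set (Fin (k + 2))), wk2 ⁻¹' t = Fin.succ ⁻¹' (Fin.succ ⁻¹' t) := fun _ _ => rfl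
  rw [h, h, lift2, preimage_succ_image_lift, preimage_succ_image_lift]

namespace PCP

theorem Proc.fv_rename {n m : ℕ} (ρ : Fin n → Fin m) (P : Proc n) :
    (P.rename ρ).fv = ρ '' P.fv := by
  induction P generalizing m <;>
    simp_all [Proc.rename, Proc.fv, Set.image_union, preimage_succ_image_lift,
      preimage_wk2_image_lift2, Set.image_insert_eq]

end PCP

/-! ### Renamings that agree, are injective or are surjective on a set of names, below binders -/

theorem eqOn_lift {n m : ℕ} {ρ σ : Fin n → Fin m} {s : Set (Fin (n + 1))}
    (h : ∀ i ∈ Fin.succ ⁻¹' s, ρ i = σ i) : ∀ i ∈ s, lift ρ i = lift σ i := by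
  simp only [forall_fin1]
  exact ⟨fun _ => rfl, fun i hi => by simp [h i hi]⟩

theorem eqOn_lift2 {n m : ℕ} {ρ σ : Fin n → Fin m} {s : Set (Fin (n + 2))}
    (h : ∀ i ∈ wk2 ⁻¹' s, ρ i = σ i) : ∀ i ∈ s, lift2 ρ i = lift2 σ i :=
  eqOn_lift (eqOn_lift h)

theorem injOn_lift {n m : ℕ} {ρ : Fin n → Fin m} {s : Set (Fin (n + 1))}
    (h : Set.InjOn ρ (Fin.succ ⁻¹' s)) : Set.InjOn (lift ρ) s := by
  simp only [Set.InjOn, forall_fin1]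
  refine ⟨fun _ => ⟨by simp, by simp⟩, fun i hi => ⟨by simp [Fin.succ_ne_zero], fun j hj e => ?_⟩⟩
  rw [h hi hj (by simpa using e)]

theorem injOn_lift2 {n m : ℕ} {ρ : Fin n → Fin m} {s : Set (Fin (n + 2))}
    (h : Set.InjOn ρ (wk2 ⁻¹' s)) : Set.InjOn (lift2 ρ) s :=
  injOn_lift (injOn_lift h)

theorem subset_range_lift {n m : ℕ} {ρ : Fin n → Fin m} {s : Set (Fin (m + 1))}
    (h : Fin.succ ⁻¹' s ⊆ Set.range ρ) : s ⊆ Set.range (lift ρ) := by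
  simp only [Set.subset_def, forall_fin1]
  refine ⟨fun _ => ⟨0, rfl⟩, fun i hi => ?_⟩
  obtain ⟨j, rfl⟩ := h hi
  exact ⟨j.succ, rfl⟩

theorem subset_range_lift2 {n m : ℕ} {ρ : Fin n → Fin m} {s : Set (Fin (m + 2))}
    (h : wk2 ⁻¹' s ⊆ Set.range ρ) : s ⊆ Set.range (lift2 ρ) :=
  subset_range_lift (subset_range_lift h)

namespace PCP

/-- This is strengthening. For `ρ = wk2` it removes a process from the scope of two names that it
does not mention. -/
theorem Proc.exists_eq_rename {n m : ℕ} {ρ : Fin n → Fin m} (P : Proc m)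
    (h : P.fv ⊆ Set.range ρ) : ∃ P' : Proc n, P = P'.rename ρ := by
  induction P generalizing n with
  | link x y =>
    obtain ⟨a, rfl⟩ := h (.inl rfl)
    obtain ⟨b, rfl⟩ := h (.inr rfl)
    exact ⟨.link a b, rfl⟩
  | res P ih =>
    obtain ⟨P', rfl⟩ := ih (subset_range_lift2 h)
    exact ⟨.res P', rfl⟩
  | par P Q ihP ihQ =>
    obtain ⟨P', rfl⟩ := ihP fun i hi => h (.inl hi)
    obtain ⟨Q', rfl⟩ := ihQ fun i hi => h (.inr hi)
    exact ⟨.par P' Q', rfl⟩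
  | halt => exact ⟨.halt, rfl⟩
  | send x P ih =>
    obtain ⟨a, rfl⟩ := h (.inl rfl)
    obtain ⟨P', rfl⟩ := ih (subset_range_lift fun i hi => h (.inr hi))
    exact ⟨.send a P', rfl⟩
  | close x P ih =>
    obtain ⟨a, rfl⟩ := h (.inl rfl)
    obtain ⟨P', rfl⟩ := ih fun i hi => h (.inr hi)
    exact ⟨.close a P', rfl⟩
  | recv x P ih =>
    obtain ⟨a, rfl⟩ := h (.inl rfl)
    obtain ⟨P', rfl⟩ := ih (subset_range_lift fun i hi => h (.inr hi))
    exact ⟨.recv a P', rfl⟩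
  | wait x P ih =>
    obtain ⟨a, rfl⟩ := h (.inl rfl)
    obtain ⟨P', rfl⟩ := ih fun i hi => h (.inr hi)
    exact ⟨.wait a P', rfl⟩
  | inl x P ih =>
    obtain ⟨a, rfl⟩ := h (.inl rfl)
    obtain ⟨P', rfl⟩ := ih fun i hi => h (.inr hi)
    exact ⟨.inl a P', rfl⟩
  | inr x P ih =>
    obtain ⟨a, rfl⟩ := h (.inl rfl)
    obtain ⟨P', rfl⟩ := ih fun i hi => h (.inr hi)
    exact ⟨.inr a P', rfl⟩
  | offer x P Q ihP ihQ =>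
    obtain ⟨a, rfl⟩ := h (.inl rfl)
    obtain ⟨P', rfl⟩ := ihP fun i hi => h (.inr (.inl hi))
    obtain ⟨Q', rfl⟩ := ihQ fun i hi => h (.inr (.inr hi))
    exact ⟨.offer a P' Q', rfl⟩
  | absurd x =>
    obtain ⟨a, rfl⟩ := h rfl
    exact ⟨.absurd a, rfl⟩

/-- Structural congruence preserves the free names. -/
theorem SC.fv_eq {n : ℕ} {P Q : Proc n} (h : SC P Q) : P.fv = Q.fv := by
  induction h with
  | linkSwap x y => exact Set.pair_comm x y
  | resLink => ext i; simp [Proc.fv]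
  | @resSwap n P =>
    simp only [Proc.fv, Proc.fv_rename]
    ext i
    simp only [Set.mem_preimage, Set.mem_image]
    refine ⟨fun h => ⟨_, h, rfl⟩, ?_⟩
    rintro ⟨j, hj, h⟩
    -- `swap2` is its own inverse and fixes `wk2 i`, so nothing else is mapped to `wk2 i`.
    have : j = wk2 i := by
      have := congrArg swap2 h
      simpa using (congrFun swap2_comp_swap2 j).symm.trans this
    exact this ▸ hj
  | @resComm n P =>
    simp only [Proc.fv, Proc.fv_rename]
    ext i
    simp only [Set.mem_preimage, Set.mem_image]
    refine ⟨fun h => ⟨_, h, rfl⟩, ?_⟩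
    rintro ⟨j, hj, h⟩
    have : j = wk2 (wk2 i) := by
      have := congrArg exch22 h
      simpa using (congrFun exch22_comp_exch22 j).symm.trans this
    exact this ▸ hj
  | resExt P Q => ext i; simp [Proc.fv, Proc.fv_rename]
  | parNil P => simp [Proc.fv]
  | parComm P Q => exact Set.union_comm _ _
  | parAssoc P Q R => exact (Set.union_assoc _ _ _).symm
  | refl P => rfl
  | symm _ ih => exact ih.symm
  | trans _ _ ih₁ ih₂ => exact ih₁.trans ih₂
  | congRes _ ih => simp [Proc.fv, ih]
  | congPar _ _ ih₁ ih₂ => simp [Proc.fv, ih₁, ih₂]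

/-! ### Consistency of processes -/

theorem Ty.dual_dual (A : Ty) : A.dual.dual = A := by
  induction A <;> simp_all [Ty.dual]

/-- The unguarded prefixes of `P` use their names in accordance with `Γ`, dually at both ends of
every channel, and parallel processes have no names in common. In contrast to `Typed`, this is
invariant under structural congruence: a process typed by `Typed` may own names that do not occur
in it, by the rule for `⊤`. -/
def Consistent : {n : ℕ} → Proc n → (Fin n → Ty) → Prop
  | _, .link x y, Γ => Γ y = (Γ x).dual
  | _, .res P, Γ => ∃ A, Consistent P (scons A (scons A.dual Γ))
  | _, .par P Q, Γ => Consistent P Γ ∧ Consistent Q Γ ∧ Disjoint P.fv Q.fv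
  | _, .halt, _ => True
  | _, .send x _, Γ => ∃ o A B, Γ x = .tens o A B
  | _, .close x _, Γ => ∃ o, Γ x = .one o
  | _, .recv x _, Γ => ∃ o A B, Γ x = .parr o A B
  | _, .wait x _, Γ => ∃ o, Γ x = .bot o
  | _, .inl x _, Γ => ∃ o A B, Γ x = .plus o A B
  | _, .inr x _, Γ => ∃ o A B, Γ x = .plus o A B
  | _, .offer x _ _, Γ => ∃ o A B, Γ x = .amp o A B
  | _, .absurd x, Γ => ∃ o, Γ x = .top o

theorem scons_comp_lift2 {n m : ℕ} (ρ : Fin n → Fin m) (A B : Ty) (Γ : Fin m → Ty) :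
    scons A (scons B Γ) ∘ lift2 ρ = scons A (scons B (Γ ∘ ρ)) := by
  funext i; revert i; simp [forall_fin2]

/-- Injectivity is needed for parallel compositions: identifying two names could destroy the
disjointness of the free names. -/
theorem consistent_rename {n m : ℕ} {ρ : Fin n → Fin m} (hρ : Function.Injective ρ)
    {P : Proc n} {Γ : Fin m → Ty} : Consistent (P.rename ρ) Γ ↔ Consistent P (Γ ∘ ρ) := by
  induction P generalizing m with
  | res P ih =>
    simp only [Proc.rename, Consistent, ih (lift2_injective hρ), scons_comp_lift2]
  | par P Q ihP ihQ =>
    simp only [Proc.rename, Consistent, ihP hρ, ihQ hρ, Proc.fv_rename,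
      Set.disjoint_image_iff hρ]
  | _ => simp [Proc.rename, Consistent]

/-- Reduction is closed under structural congruence, so the induction over a reduction passes to
congruent processes and needs an invariant that they share. -/
theorem SC.consistent_iff {n : ℕ} {P Q : Proc n} (h : SC P Q) (Γ : Fin n → Ty) :
    Consistent P Γ ↔ Consistent Q Γ := by
  induction h with
  | linkSwap x y =>
    simp only [Consistent]
    constructor <;> intro h <;> rw [h, Ty.dual_dual]
  -- Any type serves for the channel of a lone forwarder.
  | resLink => simp only [Consistent, iff_true]; exact ⟨.one 0, rfl⟩
  | @resSwap n P =>
    have hs : Function.Injective (swap2 : Fin (n + 2) → Fin (n + 2)) :=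
      (Function.LeftInverse.injective (g := swap2) (congrFun swap2_comp_swap2))
    have key : ∀ A : Ty, (scons A.dual (scons A Γ) ∘ swap2 : Fin (n + 2) → Ty) =
        scons A (scons A.dual Γ) := by
      intro A; funext i; revert i; simp [forall_fin2]
    simp only [Consistent, consistent_rename hs]
    constructor
    -- Exchanging the two ends of the channel dualises its type.
    · rintro ⟨A, h⟩; exact ⟨A.dual, by rwa [Ty.dual_dual, key]⟩
    · rintro ⟨A, h⟩; refine ⟨A.dual, ?_⟩
      rw [← key, Ty.dual_dual]; exact h
  | @resComm n P =>
    have hs : Function.Injective (exch22 : Fin (n + 4) → Fin (n + 4)) :=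
      (Function.LeftInverse.injective (g := exch22) (congrFun exch22_comp_exch22))
    have key : ∀ A B A' B' : Ty, (scons A (scons B (scons A' (scons B' Γ))) ∘ exch22) =
        scons A' (scons B' (scons A (scons B Γ))) := by
      intro A B A' B'; funext i; revert i; simp [forall_fin2]
    simp only [Consistent, consistent_rename hs, key]
    exact exists_comm
  | resExt P Q =>
    have key : ∀ A B : Ty, (scons A (scons B Γ) ∘ wk2) = Γ := fun _ _ => rfl
    simp only [Consistent, consistent_rename wk2_injective, key, Proc.fv_rename, Proc.fv,
      Set.disjoint_image_left]
    constructor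
    · rintro ⟨A, h1, h2, h3⟩; exact ⟨h1, ⟨A, h2⟩, h3⟩
    · rintro ⟨h1, ⟨A, h2⟩, h3⟩; exact ⟨A, h1, h2, h3⟩
  | parNil P => simp [Consistent, Proc.fv]
  | parComm P Q => simp only [Consistent, disjoint_comm (a := P.fv)]; tauto
  | parAssoc P Q R =>
    simp only [Consistent, Proc.fv, Set.disjoint_union_left, Set.disjoint_union_right]; tauto
  | refl P => rfl
  | symm _ ih => exact (ih Γ).symm
  | trans _ _ ih₁ ih₂ => exact (ih₁ Γ).trans (ih₂ Γ)
  | congRes _ ih => simp [Consistent, ih]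
  | congPar h₁ h₂ ih₁ ih₂ => simp [Consistent, ih₁, ih₂, h₁.fv_eq, h₂.fv_eq]

end PCP

namespace PGV

/-! ### Renaming and substitution of terms -/

theorem Term.rename_id {n : ℕ} (M : Term n) : M.rename id = M := by
  induction M <;> simp_all [Term.rename, lift_id, lift2_id]

theorem Term.rename_rename {n m k : ℕ} (σ : Fin m → Fin k) (ρ : Fin n → Fin m) (M : Term n) :
    (M.rename ρ).rename σ = M.rename (σ ∘ ρ) := by
  induction M generalizing m k <;> simp_all [Term.rename, lift_comp, lift2_comp]

theorem liftSubst_comp_lift {n m k : ℕ} (σ : Fin m → Term k) (ρ : Fin n → Fin m) :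
    liftSubst (σ ∘ ρ) = liftSubst σ ∘ lift ρ := by
  funext i; revert i; simp [forall_fin1, liftSubst]

theorem Term.subst_rename {n m k : ℕ} (σ : Fin m → Term k) (ρ : Fin n → Fin m) (M : Term n) :
    (M.rename ρ).subst σ = M.subst (σ ∘ ρ) := by
  induction M generalizing m k <;>
    simp_all [Term.rename, Term.subst, liftSubst_comp_lift, lift2]

theorem rename_comp_liftSubst {n m k : ℕ} (ρ : Fin m → Fin k) (σ : Fin n → Term m) :
    liftSubst (Term.rename ρ ∘ σ) = Term.rename (lift ρ) ∘ liftSubst σ := by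
  funext i; revert i
  simp only [forall_fin1, liftSubst, scons_zero, scons_succ, Function.comp_apply, Term.rename,
    lift_zero, Term.rename_rename, true_and]
  exact fun i => rfl

theorem Term.rename_subst {n m k : ℕ} (ρ : Fin m → Fin k) (σ : Fin n → Term m) (M : Term n) :
    (M.subst σ).rename ρ = M.subst (Term.rename ρ ∘ σ) := by
  induction M generalizing m k <;>
    simp_all [Term.rename, Term.subst, rename_comp_liftSubst, lift2]

theorem liftSubst_var {n m : ℕ} (ρ : Fin n → Fin m) :
    liftSubst (Term.var ∘ ρ) = Term.var ∘ lift ρ := by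
  funext i; revert i; simp [forall_fin1, liftSubst, Term.rename]

theorem Term.subst_var {n m : ℕ} (ρ : Fin n → Fin m) (M : Term n) :
    M.subst (Term.var ∘ ρ) = M.rename ρ := by
  induction M generalizing m <;>
    simp_all [Term.rename, Term.subst, liftSubst_var, lift2]

theorem scons_var {n m : ℕ} (a : Fin m) (ρ : Fin n → Fin m) :
    scons (Term.var a) (Term.var ∘ ρ) = Term.var ∘ scons a ρ := by
  funext i; revert i; simp [forall_fin1]

/-- The values substituted in the simulation are mostly names. Their substitution is then a
renaming, and the results are compared as compositions of renamings. -/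
theorem Term.inst_var {n : ℕ} (M : Term (n + 1)) (a : Fin n) :
    M.inst (.var a) = M.rename (scons a id) := by
  rw [← Term.subst_var, ← scons_var]; rfl

theorem Term.inst2_var {n : ℕ} (M : Term (n + 2)) (a b : Fin n) :
    M.inst2 (.var a) (.var b) = M.rename (scons a (scons b id)) := by
  rw [← Term.subst_var, ← scons_var, ← scons_var]; rfl

theorem Term.inst_rename_succ {n : ℕ} (M V : Term n) : (M.rename Fin.succ).inst V = M := by
  rw [Term.inst, Term.subst_rename]
  exact (Term.subst_var id M).trans M.rename_id

theorem Term.rename_inst {n m : ℕ} (ρ : Fin n → Fin m) (M : Term (n + 1)) (V : Term n) :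
    (M.inst V).rename ρ = (M.rename (lift ρ)).inst (V.rename ρ) := by
  rw [Term.inst, Term.inst, Term.rename_subst, Term.subst_rename]
  congr 1; funext i; revert i; simp [forall_fin1, Term.rename]

theorem Term.rename_inst2 {n m : ℕ} (ρ : Fin n → Fin m) (M : Term (n + 2)) (V W : Term n) :
    (M.inst2 V W).rename ρ = (M.rename (lift2 ρ)).inst2 (V.rename ρ) (W.rename ρ) := by
  rw [Term.inst2, Term.inst2, Term.rename_subst, Term.subst_rename]
  congr 1; funext i; revert i; simp [forall_fin2, Term.rename]

/-- The free variables of a term. -/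
def Term.fv : {n : ℕ} → Term n → Set (Fin n)
  | _, .var x => {x}
  | _, .const _ => ∅
  | _, .lam M => Fin.succ ⁻¹' M.fv
  | _, .app M N => M.fv ∪ N.fv
  | _, .unit => ∅
  | _, .andThen M N => M.fv ∪ N.fv
  | _, .pair M N => M.fv ∪ N.fv
  | _, .letPair M N => M.fv ∪ wk2 ⁻¹' N.fv
  | _, .inl M => M.fv
  | _, .inr M => M.fv
  | _, .caseSum L M N => L.fv ∪ (Fin.succ ⁻¹' M.fv ∪ Fin.succ ⁻¹' N.fv)
  | _, .absurd M => M.fv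

theorem Term.fv_rename {n m : ℕ} (ρ : Fin n → Fin m) (M : Term n) :
    (M.rename ρ).fv = ρ '' M.fv := by
  induction M generalizing m <;>
    simp_all [Term.rename, Term.fv, Set.image_union, preimage_succ_image_lift,
      preimage_wk2_image_lift2]

/-- This compares renamings that differ on shadowed names or on names that do not occur. -/
theorem Term.rename_congr {n m : ℕ} {ρ σ : Fin n → Fin m} (M : Term n)
    (h : ∀ i ∈ M.fv, ρ i = σ i) : M.rename ρ = M.rename σ := by
  induction M generalizing m with
  | var x => simp [Term.rename, h x rfl]
  | const K => rfl
  | lam M ih => simp [Term.rename, ih (eqOn_lift h)]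
  | app M N ihM ihN =>
    simp [Term.rename, ihM fun i hi => h i (.inl hi), ihN fun i hi => h i (.inr hi)]
  | unit => rfl
  | andThen M N ihM ihN =>
    simp [Term.rename, ihM fun i hi => h i (.inl hi), ihN fun i hi => h i (.inr hi)]
  | pair M N ihM ihN =>
    simp [Term.rename, ihM fun i hi => h i (.inl hi), ihN fun i hi => h i (.inr hi)]
  | letPair M N ihM ihN =>
    simp [Term.rename, ihM fun i hi => h i (.inl hi),
      ihN (eqOn_lift2 fun i hi => h i (.inr hi))]
  | inl M ih => simp [Term.rename, ih h]
  | inr M ih => simp [Term.rename, ih h]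
  | caseSum L M N ihL ihM ihN =>
    simp [Term.rename, ihL fun i hi => h i (.inl hi),
      ihM (eqOn_lift fun i hi => h i (.inr (.inl hi))),
      ihN (eqOn_lift fun i hi => h i (.inr (.inr hi)))]
  | absurd M ih => simp [Term.rename, ih h]

theorem Term.rename_injective {n m : ℕ} {ρ : Fin n → Fin m} (hρ : Function.Injective ρ) :
    Function.Injective (Term.rename ρ) := by
  intro M N h
  induction M generalizing m with
  | var x => cases N <;> simp_all [Term.rename, hρ.eq_iff]
  | const K => cases N <;> simp_all [Term.rename]
  | lam M ih =>
    cases N <;> simp only [Term.rename, reduceCtorEq, Term.lam.injEq] at h ⊢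
    exact ih (lift_injective hρ) h
  | app M N ihM ihN =>
    cases ‹Term _› <;> simp only [Term.rename, reduceCtorEq, Term.app.injEq] at h ⊢
    exact ⟨ihM hρ h.1, ihN hρ h.2⟩
  | unit => cases N <;> simp_all [Term.rename]
  | andThen M N ihM ihN =>
    cases ‹Term _› <;> simp only [Term.rename, reduceCtorEq, Term.andThen.injEq] at h ⊢
    exact ⟨ihM hρ h.1, ihN hρ h.2⟩
  | pair M N ihM ihN =>
    cases ‹Term _› <;> simp only [Term.rename, reduceCtorEq, Term.pair.injEq] at h ⊢
    exact ⟨ihM hρ h.1, ihN hρ h.2⟩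
  | letPair M N ihM ihN =>
    cases ‹Term _› <;> simp only [Term.rename, reduceCtorEq, Term.letPair.injEq] at h ⊢
    exact ⟨ihM hρ h.1, ihN (lift2_injective hρ) h.2⟩
  | inl M ih =>
    cases N <;> simp only [Term.rename, reduceCtorEq, Term.inl.injEq] at h ⊢
    exact ih hρ h
  | inr M ih =>
    cases N <;> simp only [Term.rename, reduceCtorEq, Term.inr.injEq] at h ⊢
    exact ih hρ h
  | caseSum L M N ihL ihM ihN =>
    cases ‹Term _› <;> simp only [Term.rename, reduceCtorEq, Term.caseSum.injEq] at h ⊢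
    exact ⟨ihL hρ h.1, ihM (lift_injective hρ) h.2.1, ihN (lift_injective hρ) h.2.2⟩
  | absurd M ih =>
    cases N <;> simp only [Term.rename, reduceCtorEq, Term.absurd.injEq] at h ⊢
    exact ih hρ h

/-! ### Evaluation contexts -/

theorem ECtx.rename_rename {n m k : ℕ} (σ : Fin m → Fin k) (ρ : Fin n → Fin m) (E : ECtx n) :
    (E.rename ρ).rename σ = E.rename (σ ∘ ρ) := by
  induction E <;>
    simp_all [ECtx.rename, Term.rename_rename, lift_comp, lift2_comp]

theorem ECtx.rename_plug {n m : ℕ} (ρ : Fin n → Fin m) (E : ECtx n) (M : Term n) :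
    (E.plug M).rename ρ = (E.rename ρ).plug (M.rename ρ) := by
  induction E <;> simp_all [ECtx.rename, ECtx.plug, Term.rename]

theorem not_isValue_app {n : ℕ} {M N : Term n} : ¬ IsValue (.app M N) := nofun

/-- A value has only values in its evaluation positions. -/
theorem ECtx.not_isValue_plug {n : ℕ} (E : ECtx n) {M : Term n} (hM : ¬ IsValue M) :
    ¬ IsValue (E.plug M) := by
  induction E <;> intro h <;> simp only [ECtx.plug] at h <;> first | exact hM h | (cases h; try tauto)

/-- The decomposition of a term into an evaluation context and an applied constant is unique. -/
theorem ECtx.plug_capp_inj {n : ℕ} {E E' : ECtx n} {K K' : Const} {V V' : Term n}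
    (hV : IsValue V) (hV' : IsValue V') (h : E.plug (.capp K V) = E'.plug (.capp K' V')) :
    E = E' ∧ K = K' ∧ V = V' := by
  -- If the two contexts take different directions, one of them requires a value where the other has
  -- its redex. This refutes every mismatched case.
  have key : ∀ (E : ECtx n) {K V}, ¬ IsValue (E.plug (.capp K V)) :=
    fun E => E.not_isValue_plug not_isValue_app
  induction E generalizing E' with
  | hole =>
    cases E' <;> simp only [ECtx.plug, Term.capp, reduceCtorEq, Term.app.injEq,
      Term.const.injEq] at h
    · simpa using h
    · exact _root_.absurd (h.1 ▸ IsValue.const K) (key _)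
    · exact _root_.absurd (h.2 ▸ hV) (key _)
  | appL E M ih =>
    cases E' <;> simp only [ECtx.plug, reduceCtorEq, Term.app.injEq] at h
    · simp only [Term.capp, Term.app.injEq] at h
      exact _root_.absurd (h.1 ▸ IsValue.const K') (key E)
    · obtain ⟨h1, h2⟩ := h; obtain ⟨rfl, h3⟩ := ih h1; exact ⟨by rw [h2], h3⟩
    · rename_i V hV _; exact _root_.absurd (h.1 ▸ hV) (key E)
  | appR W hW E ih =>
    cases E' <;> simp only [ECtx.plug, reduceCtorEq, Term.app.injEq] at h
    · simp only [Term.capp, Term.app.injEq] at h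
      exact _root_.absurd (h.2 ▸ hV') (key E)
    · exact _root_.absurd (h.1 ▸ hW) (key _)
    · obtain ⟨rfl, h2⟩ := h; obtain ⟨rfl, h3⟩ := ih h2; exact ⟨rfl, h3⟩
  | andThen E N ih =>
    cases E' <;> simp only [ECtx.plug, Term.capp, reduceCtorEq, Term.andThen.injEq] at h
    obtain ⟨h1, rfl⟩ := h; obtain ⟨rfl, h3⟩ := ih h1; exact ⟨rfl, h3⟩
  | pairL E N ih =>
    cases E' <;> simp only [ECtx.plug, Term.capp, reduceCtorEq, Term.pair.injEq] at h
    · obtain ⟨h1, rfl⟩ := h; obtain ⟨rfl, h3⟩ := ih h1; exact ⟨rfl, h3⟩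
    · rename_i V hV _; exact _root_.absurd (h.1 ▸ hV) (key E)
  | pairR W hW E ih =>
    cases E' <;> simp only [ECtx.plug, Term.capp, reduceCtorEq, Term.pair.injEq] at h
    · exact _root_.absurd (h.1 ▸ hW) (key _)
    · obtain ⟨rfl, h2⟩ := h; obtain ⟨rfl, h3⟩ := ih h2; exact ⟨rfl, h3⟩
  | letPair E N ih =>
    cases E' <;> simp only [ECtx.plug, Term.capp, reduceCtorEq, Term.letPair.injEq] at h
    obtain ⟨h1, rfl⟩ := h; obtain ⟨rfl, h3⟩ := ih h1; exact ⟨rfl, h3⟩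
  | inl E ih =>
    cases E' <;> simp only [ECtx.plug, Term.capp, reduceCtorEq, Term.inl.injEq] at h
    obtain ⟨rfl, h3⟩ := ih h; exact ⟨rfl, h3⟩
  | inr E ih =>
    cases E' <;> simp only [ECtx.plug, Term.capp, reduceCtorEq, Term.inr.injEq] at h
    obtain ⟨rfl, h3⟩ := ih h; exact ⟨rfl, h3⟩
  | caseSum E M N ih =>
    cases E' <;> simp only [ECtx.plug, Term.capp, reduceCtorEq, Term.caseSum.injEq] at h
    obtain ⟨h1, rfl, rfl⟩ := h; obtain ⟨rfl, h3⟩ := ih h1; exact ⟨rfl, h3⟩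
  | absurd E ih =>
    cases E' <;> simp only [ECtx.plug, Term.capp, reduceCtorEq, Term.absurd.injEq] at h
    obtain ⟨rfl, h3⟩ := ih h; exact ⟨rfl, h3⟩

theorem TRed.not_isValue {n : ℕ} {M M' : Term n} (h : TRed M M') : ¬ IsValue M := by
  induction h with
  | lift E _ ih => exact E.not_isValue_plug ih
  | _ => nofun

/-- Evaluation order is deterministic: the two contexts follow the same path as long as both go on.
The path to `M` cannot end inside `K` or `V`, which are values, so the redex `K V` lies within `M`.
-/
theorem ECtx.exists_of_plug_eq_plug_capp {n : ℕ} (E' E : ECtx n) {M : Term n} {K : Const}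
    {V : Term n} (hM : ¬ IsValue M) (hV : IsValue V) (h : E'.plug M = E.plug (.capp K V)) :
    ∃ E'' : ECtx n, M = E''.plug (.capp K V) := by
  have key : ∀ {n} (E : ECtx n) {K V}, ¬ IsValue (E.plug (.capp K V)) :=
    fun E => E.not_isValue_plug not_isValue_app
  induction E' generalizing E with
  | hole => exact ⟨E, h⟩
  | appL E' N ih =>
    cases E <;> simp only [ECtx.plug, Term.capp, reduceCtorEq, Term.app.injEq] at h
    · exact _root_.absurd (h.1 ▸ IsValue.const K) (E'.not_isValue_plug hM)
    · exact ih _ h.1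
    · rename_i W hW _; exact _root_.absurd (h.1 ▸ hW) (E'.not_isValue_plug hM)
  | appR W hW E' ih =>
    cases E <;> simp only [ECtx.plug, Term.capp, reduceCtorEq, Term.app.injEq] at h
    · exact _root_.absurd (h.2 ▸ hV) (E'.not_isValue_plug hM)
    · exact _root_.absurd (h.1 ▸ hW) (key _)
    · exact ih _ h.2
  | andThen E' N ih =>
    cases E <;> simp only [ECtx.plug, Term.capp, reduceCtorEq, Term.andThen.injEq] at h
    exact ih _ h.1
  | pairL E' N ih =>
    cases E <;> simp only [ECtx.plug, Term.capp, reduceCtorEq, Term.pair.injEq] at h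
    · exact ih _ h.1
    · rename_i W hW _; exact _root_.absurd (h.1 ▸ hW) (E'.not_isValue_plug hM)
  | pairR W hW E' ih =>
    cases E <;> simp only [ECtx.plug, Term.capp, reduceCtorEq, Term.pair.injEq] at h
    · exact _root_.absurd (h.1 ▸ hW) (key _)
    · exact ih _ h.2
  | letPair E' N ih =>
    cases E <;> simp only [ECtx.plug, Term.capp, reduceCtorEq, Term.letPair.injEq] at h
    exact ih _ h.1
  | inl E' ih =>
    cases E <;> simp only [ECtx.plug, Term.capp, reduceCtorEq, Term.inl.injEq] at h
    exact ih _ h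
  | inr E' ih =>
    cases E <;> simp only [ECtx.plug, Term.capp, reduceCtorEq, Term.inr.injEq] at h
    exact ih _ h
  | caseSum E' M N ih =>
    cases E <;> simp only [ECtx.plug, Term.capp, reduceCtorEq, Term.caseSum.injEq] at h
    exact ih _ h.1
  | absurd E' ih =>
    cases E <;> simp only [ECtx.plug, Term.capp, reduceCtorEq, Term.absurd.injEq] at h
    exact ih _ h

/-- A term with an applied constant in evaluation position does not reduce. -/
theorem TRed.ne_plug_capp {n : ℕ} {M M' : Term n} (h : TRed M M') (E : ECtx n) {K : Const}
    {V : Term n} (hV : IsValue V) : M ≠ E.plug (.capp K V) := by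
  have key : ∀ {n} (E : ECtx n) {K V}, ¬ IsValue (E.plug (.capp K V)) :=
    fun E => E.not_isValue_plug not_isValue_app
  -- Each basic redex eliminates a value, so it has no room for the non-value `K V` in evaluation
  -- position.
  induction h generalizing E with
  | lam M hW =>
    intro h
    cases E <;> simp only [ECtx.plug, Term.capp, reduceCtorEq, Term.app.injEq, false_and] at h
    · exact _root_.absurd (h.1 ▸ IsValue.lam M) (key _)
    · exact _root_.absurd (h.2 ▸ hW) (key _)
  | unit M =>
    intro h
    cases E <;> simp only [ECtx.plug, Term.capp, reduceCtorEq, Term.andThen.injEq] at h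
    exact _root_.absurd (h.1 ▸ IsValue.unit) (key _)
  | pair M hW hW' =>
    intro h
    cases E <;> simp only [ECtx.plug, Term.capp, reduceCtorEq, Term.letPair.injEq] at h
    exact _root_.absurd (h.1 ▸ IsValue.pair hW hW') (key _)
  | inl M N hW =>
    intro h
    cases E <;> simp only [ECtx.plug, Term.capp, reduceCtorEq, Term.caseSum.injEq] at h
    exact _root_.absurd (h.1 ▸ IsValue.inl hW) (key _)
  | inr M N hW =>
    intro h
    cases E <;> simp only [ECtx.plug, Term.capp, reduceCtorEq, Term.caseSum.injEq] at h
    exact _root_.absurd (h.1 ▸ IsValue.inr hW) (key _)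
  | lift E' hM ih =>
    intro h
    obtain ⟨E'', h''⟩ := E'.exists_of_plug_eq_plug_capp E hM.not_isValue hV h
    exact ih E'' h''

end PGV

/-! ### Renaming of the translation -/

open PGV PCP

theorem rebind_self {n : ℕ} (x : Fin n) : rebind x x = 0 := if_pos rfl

theorem rebind_of_ne {n : ℕ} {x i : Fin n} (h : i ≠ x) : rebind x i = i.succ := if_neg h

theorem preimage_succ_image_rebind {n : ℕ} (x : Fin n) (s : Set (Fin n)) :
    Fin.succ ⁻¹' (rebind x '' s) = s \ {x} := by
  ext i
  simp only [Set.mem_preimage, Set.mem_image, Set.mem_sdiff, Set.mem_singleton_iff]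
  constructor
  · rintro ⟨j, hj, h⟩
    by_cases hx : j = x
    · rw [hx, rebind_self] at h; exact (zero_ne_succ _ h).elim
    · rw [rebind_of_ne hx, Fin.succ_inj] at h; exact h ▸ ⟨hj, hx⟩
  · rintro ⟨hi, hx⟩; exact ⟨i, hi, rebind_of_ne hx⟩

/-- The renaming used to translate an input on `x`. -/
def rebind2 {n : ℕ} (x : Fin n) : Fin (n + 1) → Fin (n + 2) :=
  scons 0 (fun i => if i = x then 1 else wk2 i)

@[simp] theorem rebind2_zero {n : ℕ} (x : Fin n) : rebind2 x 0 = 0 := rfl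

theorem rebind2_self {n : ℕ} (x : Fin n) : rebind2 x x.succ = 1 := if_pos rfl

theorem rebind2_of_ne {n : ℕ} {x i : Fin n} (h : i ≠ x) : rebind2 x i.succ = wk2 i := if_neg h

theorem preimage_wk2_image_rebind2 {n : ℕ} (x : Fin n) (s : Set (Fin (n + 1))) :
    wk2 ⁻¹' (rebind2 x '' s) = (Fin.succ ⁻¹' s) \ {x} := by
  ext i
  simp only [Set.mem_preimage, Set.mem_image, Set.mem_sdiff, Set.mem_singleton_iff]
  constructor
  · rintro ⟨j, hj, h⟩
    revert hj h; revert j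
    simp only [forall_fin1]
    refine ⟨by simp, fun j hj h => ?_⟩
    by_cases hx : j = x
    · rw [hx, rebind2_self] at h; exact (one_ne_wk2 _ h).elim
    · rw [rebind2_of_ne hx, wk2_inj] at h; exact h ▸ ⟨hj, hx⟩
  · rintro ⟨hi, hx⟩; exact ⟨_, hi, rebind2_of_ne hx⟩

theorem lift_comp_rebind {n m : ℕ} {ρ : Fin n → Fin m} {x i : Fin n}
    (h : ρ i = ρ x → i = x) : lift ρ (rebind x i) = rebind (ρ x) (ρ i) := by
  by_cases hx : i = x
  · rw [hx, rebind_self, rebind_self, lift_zero]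
  · rw [rebind_of_ne hx, rebind_of_ne fun e => hx (h e), lift_succ]

theorem lift2_comp_rebind2 {n m : ℕ} {ρ : Fin n → Fin m} {x i : Fin n}
    (h : ρ i = ρ x → i = x) : lift2 ρ (rebind2 x i.succ) = rebind2 (ρ x) (ρ i).succ := by
  by_cases hx : i = x
  · rw [hx, rebind2_self, rebind2_self, lift2_one]
  · rw [rebind2_of_ne hx, rebind2_of_ne fun e => hx (h e), lift2_wk2]

/-- If `ρ` identified another free name with `x`, that name would be captured by the binder that
shadows `x`. Injectivity on the names that occur excludes this. -/
theorem rename_rebind {n m : ℕ} {ρ : Fin n → Fin m} {x : Fin n} (M : Term n)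
    (h : Set.InjOn ρ ({x} ∪ M.fv)) :
    (M.rename (rebind x)).rename (lift ρ) = (M.rename ρ).rename (rebind (ρ x)) := by
  simp only [Term.rename_rename]
  exact M.rename_congr fun i hi => lift_comp_rebind fun e => h (.inr hi) (.inl rfl) e

theorem rename_rebind2 {n m : ℕ} {ρ : Fin n → Fin m} {x : Fin n} (M : Term (n + 1))
    (h : Set.InjOn ρ ({x} ∪ Fin.succ ⁻¹' M.fv)) :
    (M.rename (rebind2 x)).rename (lift2 ρ) = (M.rename (lift ρ)).rename (rebind2 (ρ x)) := by
  simp only [Term.rename_rename]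
  refine M.rename_congr ?_
  simp only [forall_fin1]
  exact ⟨fun _ => rfl, fun i hi => lift2_comp_rebind2 fun e => h (.inr hi) (.inl rfl) e⟩

/-- The body of the thread that results from a selection on `x`, where `V` is the selected
injection of the index `0`. -/
def selectCont {n : ℕ} (x : Fin n) (V : Term (n + 2)) (M : Term n) : Term (n + 2) :=
  .letShadow (wk2 x) (.andThen (.capp .close (.capp .send (.pair V (.var (wk2 x))))) (.var 1))
    (M.rename wk2)

/-- The processes other than parallel compositions and restrictions that are translated to single
threads. -/
inductive Guard : {n : ℕ} → Proc n → Prop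
  | link {n : ℕ} (x y : Fin n) : Guard (.link x y)
  | halt {n : ℕ} : Guard (.halt : Proc n)
  | close {n : ℕ} (x : Fin n) (P : Proc n) : Guard (.close x P)
  | recv {n : ℕ} (x : Fin n) (P : Proc (n + 1)) : Guard (.recv x P)
  | wait {n : ℕ} (x : Fin n) (P : Proc n) : Guard (.wait x P)
  | offer {n : ℕ} (x : Fin n) (P Q : Proc n) : Guard (.offer x P Q)
  | absurd {n : ℕ} (x : Fin n) : Guard (.absurd x)

/-- `Opens T P`: the translation of `P` is a restriction of the thread `T`. -/
inductive Opens : {n : ℕ} → Term (n + 2) → Proc n → Prop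
  | send {n : ℕ} (x : Fin n) (P : Proc (n + 1)) : Opens (sendCont x (transM P)) (.send x P)
  | inl {n : ℕ} (x : Fin n) (P : Proc n) :
      Opens (selectCont x (.inl (.var 0)) (transM P)) (.inl x P)
  | inr {n : ℕ} (x : Fin n) (P : Proc n) :
      Opens (selectCont x (.inr (.var 0)) (transM P)) (.inr x P)

theorem Guard.transC_eq {n : ℕ} {P : Proc n} (h : Guard P) :
    transC P = .thread .child (transM P) := by
  cases h <;> rfl

theorem Opens.transC_eq {n : ℕ} {T : Term (n + 2)} {P : Proc n} (h : Opens T P) :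
    transC P = .res (.thread .child T) := by
  cases h <;> rfl

theorem fv_selectInl {n : ℕ} : (Term.selectInl : Term n).fv = ∅ := by
  ext i
  have : wk2 i.succ ≠ 2 := fun h => zero_ne_succ _ (wk2_injective h).symm
  simpa [Term.selectInl, Term.fv, Term.capp]

theorem fv_selectInr {n : ℕ} : (Term.selectInr : Term n).fv = ∅ := by
  ext i
  have : wk2 i.succ ≠ 2 := fun h => zero_ne_succ _ (wk2_injective h).symm
  simpa [Term.selectInr, Term.fv, Term.capp]

/-- A continuation in which the channel `x` is shadowed no longer contributes `x`, but the prefix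
itself uses `x`, so no free name is lost. -/
theorem fv_transM {n : ℕ} (P : Proc n) : (transM P).fv = P.fv := by
  induction P with
  | link x y => simp [transM, Term.linkVars, Term.capp, Term.fv, Proc.fv, Set.pair_comm]
  | halt => rfl
  | recv x P ih =>
    have := preimage_wk2_image_rebind2 x P.fv
    simp only [rebind2] at this
    simp only [transM, Term.fv, Term.fv_rename, Term.capp, Proc.fv, ih, this]
    simp
  | offer x P Q ihP ihQ =>
    simp only [transM, Term.fv, Term.fv_rename, Term.capp, Proc.fv, ihP, ihQ, Term.offerShadow,
      preimage_succ_image_rebind]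
    ext i
    by_cases h : i = x <;> simp [h]
  | send x P ih =>
    simp only [transM, Term.fv, Term.fv_rename, Term.capp, Proc.fv, ih, sendCont, Term.letShadow,
      preimage_succ_image_rebind]
    ext i
    simp only [Set.mem_union, Set.mem_preimage, Set.mem_sdiff, Set.mem_image, Set.mem_singleton_iff,
      Set.mem_empty_iff_false, wk2_inj, wk2_ne_one]
    -- The name `x` is free on both sides because of the prefix; any other name is unaffected by the
    -- shadowing.
    by_cases h : i = x
    · simp [h]
    · simp only [h, not_false_eq_true, false_or, or_false, and_true]
      constructor
      · rintro ⟨j, hj, e⟩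
        revert hj e; revert j
        simp only [forall_fin1]
        refine ⟨by simp, fun j hj e => ?_⟩
        rw [lift_succ] at e
        have : j = i := wk2_injective e
        exact this ▸ hj
      · intro hi; exact ⟨_, hi, rfl⟩
  | inl x P ih =>
    simp [transM, Term.letShadow, Term.fv, Term.fv_rename, preimage_succ_image_rebind, ih,
      fv_selectInl, Proc.fv]
  | inr x P ih =>
    simp [transM, Term.letShadow, Term.fv, Term.fv_rename, preimage_succ_image_rebind, ih,
      fv_selectInr, Proc.fv]
  | _ =>
    simp_all only [transM, Term.fv, Term.fv_rename, Term.capp, Proc.fv,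
      Term.lamUnit, Term.offerEmpty]
    ext i
    simp

theorem Opens.fv_eq {n : ℕ} {T : Term (n + 2)} {P : Proc n} (h : Opens T P) :
    wk2 ⁻¹' T.fv = P.fv := by
  cases h with
  | send x P => simpa [transM, Term.fv, Proc.fv, Term.capp] using fv_transM (.send x P)
  | inl x P =>
    simp only [selectCont, Term.letShadow, Term.fv, Term.capp, Term.fv_rename,
      preimage_succ_image_rebind, fv_transM, Proc.fv]
    ext i; by_cases h : i = x <;> simp [h]
  | inr x P =>
    simp only [selectCont, Term.letShadow, Term.fv, Term.capp, Term.fv_rename,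
      preimage_succ_image_rebind, fv_transM, Proc.fv]
    ext i; by_cases h : i = x <;> simp [h]

theorem rename_sendCont {n m : ℕ} {ρ : Fin n → Fin m} {x : Fin n} (M : Term (n + 1))
    (h : Set.InjOn ρ ({x} ∪ Fin.succ ⁻¹' M.fv)) :
    (sendCont x M).rename (lift2 ρ) = sendCont (ρ x) (M.rename (lift ρ)) := by
  have key : lift2 ρ ∘ lift Fin.succ = lift Fin.succ ∘ lift ρ := by
    funext i; revert i; simp only [forall_fin1]; exact ⟨rfl, fun _ => rfl⟩
  simp only [sendCont, Term.letShadow, Term.rename, Term.capp, lift2_wk2, lift2_one]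
  rw [rename_rebind]
  · simp only [Term.rename_rename, key, lift2_wk2]
  · refine injOn_lift2 (h.mono ?_)
    rw [Term.fv_rename]
    rintro i (hi | ⟨j, hj, e⟩)
    · exact .inl (wk2_injective hi)
    · revert hj e; revert j
      simp only [forall_fin1]
      refine ⟨by simp, fun j hj e => .inr ?_⟩
      have : j = i := wk2_injective e
      exact this ▸ hj

theorem rename_selectCont {n m : ℕ} {ρ : Fin n → Fin m} {x : Fin n} (V : Term (n + 2)) (M : Term n)
    (h : Set.InjOn ρ ({x} ∪ M.fv)) :
    (selectCont x V M).rename (lift2 ρ) = selectCont (ρ x) (V.rename (lift2 ρ)) (M.rename ρ) := by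
  simp only [selectCont, Term.letShadow, Term.rename, Term.capp, lift2_wk2, lift2_one]
  rw [rename_rebind]
  · simp only [Term.rename_rename, lift2_comp_wk2, lift2_wk2]
  · refine injOn_lift2 (h.mono ?_)
    rw [Term.fv_rename]
    rintro i (hi | ⟨j, hj, e⟩)
    · exact .inl (wk2_injective hi)
    · exact .inr (wk2_injective e ▸ hj)

/-- Shadowing makes this false for arbitrary renamings. Injectivity is asked on the free names only,
as the substitution in the reduction of a forwarder is not injective on all names. -/
theorem transM_rename {n m : ℕ} {ρ : Fin n → Fin m} (P : Proc n) (h : Set.InjOn ρ P.fv) :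
    transM (P.rename ρ) = (transM P).rename ρ := by
  induction P generalizing m with
  | link x y => rfl
  | res P ih => simp [Proc.rename, transM, Term.rename, ih (injOn_lift2 h), Term.capp]
  | par P Q ihP ihQ =>
    simp only [Proc.rename, transM, Term.rename, ihP (h.mono Set.subset_union_left),
      ihQ (h.mono Set.subset_union_right), Term.capp, Term.lamUnit, Term.rename_rename]
    rfl
  | halt => rfl
  | send x P ih =>
    simp only [Proc.rename, transM, Term.rename, Term.capp,
      ih (injOn_lift (h.mono Set.subset_union_right))]
    rw [rename_sendCont]
    rwa [fv_transM]
  | close x P ih =>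
    simp [Proc.rename, transM, Term.rename, ih (h.mono Set.subset_union_right), Term.capp]
  | recv x P ih =>
    have := rename_rebind2 (x := x) (ρ := ρ) (transM P) (by rwa [fv_transM])
    simp only [rebind2] at this
    simp only [Proc.rename, transM, Term.rename, Term.capp, this,
      ih (injOn_lift (h.mono Set.subset_union_right))]
  | wait x P ih =>
    simp [Proc.rename, transM, Term.rename, ih (h.mono Set.subset_union_right), Term.capp]
  | inl x P ih =>
    simp only [Proc.rename, transM, Term.rename, Term.letShadow,
      ih (h.mono Set.subset_union_right), rename_rebind (transM P) (by rwa [fv_transM])]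
    rfl
  | inr x P ih =>
    simp only [Proc.rename, transM, Term.rename, Term.letShadow,
      ih (h.mono Set.subset_union_right), rename_rebind (transM P) (by rwa [fv_transM])]
    rfl
  | offer x P Q ihP ihQ =>
    have aux : ∀ R : Proc _, R.fv ⊆ P.fv ∪ Q.fv →
        (((transM R).rename wk2).rename (rebind (wk2 x))).rename (lift (lift2 ρ)) =
          (((transM R).rename ρ).rename wk2).rename (rebind (wk2 (ρ x))) := by
      intro R hR
      rw [rename_rebind]
      · simp only [Term.rename_rename, lift2_comp_wk2, lift2_wk2]
      · refine injOn_lift2 (h.mono ?_)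
        rw [Term.fv_rename, fv_transM]
        rintro i (hi | ⟨j, hj, e⟩)
        · exact .inl (wk2_injective hi)
        · exact .inr (hR (wk2_injective e ▸ hj))
    simp only [Proc.rename, transM, Term.rename, Term.offerShadow, Term.capp,
      aux P Set.subset_union_left, aux Q Set.subset_union_right,
      ihP (h.mono fun i hi => .inr (.inl hi)), ihQ (h.mono fun i hi => .inr (.inr hi))]
    rfl
  | absurd x => rfl

theorem Guard.rename {n m : ℕ} {P : Proc n} (h : Guard P) (ρ : Fin n → Fin m) :
    Guard (P.rename ρ) := by
  cases h <;> constructor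

theorem Opens.rename {n m : ℕ} {T : Term (n + 2)} {P : Proc n} (h : Opens T P) {ρ : Fin n → Fin m}
    (hρ : Set.InjOn ρ P.fv) : Opens (T.rename (lift2 ρ)) (P.rename ρ) := by
  cases h with
  | send x P =>
    rw [rename_sendCont _ (by rwa [fv_transM]),
      ← transM_rename _ (injOn_lift (hρ.mono Set.subset_union_right))]
    exact .send _ _
  | inl x P =>
    rw [rename_selectCont _ _ (by rwa [fv_transM]),
      ← transM_rename _ (hρ.mono Set.subset_union_right)]
    exact .inl _ _
  | inr x P =>
    rw [rename_selectCont _ _ (by rwa [fv_transM]),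
      ← transM_rename _ (hρ.mono Set.subset_union_right)]
    exact .inr _ _

theorem Guard.of_rename {n m : ℕ} {P : Proc n} {ρ : Fin n → Fin m} (h : Guard (P.rename ρ)) :
    Guard P := by
  cases P <;> first | constructor | cases h

theorem Opens.unique {n : ℕ} {T T' : Term (n + 2)} {P : Proc n} (h : Opens T P)
    (h' : Opens T' P) : T = T' := by
  simpa using h.transC_eq.symm.trans h'.transC_eq

theorem Opens.of_rename {n m : ℕ} {P : Proc n} {ρ : Fin n → Fin m} {T : Term (m + 2)}
    (hρ : Function.Injective ρ) (h : Opens T (P.rename ρ)) :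
    ∃ T', Opens T' P ∧ T = T'.rename (lift2 ρ) := by
  have key {T'} (hT : Opens T' P) : T = T'.rename (lift2 ρ) := h.unique (hT.rename hρ.injOn)
  cases P with
  | send x P => exact ⟨_, .send x P, key (.send x P)⟩
  | inl x P => exact ⟨_, .inl x P, key (.inl x P)⟩
  | inr x P => exact ⟨_, .inr x P, key (.inr x P)⟩
  | _ => cases h

/-! ### Reduction in Priority GV -/

namespace PGV

theorem TRed.rename {n m : ℕ} {M M' : Term n} (h : TRed M M') (ρ : Fin n → Fin m) :
    TRed (M.rename ρ) (M'.rename ρ) := by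
  induction h with
  | lam M hV => rw [Term.rename_inst]; exact .lam _ (hV.rename ρ)
  | unit M => exact .unit _
  | pair M hV hW => rw [Term.rename_inst2]; exact .pair _ (hV.rename ρ) (hW.rename ρ)
  | inl M N hV => rw [Term.rename_inst]; exact .inl _ _ (hV.rename ρ)
  | inr M N hV => rw [Term.rename_inst]; exact .inr _ _ (hV.rename ρ)
  | lift E _ ih => rw [ECtx.rename_plug, ECtx.rename_plug]; exact .lift _ ih

theorem Conf.rename_id {n : ℕ} (C : Conf n) : C.rename id = C := by
  induction C <;> simp_all [Conf.rename, Term.rename_id, lift2_id]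

theorem Conf.rename_rename {n m k : ℕ} (σ : Fin m → Fin k) (ρ : Fin n → Fin m) (C : Conf n) :
    (C.rename ρ).rename σ = C.rename (σ ∘ ρ) := by
  induction C generalizing m k <;> simp_all [Conf.rename, Term.rename_rename, lift2_comp]

theorem TCtx.rename_plug {n m : ℕ} (ρ : Fin n → Fin m) (F : TCtx n) (M : Term n) :
    (F.plug M).rename ρ = (F.rename ρ).plug (M.rename ρ) := by
  simp [TCtx.plug, Conf.rename, TCtx.rename, ECtx.rename_plug]

theorem TCtx.rename_rename {n m k : ℕ} (σ : Fin m → Fin k) (ρ : Fin n → Fin m) (F : TCtx n) :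
    (F.rename ρ).rename σ = F.rename (σ ∘ ρ) := by
  simp [TCtx.rename, ECtx.rename_rename]

theorem TCtx.rename_wk2_lift2 {n m : ℕ} (ρ : Fin n → Fin m) (F : TCtx n) :
    (F.rename wk2).rename (lift2 ρ) = (F.rename ρ).rename wk2 := by
  simp [TCtx.rename_rename, lift2_comp_wk2]

theorem Conf.rename_wk2_lift2 {n m : ℕ} (ρ : Fin n → Fin m) (C : Conf n) :
    (C.rename wk2).rename (lift2 ρ) = (C.rename ρ).rename wk2 := by
  simp [Conf.rename_rename, lift2_comp_wk2]

theorem lift2_comp_swap2 {n m : ℕ} (ρ : Fin n → Fin m) : lift2 ρ ∘ swap2 = swap2 ∘ lift2 ρ := by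
  funext i; revert i; simp [forall_fin2]

theorem lift2_comp_exch22 {n m : ℕ} (ρ : Fin n → Fin m) :
    lift2 (lift2 ρ) ∘ exch22 = exch22 ∘ lift2 (lift2 ρ) := by
  funext i; revert i; simp [forall_fin2]

theorem SC.rename {n m : ℕ} {C D : Conf n} (h : SC C D) (ρ : Fin n → Fin m) :
    SC (C.rename ρ) (D.rename ρ) := by
  induction h generalizing m with
  | linkSwap F x y => simp only [TCtx.rename_plug]; exact .linkSwap _ _ _
  | resLink φ => exact .resLink φ
  | resSwap C =>
    simp only [Conf.rename, Conf.rename_rename, lift2_comp_swap2]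
    rw [← Conf.rename_rename]; exact .resSwap _
  | resComm C =>
    simp only [Conf.rename, Conf.rename_rename, lift2_comp_exch22]
    rw [← Conf.rename_rename]; exact .resComm _
  | resExt C D =>
    simp only [Conf.rename, Conf.rename_wk2_lift2]; exact .resExt _ _
  | parNil C => exact .parNil _
  | parComm C D => exact .parComm _ _
  | parAssoc C D E => exact .parAssoc _ _ _
  | refl C => exact .refl _
  | symm _ ih => exact (ih ρ).symm
  | trans _ _ ih₁ ih₂ => exact (ih₁ ρ).trans (ih₂ ρ)
  | congRes _ ih => exact .congRes (ih _)
  | congPar _ _ ih₁ ih₂ => exact .congPar (ih₁ ρ) (ih₂ ρ)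

theorem CRed.rename {n m : ℕ} {C D : Conf n} (h : CRed C D) (ρ : Fin n → Fin m) :
    CRed (C.rename ρ) (D.rename ρ) := by
  induction h generalizing m with
  | link F w C D h =>
    simp only [Conf.rename, TCtx.rename_plug, TCtx.rename_wk2_lift2]
    refine .link (F.rename ρ) (lift2 ρ w) _ _ ?_
    rw [← Conf.rename_wk2_lift2, ← h, Conf.rename_rename, Conf.rename_rename]
    congr 1; funext i; revert i
    simp [forall_fin2, replace, Function.update]
  | new F =>
    simp only [Conf.rename, TCtx.rename_plug, TCtx.rename_wk2_lift2]; exact .new _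
  | spawn F hV =>
    simp only [Conf.rename, TCtx.rename_plug]; exact .spawn _ (hV.rename ρ)
  | send F F' hV =>
    simp only [Conf.rename, TCtx.rename_plug]; exact .send _ _ (hV.rename _)
  | close F F' =>
    simp only [Conf.rename, TCtx.rename_plug, TCtx.rename_wk2_lift2]; exact .close _ _
  | liftPar D _ ih => exact .liftPar _ (ih ρ)
  | liftRes _ ih => exact .liftRes (ih _)
  | liftM F h => simp only [TCtx.rename_plug]; exact .liftM _ (h.rename ρ)
  | liftSC h₁ _ h₂ ih => exact .liftSC (h₁.rename ρ) (ih ρ) (h₂.rename ρ)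

/-- Structurally congruent configurations reduce to one another, by the reduction of a forwarder
between the two ends of a channel that is used nowhere else. -/
theorem SC.cRed {n : ℕ} {C D : Conf n} (h : SC C D) : CRed C D := by
  let U {n : ℕ} : Conf n := .thread .child .unit
  -- The reduction of forwarders acts on `link (w, x)`, here with `w` the other end of the same
  -- channel; the congruence for forwarders has the names in the opposite order, hence the swap.
  have h₁ : SC (.res (.par (.thread .child (.linkVars 1 0)) U) : Conf n) U := by
    refine (SC.congRes (.parNil _)).trans ((SC.congRes ?_).trans (.resLink _))
    exact .linkSwap ⟨.child, .hole⟩ 1 0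
  have h₂ : CRed (.res (.par (.thread .child (.linkVars 1 0)) U) : Conf n) (.par U U) :=
    .link ⟨.child, .hole⟩ 1 U U rfl
  have h₃ (E : Conf n) : SC (.par U E) E := (SC.parComm _ _).trans (.parNil _)
  -- A finished thread next to `C` is expanded to a forwarder, the forwarder is reduced, and the two
  -- finished threads that remain are discarded.
  refine .liftSC ?_ (.liftPar C h₂) (((h₃ _).congPar (.refl _)).trans ((h₃ _).trans h))
  exact (h₃ C).symm.trans (.congPar h₁.symm (.refl C))

/-- The reflexive-transitive closure of reduction. -/
abbrev CReds {n : ℕ} : Conf n → Conf n → Prop := Relation.ReflTransGen CRed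

theorem CReds.par {n : ℕ} {C C' D D' : Conf n} (h₁ : CReds C C') (h₂ : CReds D D') :
    CReds (.par C D) (.par C' D') := by
  refine Relation.ReflTransGen.trans (b := .par C' D) ?_ ?_
  · exact h₁.lift (fun C => Conf.par C D) fun _ _ h => .liftPar D h
  · exact h₂.lift (fun D => Conf.par C' D) fun _ _ h =>
      .liftSC (.parComm _ _) (.liftPar C' h) (.parComm _ _)

theorem CReds.res {n : ℕ} {C C' : Conf (n + 2)} (h : CReds C C') : CReds (.res C) (.res C') :=
  h.lift Conf.res fun _ _ h => .liftRes h

theorem CReds.rename {n m : ℕ} {C C' : Conf n} (h : CReds C C') (ρ : Fin n → Fin m) :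
    CReds (C.rename ρ) (C'.rename ρ) :=
  h.lift (Conf.rename ρ) fun _ _ h => h.rename ρ

theorem TRed.cReds {n : ℕ} {φ : Flag} {M M' : Term n} (h : TRed M M') :
    CReds (.thread φ M) (.thread φ M') :=
  .single (.liftM ⟨φ, .hole⟩ h)

end PGV

/-! ### Evaluation of translated terms -/

theorem rename_wk2_pair {n : ℕ} (M : Term (n + 2)) :
    (M.rename (lift2 wk2)).inst2 (.var 0) (.var 1) = M := by
  rw [Term.inst2_var, Term.rename_rename]
  refine Eq.trans ?_ M.rename_id
  congr 1; funext i; revert i; simp [forall_fin2]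

theorem cReds_new {n : ℕ} (M : Term (n + 2)) :
    CReds (.thread .child (.letPair (.capp .new .unit) M)) (.res (.thread .child M)) := by
  refine .head (.new ⟨.child, .letPair .hole M⟩) (CReds.res ?_)
  have := TRed.cReds (φ := .child)
    (.pair (V := .var 0) (W := .var 1) (M.rename (lift2 wk2)) (.var _) (.var _))
  rwa [rename_wk2_pair] at this

theorem rename_rebind_wk2 {n : ℕ} (x : Fin n) (M : Term n) :
    (M.rename (rebind x)).rename (lift wk2) = (M.rename wk2).rename (rebind (wk2 x)) :=
  rename_rebind M wk2_injective.injOn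

/-- The translation of a process to a term evaluates to its translation to a configuration. -/
theorem cReds_transC {n : ℕ} (P : Proc n) : CReds (.thread .child (transM P)) (transC P) := by
  induction P with
  | res P ih => exact (cReds_new _).trans (CReds.res ih)
  | par P Q ihP ihQ =>
    refine .head (.spawn ⟨.child, .andThen .hole (transM Q)⟩ (.lam _)) ?_
    -- After `spawn` the thread of `Q` stands on the left; the exchange of the two components is a
    -- reduction step by `SC.cRed`.
    refine .trans (CReds.par (C' := transC Q) (D' := transC P) ?_ ?_)
      (.single (PGV.SC.parComm _ _).cRed)
    · exact (TRed.unit _).cReds.trans ihQ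
    · refine ((TRed.lam _ .unit).cReds.trans ?_).trans ihP
      have : (Term.andThen (.var 0) ((transM P).rename Fin.succ)).inst .unit =
          .andThen .unit (transM P) :=
        congrArg (Term.andThen .unit) (Term.inst_rename_succ _ .unit)
      rw [this]
      exact (TRed.unit _).cReds
  | send x P ih => exact cReds_new _
  | inl x P ih =>
    refine .trans (TRed.cReds (.lift (.appR _ (.lam _) .hole) (.lam _ (.var x)))) ?_
    refine .head (.new ⟨.child, .appR _ (.lam _) (.letPair .hole _)⟩) (CReds.res ?_)
    refine .trans (TRed.cReds (.lift (.appR _ (IsValue.rename _ (.lam _)) .hole)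
      (.pair _ (.var _) (.var _)))) ?_
    simp only [ECtx.plug, Term.rename, rename_rebind_wk2]
    exact .refl
  | inr x P ih =>
    refine .trans (TRed.cReds (.lift (.appR _ (.lam _) .hole) (.lam _ (.var x)))) ?_
    refine .head (.new ⟨.child, .appR _ (.lam _) (.letPair .hole _)⟩) (CReds.res ?_)
    refine .trans (TRed.cReds (.lift (.appR _ (IsValue.rename _ (.lam _)) .hole)
      (.pair _ (.var _) (.var _)))) ?_
    simp only [ECtx.plug, Term.rename, rename_rebind_wk2]
    exact .refl
  | _ => exact .refl

/-! ### Configurations that represent processes -/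

/-- The image of a multiset of pairs of names under a renaming. -/
def pairsMap {n m : ℕ} (ρ : Fin n → Fin m) (Δ : Multiset (Fin n × Fin n)) :
    Multiset (Fin m × Fin m) := Δ.map (Prod.map ρ ρ)

@[simp] theorem pairsMap_zero {n m : ℕ} (ρ : Fin n → Fin m) : pairsMap ρ 0 = 0 := rfl

@[simp] theorem pairsMap_cons {n m : ℕ} (ρ : Fin n → Fin m) (d : Fin n × Fin n)
    (Δ : Multiset (Fin n × Fin n)) :
    pairsMap ρ (d ::ₘ Δ) = (ρ d.1, ρ d.2) ::ₘ pairsMap ρ Δ := Multiset.map_cons _ _ _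

@[simp] theorem pairsMap_add {n m : ℕ} (ρ : Fin n → Fin m) (Δ Δ' : Multiset (Fin n × Fin n)) :
    pairsMap ρ (Δ + Δ') = pairsMap ρ Δ + pairsMap ρ Δ' := Multiset.map_add _ _ _

theorem pairsMap_pairsMap {n m k : ℕ} (σ : Fin m → Fin k) (ρ : Fin n → Fin m)
    (Δ : Multiset (Fin n × Fin n)) : pairsMap σ (pairsMap ρ Δ) = pairsMap (σ ∘ ρ) Δ := by
  rw [pairsMap, pairsMap, Multiset.map_map, Prod.map_comp_map]; rfl

theorem pairsMap_id {n : ℕ} (Δ : Multiset (Fin n × Fin n)) : pairsMap id Δ = Δ := by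
  simp [pairsMap]

theorem pairsMap_eq_zero {n m : ℕ} {ρ : Fin n → Fin m} {Δ : Multiset (Fin n × Fin n)} :
    pairsMap ρ Δ = 0 ↔ Δ = 0 := Multiset.map_eq_zero

theorem pairsMap_wk2_lift2 {n m : ℕ} (ρ : Fin n → Fin m) (Δ : Multiset (Fin n × Fin n)) :
    pairsMap (lift2 ρ) (pairsMap wk2 Δ) = pairsMap wk2 (pairsMap ρ Δ) := by
  simp [pairsMap_pairsMap, lift2_comp_wk2]

theorem pairsMap_swap2_wk2 {n : ℕ} (Δ : Multiset (Fin n × Fin n)) :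
    pairsMap swap2 (pairsMap wk2 Δ) = pairsMap wk2 Δ := pairsMap_pairsMap _ _ _

theorem pairsMap_exch22_wk2 {n : ℕ} (Δ : Multiset (Fin n × Fin n)) :
    pairsMap exch22 (pairsMap wk2 (pairsMap wk2 Δ)) = pairsMap wk2 (pairsMap wk2 Δ) := by
  simp only [pairsMap_pairsMap]; rfl

theorem pairsMap_eq_cons {n m : ℕ} {ρ : Fin n → Fin m} {Δ : Multiset (Fin n × Fin n)}
    {d : Fin m × Fin m} {Δ' : Multiset (Fin m × Fin m)} (h : pairsMap ρ Δ = d ::ₘ Δ') :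
    ∃ y z Δ₁, d = (ρ y, ρ z) ∧ Δ = (y, z) ::ₘ Δ₁ ∧ pairsMap ρ Δ₁ = Δ' := by
  obtain ⟨⟨y, z⟩, ha, e, h'⟩ := (Multiset.map_eq_cons _ _ _ _).2 h
  exact ⟨y, z, _, e.symm, (Multiset.cons_erase ha).symm, h'⟩

theorem pairsMap_eq_singleton {n m : ℕ} {ρ : Fin n → Fin m} {Δ : Multiset (Fin n × Fin n)}
    {d : Fin m × Fin m} (h : pairsMap ρ Δ = {d}) :
    ∃ y z, d = (ρ y, ρ z) ∧ Δ = {(y, z)} := by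
  obtain ⟨y, z, Δ₁, e, rfl, h'⟩ := pairsMap_eq_cons (Δ' := 0) h
  rw [pairsMap_eq_zero] at h'
  exact ⟨y, z, e, by rw [h']; rfl⟩

theorem pairsMap_eq_add {n m : ℕ} {ρ : Fin n → Fin m} {Δ : Multiset (Fin n × Fin n)}
    {Δ₁ Δ₂ : Multiset (Fin m × Fin m)} (h : pairsMap ρ Δ = Δ₁ + Δ₂) :
    ∃ Δ₁' Δ₂', Δ = Δ₁' + Δ₂' ∧ pairsMap ρ Δ₁' = Δ₁ ∧ pairsMap ρ Δ₂' = Δ₂ := by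
  induction Δ₁ using Multiset.induction generalizing Δ with
  | empty => exact ⟨0, Δ, by simp, rfl, by simpa using h⟩
  | cons d Δ₁ ih =>
    rw [Multiset.cons_add] at h
    obtain ⟨y, z, Δ₃, rfl, rfl, h'⟩ := pairsMap_eq_cons h
    obtain ⟨Δ₁', Δ₂', rfl, rfl, rfl⟩ := ih h'
    exact ⟨(y, z) ::ₘ Δ₁', Δ₂', by simp, by simp, rfl⟩

/-- `Represents ρ Δ C P`: the configuration `C` is the translation of the process `P`, renamed
along `ρ`, except that the restrictions `(ν y z)` that the translation of outputs and selections
introduces may occur anywhere above the threads that use them, with their two names in either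
order. The pairs `(y, z)` of names that are restricted outside of `C` are collected in `Δ`; they
do not belong to the range of `ρ`. -/
inductive Represents : {n m : ℕ} → (Fin m → Fin n) → Multiset (Fin n × Fin n) → Conf n →
    Proc m → Prop
  | guard {n m : ℕ} {ρ : Fin m → Fin n} {P : Proc m} : Guard P →
      Represents ρ 0 (.thread .child ((transM P).rename ρ)) P
  | opens {n m : ℕ} {ρ : Fin m → Fin n} {P : Proc m} {T : Term (m + 2)} (y z : Fin n) :
      Opens T P → Represents ρ {(y, z)} (.thread .child (T.rename (scons y (scons z ρ)))) P
  | par {n m : ℕ} {ρ : Fin m → Fin n} {Δ₁ Δ₂ : Multiset (Fin n × Fin n)} {C D : Conf n}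
      {P Q : Proc m} : Represents ρ Δ₁ C P → Represents ρ Δ₂ D Q →
      Represents ρ (Δ₁ + Δ₂) (.par C D) (.par P Q)
  | res {n m : ℕ} {ρ : Fin m → Fin n} {Δ : Multiset (Fin n × Fin n)} {C : Conf (n + 2)}
      {P : Proc (m + 2)} : Represents (lift2 ρ) (pairsMap wk2 Δ) C P →
      Represents ρ Δ (.res C) (.res P)
  | hide {n m : ℕ} {ρ : Fin m → Fin n} {Δ : Multiset (Fin n × Fin n)} {C : Conf (n + 2)}
      {P : Proc m} {d : Fin (n + 2) × Fin (n + 2)} : d = (0, 1) ∨ d = (1, 0) →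
      Represents (wk2 ∘ ρ) (d ::ₘ pairsMap wk2 Δ) C P → Represents ρ Δ (.res C) P

namespace Represents

theorem of_transC {n m : ℕ} (P : Proc m) (ρ : Fin m → Fin n) :
    Represents ρ 0 ((transC P).rename ρ) P := by
  have key {m n : ℕ} {ρ : Fin m → Fin n} {T P} (h : Opens T P) :
      Represents ρ 0 ((transC P).rename ρ) P := by
    rw [h.transC_eq, Conf.rename, Conf.rename, lift2_eq]
    exact .hide (.inl rfl) (.opens 0 1 h)
  induction P generalizing n with
  | res P ih => exact .res (ih _)
  | par P Q ihP ihQ => exact .par (ihP ρ) (ihQ ρ)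
  | send x P => exact key (.send x P)
  | inl x P => exact key (.inl x P)
  | inr x P => exact key (.inr x P)
  | _ => exact .guard (by constructor)

/-- Renaming of the configuration and of the process. -/
theorem rename {n m n' m' : ℕ} {ρ : Fin m → Fin n} {Δ : Multiset (Fin n × Fin n)} {C : Conf n}
    {P : Proc m} (h : Represents ρ Δ C P) {ρ' : Fin m' → Fin n'} (θ : Fin n → Fin n')
    (θ' : Fin m → Fin m') (hθ' : Set.InjOn θ' P.fv) (hc : ∀ i ∈ P.fv, θ (ρ i) = ρ' (θ' i)) :
    Represents ρ' (pairsMap θ Δ) (C.rename θ) (P.rename θ') := by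
  induction h generalizing n' m' with
  | @guard n m ρ P hP =>
    have : ((transM P).rename ρ).rename θ = (transM (P.rename θ')).rename ρ' := by
      rw [transM_rename _ hθ', Term.rename_rename, Term.rename_rename]
      exact Term.rename_congr _ (by rwa [fv_transM])
    rw [Conf.rename, this]
    exact .guard (hP.rename θ')
  | @opens n m ρ P T y z hT =>
    have : (T.rename (scons y (scons z ρ))).rename θ =
        (T.rename (lift2 θ')).rename (scons (θ y) (scons (θ z) ρ')) := by
      rw [Term.rename_rename, Term.rename_rename]
      refine Term.rename_congr _ ?_
      simp only [forall_fin2]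
      exact ⟨fun _ => rfl, fun _ => rfl, fun i hi => hc i (hT.fv_eq.subset hi)⟩
    rw [Conf.rename, this]
    exact .opens _ _ (hT.rename hθ')
  | par h₁ h₂ ih₁ ih₂ =>
    rw [pairsMap_add]
    exact .par (ih₁ θ θ' (hθ'.mono fun i hi => .inl hi) fun i hi => hc i (.inl hi))
      (ih₂ θ θ' (hθ'.mono fun i hi => .inr hi) fun i hi => hc i (.inr hi))
  | res h ih =>
    refine .res ?_
    rw [← pairsMap_wk2_lift2]
    refine ih (lift2 θ) (lift2 θ') (injOn_lift2 hθ') ?_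
    simp only [forall_fin2]
    exact ⟨fun _ => rfl, fun _ => rfl, fun i hi => congrArg wk2 (hc i hi)⟩
  | @hide n m ρ Δ C P d hd h ih =>
    refine .hide (d := (lift2 θ d.1, lift2 θ d.2)) ?_ ?_
    · rcases hd with rfl | rfl <;> simp
    · rw [← pairsMap_wk2_lift2, ← pairsMap_cons]
      exact ih _ θ' hθ' fun i hi => congrArg wk2 (hc i hi)

/-- Each pending pair `(y, z)` belongs to a thread of the configuration that mentions `z`. Nothing
similar holds for `y`, which an output need not mention. The lemma tells on which side of a parallel
composition a pair is used. -/
theorem mem_range {n n₀ m : ℕ} {ρ : Fin m → Fin n} {θ : Fin n₀ → Fin n}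
    {Δ : Multiset (Fin n × Fin n)} {C : Conf n₀} {P : Proc m}
    (h : Represents ρ Δ (C.rename θ) P) {d : Fin n × Fin n} (hd : d ∈ Δ) : d.2 ∈ Set.range θ := by
  induction C generalizing n m with
  | thread φ M =>
    generalize hC : Conf.rename θ (.thread φ M) = C' at h
    cases h with
    | guard => simp at hd
    | opens y z hT =>
      rw [Multiset.mem_singleton] at hd
      simp only [Conf.rename, Conf.thread.injEq] at hC
      have h1 : z ∈ (M.rename θ).fv := by
        rw [hC.2, Term.fv_rename]
        refine ⟨1, ?_, rfl⟩
        cases hT <;> simp [sendCont, selectCont, Term.letShadow, Term.fv, Term.capp]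
      rw [Term.fv_rename] at h1
      exact hd ▸ Set.image_subset_range _ _ h1
    | _ => simp [Conf.rename] at hC
  | par C D ihC ihD =>
    cases h with
    | par h₁ h₂ =>
      rcases Multiset.mem_add.1 hd with hd | hd
      exacts [ihC h₁ hd, ihD h₂ hd]
  | res C ih =>
    have key : wk2 d.2 ∈ Set.range (lift2 θ) → d.2 ∈ Set.range θ := by
      rintro ⟨j, hj⟩
      revert hj; revert j
      simp only [forall_fin2]
      exact ⟨by simp, by simp, fun j hj => ⟨j, wk2_injective hj⟩⟩
    have hd' : (wk2 d.1, wk2 d.2) ∈ pairsMap wk2 Δ := Multiset.mem_map_of_mem (Prod.map wk2 wk2) hd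
    cases h with
    | res h => exact key (ih h hd')
    | hide _ h => exact key (ih h (Multiset.mem_cons_of_mem hd'))

/-- Representation is reflected by a renaming, along a pullback of renamings. -/
theorem of_rename {n n₀ m m₀ : ℕ} {ρ : Fin m → Fin n} {ρ₀ : Fin m₀ → Fin n₀} {θ : Fin n₀ → Fin n}
    {θ' : Fin m₀ → Fin m} (hθ : Function.Injective θ) (hθ' : Function.Injective θ')
    (hc : ∀ k, ρ (θ' k) = θ (ρ₀ k)) (hp : ∀ i j, ρ i = θ j → ∃ k, θ' k = i)
    {Δ : Multiset (Fin n₀ × Fin n₀)} {C : Conf n₀} {P : Proc m}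
    (h : Represents ρ (pairsMap θ Δ) (C.rename θ) P) :
    ∃ P' : Proc m₀, P = P'.rename θ' ∧ Represents ρ₀ Δ C P' := by
  induction C generalizing n m m₀ with
  | thread φ M =>
    generalize hC : Conf.rename θ (.thread φ M) = C' at h
    generalize hΔ : pairsMap θ Δ = Δ' at h
    cases h with
    | guard hP =>
      simp only [Conf.rename, Conf.thread.injEq] at hC
      obtain ⟨rfl, hC⟩ := hC
      -- A free name of `P` occurs in the thread, so its image under `ρ` is in the range of `θ`; the
      -- pullback property `hp` then puts the name itself in the range of `θ'`.
      obtain ⟨P', rfl⟩ := P.exists_eq_rename (ρ := θ') fun i hi => by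
        have : ρ i ∈ (M.rename θ).fv := by
          rw [hC, Term.fv_rename, fv_transM]; exact ⟨i, hi, rfl⟩
        rw [Term.fv_rename] at this
        obtain ⟨j, _, e⟩ := this
        exact hp i j e.symm
      have hM : M = (transM P').rename ρ₀ := by
        refine Term.rename_injective hθ ?_
        rw [hC, transM_rename _ hθ'.injOn, Term.rename_rename, Term.rename_rename]
        exact Term.rename_congr _ fun i _ => hc i
      rw [pairsMap_eq_zero.1 hΔ, hM]
      exact ⟨P', rfl, .guard hP.of_rename⟩
    | opens y z hT =>
      simp only [Conf.rename, Conf.thread.injEq] at hC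
      obtain ⟨rfl, hC⟩ := hC
      obtain ⟨P', rfl⟩ := P.exists_eq_rename (ρ := θ') fun i hi => by
        have : ρ i ∈ (M.rename θ).fv := by
          rw [hC, Term.fv_rename]; exact ⟨wk2 i, hT.fv_eq.symm.subset hi, rfl⟩
        rw [Term.fv_rename] at this
        obtain ⟨j, _, e⟩ := this
        exact hp i j e.symm
      obtain ⟨T', hT', rfl⟩ := hT.of_rename hθ'
      obtain ⟨y, z, e, rfl⟩ := pairsMap_eq_singleton hΔ
      obtain ⟨rfl, rfl⟩ := Prod.mk.inj e
      have hM : M = T'.rename (scons y (scons z ρ₀)) := by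
        refine Term.rename_injective hθ ?_
        rw [hC, Term.rename_rename, Term.rename_rename]
        congr 1; funext i; revert i; simp [forall_fin2, hc]
      rw [hM]
      exact ⟨P', rfl, .opens y z hT'⟩
    | _ => simp [Conf.rename] at hC
  | par C D ihC ihD =>
    generalize hΔ : pairsMap θ Δ = Δ' at h
    cases h with
    | par h₁ h₂ =>
      obtain ⟨Δ₁, Δ₂, rfl, rfl, rfl⟩ := pairsMap_eq_add hΔ
      obtain ⟨P', rfl, hP'⟩ := ihC hθ hθ' hc hp h₁
      obtain ⟨Q', rfl, hQ'⟩ := ihD hθ hθ' hc hp h₂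
      exact ⟨.par P' Q', rfl, .par hP' hQ'⟩
  | res C ih =>
    generalize hΔ : pairsMap θ Δ = Δ' at h
    cases h with
    | res h =>
      subst hΔ
      rw [← pairsMap_wk2_lift2] at h
      obtain ⟨P', rfl, hP'⟩ := ih (ρ₀ := lift2 ρ₀) (lift2_injective hθ) (lift2_injective hθ')
        (by simp [forall_fin2, hc]) (by
          simp only [forall_fin2]
          refine ⟨⟨fun _ => ⟨0, rfl⟩, by simp, by simp⟩,
            ⟨by simp, fun _ => ⟨1, rfl⟩, by simp⟩, fun i => ⟨by simp, by simp, fun j e => ?_⟩⟩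
          obtain ⟨k, rfl⟩ := hp i j (by simpa using e)
          exact ⟨wk2 k, rfl⟩) h
      exact ⟨.res P', rfl, .res hP'⟩
    | hide hd h =>
      subst hΔ
      have key {d : Fin _ × Fin _} (hd : d = (0, 1) ∨ d = (1, 0))
          (h : Represents (wk2 ∘ ρ) (pairsMap (lift2 θ) (d ::ₘ pairsMap wk2 Δ))
            (C.rename (lift2 θ)) P) : ∃ P' : Proc m₀, P = P'.rename θ' ∧
              Represents ρ₀ Δ (.res C) P' := by
        obtain ⟨P', rfl, hP'⟩ := ih (ρ₀ := wk2 ∘ ρ₀) (lift2_injective hθ) hθ'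
          (fun k => congrArg wk2 (hc k)) (by
            simp only [forall_fin2]
            exact fun i => ⟨by simp, by simp, fun j e => hp i j (by simpa using e)⟩) h
        exact ⟨P', rfl, .hide hd hP'⟩
      rw [← pairsMap_wk2_lift2] at h
      rcases hd with rfl | rfl
      · exact key (d := (0, 1)) (.inl rfl) (by rw [pairsMap_cons]; exact h)
      · exact key (d := (1, 0)) (.inr rfl) (by rw [pairsMap_cons]; exact h)

end Represents

/-! ### Structural congruence and representation -/

namespace Represents

/-- A thread with a redex `K V` that represents a process. -/
inductive Prefix {n m : ℕ} (ρ : Fin m → Fin n) :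
    Multiset (Fin n × Fin n) → ECtx n → Const → Term n → Proc m → Prop
  | link (x y : Fin m) : Prefix ρ 0 .hole .link (.pair (.var (ρ x)) (.var (ρ y))) (.link x y)
  | close (x : Fin m) (P : Proc m) :
      Prefix ρ 0 (.andThen .hole ((transM P).rename ρ)) .close (.var (ρ x)) (.close x P)
  | wait (x : Fin m) (P : Proc m) :
      Prefix ρ 0 (.andThen .hole ((transM P).rename ρ)) .wait (.var (ρ x)) (.wait x P)
  | recv (x : Fin m) (P : Proc (m + 1)) :
      Prefix ρ 0 (.letPair .hole (((transM P).rename (rebind2 x)).rename (lift2 ρ))) .recv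
        (.var (ρ x)) (.recv x P)
  | offer (x : Fin m) (P Q : Proc m) :
      Prefix ρ 0 (.letPair .hole (.andThen (.capp .wait (.var 1)) (.caseSum (.var 0)
        ((((transM P).rename wk2).rename (rebind (wk2 x))).rename (lift (lift2 ρ)))
        ((((transM Q).rename wk2).rename (rebind (wk2 x))).rename (lift (lift2 ρ)))))) .recv
        (.var (ρ x)) (.offer x P Q)
  | absurd (x : Fin m) :
      Prefix ρ 0 (.letPair .hole (.andThen (.capp .wait (.var 1)) (.absurd (.var 0)))) .recv
        (.var (ρ x)) (.absurd x)
  | send (y z : Fin n) (x : Fin m) (P : Proc (m + 1)) :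
      Prefix ρ {(y, z)} (.appR (.lam ((((transM P).rename (lift Fin.succ)).rename
          (rebind (wk2 x))).rename (lift (scons y (scons z ρ))))) (.lam _) .hole) .send
        (.pair (.var z) (.var (ρ x))) (.send x P)
  | inl (y z : Fin n) (x : Fin m) (P : Proc m) :
      Prefix ρ {(y, z)} (.appR (.lam ((((transM P).rename wk2).rename
          (rebind (wk2 x))).rename (lift (scons y (scons z ρ))))) (.lam _)
          (.andThen (.appR (.const .close) (.const _) .hole) (.var z))) .send
        (.pair (.inl (.var y)) (.var (ρ x))) (.inl x P)
  | inr (y z : Fin n) (x : Fin m) (P : Proc m) :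
      Prefix ρ {(y, z)} (.appR (.lam ((((transM P).rename wk2).rename
          (rebind (wk2 x))).rename (lift (scons y (scons z ρ))))) (.lam _)
          (.andThen (.appR (.const .close) (.const _) .hole) (.var z))) .send
        (.pair (.inr (.var y)) (.var (ρ x))) (.inr x P)

theorem Prefix.isValue {n m : ℕ} {ρ : Fin m → Fin n} {Δ : Multiset (Fin n × Fin n)} {E : ECtx n}
    {K : Const} {V : Term n} {P : Proc m} (h : Prefix ρ Δ E K V P) : IsValue V := by
  cases h <;> repeat constructor

/-- A thread that represents a process either has terminated or has a redex. -/
theorem thread_cases {n m : ℕ} {ρ : Fin m → Fin n} {Δ : Multiset (Fin n × Fin n)} {φ : Flag}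
    {M : Term n} {P : Proc m} (h : Represents ρ Δ (.thread φ M) P) :
    φ = .child ∧ ((M = .unit ∧ P = .halt ∧ Δ = 0) ∨
      ∃ E K V, M = E.plug (.capp K V) ∧ Prefix ρ Δ E K V P) := by
  cases h with
  | guard hP =>
    refine ⟨rfl, ?_⟩
    cases hP with
    | link x y => exact .inr ⟨_, _, _, rfl, .link x y⟩
    | halt => exact .inl ⟨rfl, rfl, rfl⟩
    | close x P => exact .inr ⟨_, _, _, rfl, .close x P⟩
    | recv x P => exact .inr ⟨_, _, _, rfl, .recv x P⟩
    | wait x P => exact .inr ⟨_, _, _, rfl, .wait x P⟩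
    | offer x P Q => exact .inr ⟨_, _, _, rfl, .offer x P Q⟩
    | absurd x => exact .inr ⟨_, _, _, rfl, .absurd x⟩
  | opens y z hT =>
    refine ⟨rfl, .inr ?_⟩
    cases hT with
    | send x P => exact ⟨_, _, _, rfl, .send y z x P⟩
    | inl x P => exact ⟨_, _, _, rfl, .inl y z x P⟩
    | inr x P => exact ⟨_, _, _, rfl, .inr y z x P⟩

/-- By the uniqueness of the decomposition, the redex that takes part in a reduction is the one
given by the translation, and hence determines the prefix of the process. -/
theorem prefix_of_plug {n m : ℕ} {ρ : Fin m → Fin n} {Δ : Multiset (Fin n × Fin n)} {F : TCtx n}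
    {K : Const} {V : Term n} {P : Proc m} (hV : IsValue V)
    (h : Represents ρ Δ (F.plug (.capp K V)) P) :
    F.flag = .child ∧ Prefix ρ Δ F.ctx K V P := by
  obtain ⟨hf, ⟨hM, _⟩ | ⟨E, K', V', hM, hp⟩⟩ := thread_cases h
  · exact (F.ctx.not_isValue_plug not_isValue_app (hM ▸ IsValue.unit)).elim
  · obtain ⟨hE, rfl, rfl⟩ := ECtx.plug_capp_inj hV hp.isValue hM
    exact ⟨hf, hE ▸ hp⟩

/-- The thread is finished or blocked on a communication. -/
theorem not_tRed {n m : ℕ} {ρ : Fin m → Fin n} {Δ : Multiset (Fin n × Fin n)} {φ : Flag}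
    {M M' : Term n} {P : Proc m} (h : Represents ρ Δ (.thread φ M) P) : ¬ TRed M M' := by
  intro hr
  obtain ⟨_, ⟨rfl, _⟩ | ⟨E, K, V, hM, hp⟩⟩ := thread_cases h
  · exact hr.not_isValue .unit
  · exact hr.ne_plug_capp E hp.isValue hM

theorem plug_link {n m : ℕ} {ρ : Fin m → Fin n} {Δ : Multiset (Fin n × Fin n)} {F : TCtx n}
    {x y : Fin n} {P : Proc m} (h : Represents ρ Δ (F.plug (.linkVars x y)) P) :
    F = ⟨.child, .hole⟩ ∧ Δ = 0 ∧ ∃ a b, P = .link a b ∧ x = ρ a ∧ y = ρ b := by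
  obtain ⟨hf, hp⟩ := prefix_of_plug (.pair (.var x) (.var y)) h
  obtain ⟨φ, E⟩ := F
  generalize hV : Term.pair (.var x) (.var y) = V at hp
  simp only at hf hp
  cases hp
  simp only [Term.pair.injEq, Term.var.injEq] at hV
  exact ⟨by rw [hf], rfl, _, _, rfl, hV⟩

theorem thread_unit {n m : ℕ} {ρ : Fin m → Fin n} {Δ : Multiset (Fin n × Fin n)} {φ : Flag}
    {P : Proc m} (h : Represents ρ Δ (.thread φ .unit) P) : φ = .child ∧ P = .halt ∧ Δ = 0 := by
  obtain ⟨hf, ⟨_, h⟩ | ⟨E, K', V', hM, hp⟩⟩ := thread_cases h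
  · exact ⟨hf, h⟩
  · exact (E.not_isValue_plug not_isValue_app (hM ▸ IsValue.unit)).elim

theorem link {n m : ℕ} (ρ : Fin m → Fin n) (a b : Fin m) :
    Represents ρ 0 (.thread .child (.linkVars (ρ a) (ρ b))) (.link a b) := .guard (.link a b)

theorem halt {n m : ℕ} (ρ : Fin m → Fin n) :
    Represents ρ 0 (.thread .child .unit) .halt := .guard .halt

/-- Renaming of the configuration only. -/
theorem renameConf {n m n' : ℕ} {ρ : Fin m → Fin n} {Δ : Multiset (Fin n × Fin n)} {C : Conf n}
    {P : Proc m} (h : Represents ρ Δ C P) {ρ' : Fin m → Fin n'} (θ : Fin n → Fin n')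
    (hc : ∀ i, θ (ρ i) = ρ' i) : Represents ρ' (pairsMap θ Δ) (C.rename θ) P := by
  have := h.rename θ id Function.injective_id.injOn (ρ' := ρ') fun i _ => hc i
  rwa [Proc.rename_id] at this

theorem hide_swap {n m : ℕ} {ρ : Fin m → Fin n} {Δ : Multiset (Fin n × Fin n)} {C : Conf (n + 2)}
    {P : Proc m} {d : Fin (n + 2) × Fin (n + 2)} (hd : d = (0, 1) ∨ d = (1, 0))
    (h : Represents (wk2 ∘ ρ) (d ::ₘ pairsMap wk2 Δ) C P) :
    Represents ρ Δ (.res (C.rename swap2)) P := by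
  refine .hide (d := (swap2 d.1, swap2 d.2)) (by rcases hd with rfl | rfl <;> simp) ?_
  rw [← pairsMap_swap2_wk2, ← pairsMap_cons]
  exact h.renameConf swap2 fun i => rfl

theorem exch22_injective {n : ℕ} : Function.Injective (exch22 : Fin (n + 4) → Fin (n + 4)) :=
  Function.LeftInverse.injective (g := exch22) (congrFun exch22_comp_exch22)

theorem swap2_injective {n : ℕ} : Function.Injective (swap2 : Fin (n + 2) → Fin (n + 2)) :=
  Function.LeftInverse.injective (g := swap2) (congrFun swap2_comp_swap2)

/-- A restriction that comes from the process is swapped there as well. For one introduced by the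
translation the process stays the same and only the order of the pair changes, which is why
`Represents` admits both orders. -/
theorem resSwap {n m : ℕ} {ρ : Fin m → Fin n} {Δ : Multiset (Fin n × Fin n)} {C : Conf (n + 2)}
    {P : Proc m} (h : Represents ρ Δ (.res C) P) :
    ∃ P', PCP.SC P P' ∧ Represents ρ Δ (.res (C.rename swap2)) P' := by
  cases h with
  | @res _ _ _ _ _ P h =>
    refine ⟨_, .resSwap P, .res ?_⟩
    rw [← pairsMap_swap2_wk2]
    exact h.rename swap2 swap2 swap2_injective.injOn fun i _ =>
      congrFun (lift2_comp_swap2 ρ).symm i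
  | hide hd h => exact ⟨P, .refl _, hide_swap hd h⟩

theorem par_inv {n m : ℕ} {ρ : Fin m → Fin n} {Δ : Multiset (Fin n × Fin n)} {C D : Conf n}
    {P : Proc m} (h : Represents ρ Δ (.par C D) P) :
    ∃ Δ₁ Δ₂ P₁ P₂, Δ = Δ₁ + Δ₂ ∧ P = .par P₁ P₂ ∧ Represents ρ Δ₁ C P₁ ∧
      Represents ρ Δ₂ D P₂ := by
  cases h with
  | par h₁ h₂ => exact ⟨_, _, _, _, rfl, rfl, h₁, h₂⟩

theorem res_inv {n m : ℕ} {ρ : Fin m → Fin n} {Δ : Multiset (Fin n × Fin n)} {C : Conf (n + 2)}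
    {P : Proc m} (h : Represents ρ Δ (.res C) P) :
    (∃ P', P = .res P' ∧ Represents (lift2 ρ) (pairsMap wk2 Δ) C P') ∨
      ∃ d : Fin (n + 2) × Fin (n + 2), (d = (0, 1) ∨ d = (1, 0)) ∧
        Represents (wk2 ∘ ρ) (d ::ₘ pairsMap wk2 Δ) C P := by
  cases h with
  | res h => exact .inl ⟨_, rfl, h⟩
  | hide hd h => exact .inr ⟨_, hd, h⟩

/-- The process changes only if both restrictions come from it; otherwise an extra restriction moves
past another restriction, which `Represents` does not see. -/
theorem resComm {n m : ℕ} {ρ : Fin m → Fin n} {Δ : Multiset (Fin n × Fin n)} {C : Conf (n + 4)}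
    {P : Proc m} (h : Represents ρ Δ (.res (.res C)) P) :
    ∃ P', PCP.SC P P' ∧ Represents ρ Δ (.res (.res (C.rename exch22))) P' := by
  obtain ⟨P, rfl, h'⟩ | ⟨d, hd, h'⟩ := h.res_inv
  · obtain ⟨P, rfl, h''⟩ | ⟨d, hd, h''⟩ := h'.res_inv
    · refine ⟨_, .resComm P, .res (.res ?_)⟩
      rw [← pairsMap_exch22_wk2]
      exact h''.rename exch22 exch22 exch22_injective.injOn fun i _ =>
        congrFun (lift2_comp_exch22 ρ).symm i
    · have := h''.renameConf exch22 (ρ' := lift2 (wk2 ∘ ρ)) (by simp [forall_fin2])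
      rw [pairsMap_cons, pairsMap_exch22_wk2] at this
      rcases hd with rfl | rfl
      · exact ⟨_, .refl _, .hide (.inl rfl) (.res (by rw [pairsMap_cons]; exact this))⟩
      · exact ⟨_, .refl _, .hide (.inr rfl) (.res (by rw [pairsMap_cons]; exact this))⟩
  · obtain ⟨P, rfl, h''⟩ | ⟨d', hd', h''⟩ := h'.res_inv
    · have := h''.renameConf exch22 (ρ' := wk2 ∘ lift2 ρ) (by simp [forall_fin2])
      rw [pairsMap_cons, pairsMap_cons, pairsMap_exch22_wk2] at this
      rcases hd with rfl | rfl
      · exact ⟨_, .refl _, .res (.hide (.inl rfl) this)⟩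
      · exact ⟨_, .refl _, .res (.hide (.inr rfl) this)⟩
    · have := h''.renameConf exch22 (ρ' := wk2 ∘ wk2 ∘ ρ) (by simp)
      rw [pairsMap_cons, pairsMap_cons, pairsMap_cons, pairsMap_exch22_wk2,
        Multiset.cons_swap] at this
      have key {e e' : Fin (_ + 2) × Fin (_ + 2)} (he : e = (0, 1) ∨ e = (1, 0))
          (he' : e' = (0, 1) ∨ e' = (1, 0)) (h : Represents (wk2 ∘ wk2 ∘ ρ)
            (e ::ₘ (wk2 e'.1, wk2 e'.2) ::ₘ pairsMap wk2 (pairsMap wk2 Δ)) (C.rename exch22) P) :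
          ∃ P', PCP.SC P P' ∧ Represents ρ Δ (.res (.res (C.rename exch22))) P' :=
        ⟨_, .refl _, .hide he' (.hide he (by rw [pairsMap_cons]; exact h))⟩
      rcases hd with rfl | rfl <;> rcases hd' with rfl | rfl
      · exact key (.inl rfl) (.inl rfl) this
      · exact key (.inl rfl) (.inr rfl) this
      · exact key (.inr rfl) (.inl rfl) this
      · exact key (.inr rfl) (.inr rfl) this

theorem resExt {n m : ℕ} {ρ : Fin m → Fin n} {Δ : Multiset (Fin n × Fin n)} {C : Conf n}
    {D : Conf (n + 2)} {P : Proc m} (h : Represents ρ Δ (.res (.par (C.rename wk2) D)) P) :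
    ∃ P', PCP.SC P P' ∧ Represents ρ Δ (.par C (.res D)) P' := by
  obtain ⟨P, rfl, h'⟩ | ⟨d, hd, h'⟩ := h.res_inv
  · obtain ⟨_, _, P, Q, hΔ, rfl, h₁, h₂⟩ := h'.par_inv
    obtain ⟨Δ₁, Δ₂, rfl, rfl, rfl⟩ := pairsMap_eq_add hΔ
    obtain ⟨P', rfl, hP'⟩ := h₁.of_rename (ρ₀ := ρ) wk2_injective wk2_injective (fun k => rfl)
      (by simp only [forall_fin2]; exact ⟨by simp, by simp, fun i _ _ => ⟨i, rfl⟩⟩)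
    exact ⟨_, .resExt _ _, .par hP' (.res h₂)⟩
  · obtain ⟨Δ₁, Δ₂, P, Q, hΔ, rfl, h₁, h₂⟩ := h'.par_inv
    -- The left component does not mention the two names bound last, so the pair is used on the
    -- right.
    have hd' : d ∉ Δ₁ := by
      intro hm
      obtain ⟨j, hj⟩ := h₁.mem_range hm
      rcases hd with rfl | rfl <;> simp at hj
    have hd'' : d ∈ Δ₂ :=
      (Multiset.mem_add.1 (hΔ ▸ Multiset.mem_cons_self d _)).resolve_left hd'
    obtain ⟨Δ₂, rfl⟩ := Multiset.exists_cons_of_mem hd''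
    rw [Multiset.add_cons, Multiset.cons_inj_right] at hΔ
    obtain ⟨Δ₁, Δ₂, rfl, rfl, rfl⟩ := pairsMap_eq_add hΔ
    obtain ⟨P', rfl, hP'⟩ := h₁.of_rename (ρ₀ := ρ) (θ' := id) wk2_injective
      Function.injective_id (fun k => rfl) (fun i _ _ => ⟨i, rfl⟩)
    rw [Proc.rename_id]
    exact ⟨_, .refl _, .par hP' (.hide hd h₂)⟩

theorem resExt_symm {n m : ℕ} {ρ : Fin m → Fin n} {Δ : Multiset (Fin n × Fin n)} {C : Conf n}
    {D : Conf (n + 2)} {P : Proc m} (h : Represents ρ Δ (.par C (.res D)) P) :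
    ∃ P', PCP.SC P P' ∧ Represents ρ Δ (.res (.par (C.rename wk2) D)) P' := by
  cases h with
  | @par _ _ _ Δ₁ Δ₂ _ _ P Q h₁ h₂ =>
    cases h₂ with
    | @res _ _ _ _ _ Q h₂ =>
      refine ⟨_, (PCP.SC.resExt P Q).symm, .res ?_⟩
      rw [pairsMap_add]
      exact .par (h₁.rename wk2 wk2 wk2_injective.injOn fun i _ => rfl) h₂
    | hide hd h₂ =>
      refine ⟨_, .refl _, .hide hd ?_⟩
      rw [pairsMap_add, ← Multiset.add_cons]
      exact .par (h₁.renameConf wk2 fun i => rfl) h₂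

/-- Structural congruence of configurations is matched by that of the processes represented. -/
theorem sC {n : ℕ} {C C' : Conf n} (h : PGV.SC C C') {m : ℕ} {ρ : Fin m → Fin n}
    {Δ : Multiset (Fin n × Fin n)} {P : Proc m} :
    (Represents ρ Δ C P → ∃ P', PCP.SC P P' ∧ Represents ρ Δ C' P') ∧
      (Represents ρ Δ C' P → ∃ P', PCP.SC P P' ∧ Represents ρ Δ C P') := by
  -- Both directions are proved together because the congruence is closed under symmetry.
  induction h generalizing m with
  | linkSwap F x y =>
    have key (x y) (h : Represents ρ Δ (F.plug (.linkVars x y)) P) :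
        ∃ P', PCP.SC P P' ∧ Represents ρ Δ (F.plug (.linkVars y x)) P' := by
      obtain ⟨rfl, rfl, a, b, rfl, rfl, rfl⟩ := h.plug_link
      exact ⟨_, .linkSwap a b, link ρ b a⟩
    exact ⟨key x y, key y x⟩
  | resLink φ =>
    constructor
    · intro h
      cases h with
      | res h =>
        obtain ⟨hF, hΔ, a, b, rfl, ha, hb⟩ := plug_link (F := ⟨φ, .hole⟩) h
        obtain ⟨rfl, _⟩ := (TCtx.mk.injEq ..).mp hF
        rw [pairsMap_eq_zero] at hΔ
        obtain rfl : a = 0 := by revert ha; revert a; simp [forall_fin2]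
        obtain rfl : b = 1 := by revert hb; revert b; simp [forall_fin2]
        exact ⟨_, .resLink, hΔ ▸ halt ρ⟩
      -- A forwarder uses no pending pair, so its restriction is one of the process.
      | hide hd h =>
        obtain ⟨_, hΔ, _⟩ := plug_link (F := ⟨φ, .hole⟩) h
        simp at hΔ
    · intro h
      obtain ⟨rfl, rfl, rfl⟩ := h.thread_unit
      exact ⟨_, PCP.SC.resLink.symm, .res (link _ 0 1)⟩
  | resSwap C =>
    refine ⟨resSwap, fun h => ?_⟩
    obtain ⟨P', hP, h⟩ := h.resSwap
    rw [Conf.rename_rename, swap2_comp_swap2, Conf.rename_id] at h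
    exact ⟨P', hP, h⟩
  | resComm C =>
    refine ⟨resComm, fun h => ?_⟩
    obtain ⟨P', hP, h⟩ := h.resComm
    rw [Conf.rename_rename, exch22_comp_exch22, Conf.rename_id] at h
    exact ⟨P', hP, h⟩
  | resExt C D => exact ⟨resExt, resExt_symm⟩
  | parNil C =>
    constructor
    · intro h
      cases h with
      | par h₁ h₂ =>
        obtain ⟨_, rfl, rfl⟩ := h₂.thread_unit
        rw [add_zero]
        exact ⟨_, .parNil _, h₁⟩
    · intro h
      exact ⟨_, (PCP.SC.parNil P).symm, add_zero Δ ▸ .par h (halt ρ)⟩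
  | parComm C D =>
    have key (C D) (h : Represents ρ Δ (.par C D) P) :
        ∃ P', PCP.SC P P' ∧ Represents ρ Δ (.par D C) P' := by
      obtain ⟨Δ₁, Δ₂, P, Q, rfl, rfl, h₁, h₂⟩ := h.par_inv
      exact ⟨_, .parComm _ _, add_comm Δ₂ Δ₁ ▸ .par h₂ h₁⟩
    exact ⟨key C D, key D C⟩
  | parAssoc C D E =>
    constructor
    · intro h
      obtain ⟨Δ₁, _, _, _, rfl, rfl, h₁, h'⟩ := h.par_inv
      obtain ⟨Δ₂, Δ₃, _, _, rfl, rfl, h₂, h₃⟩ := h'.par_inv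
      exact ⟨_, .parAssoc _ _ _, add_assoc Δ₁ Δ₂ Δ₃ ▸ .par (.par h₁ h₂) h₃⟩
    · intro h
      obtain ⟨_, Δ₃, _, _, rfl, rfl, h', h₃⟩ := h.par_inv
      obtain ⟨Δ₁, Δ₂, _, _, rfl, rfl, h₁, h₂⟩ := h'.par_inv
      exact ⟨_, (PCP.SC.parAssoc _ _ _).symm, (add_assoc Δ₁ Δ₂ Δ₃).symm ▸ .par h₁ (.par h₂ h₃)⟩
  | refl C => exact ⟨fun h => ⟨P, .refl _, h⟩, fun h => ⟨P, .refl _, h⟩⟩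
  | symm _ ih => exact ih.symm
  | trans _ _ ih₁ ih₂ =>
    constructor
    · intro h
      obtain ⟨P₁, e₁, h₁⟩ := ih₁.1 h
      obtain ⟨P₂, e₂, h₂⟩ := ih₂.1 h₁
      exact ⟨P₂, e₁.trans e₂, h₂⟩
    · intro h
      obtain ⟨P₁, e₁, h₁⟩ := ih₂.2 h
      obtain ⟨P₂, e₂, h₂⟩ := ih₁.2 h₁
      exact ⟨P₂, e₁.trans e₂, h₂⟩
  | congRes _ ih =>
    constructor
    · intro h
      cases h with
      | res h => obtain ⟨P', e, h⟩ := ih.1 h; exact ⟨_, .congRes e, .res h⟩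
      | hide hd h => obtain ⟨P', e, h⟩ := ih.1 h; exact ⟨_, e, .hide hd h⟩
    · intro h
      cases h with
      | res h => obtain ⟨P', e, h⟩ := ih.2 h; exact ⟨_, .congRes e, .res h⟩
      | hide hd h => obtain ⟨P', e, h⟩ := ih.2 h; exact ⟨_, e, .hide hd h⟩
  | congPar _ _ ih₁ ih₂ =>
    constructor
    · intro h
      cases h with
      | par h₁ h₂ =>
        obtain ⟨P', e₁, h₁⟩ := ih₁.1 h₁
        obtain ⟨Q', e₂, h₂⟩ := ih₂.1 h₂
        exact ⟨_, .congPar e₁ e₂, .par h₁ h₂⟩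
    · intro h
      cases h with
      | par h₁ h₂ =>
        obtain ⟨P', e₁, h₁⟩ := ih₁.2 h₁
        obtain ⟨Q', e₂, h₂⟩ := ih₂.2 h₂
        exact ⟨_, .congPar e₁ e₂, .par h₁ h₂⟩

end Represents

/-! ### Representation without pending restrictions -/

/-- As `Represents`, where in addition every restriction that the translation introduces is
immediately above the thread that uses it. -/
inductive Canonical : {n m : ℕ} → (Fin m → Fin n) → Multiset (Fin n × Fin n) → Conf n →
    Proc m → Prop
  | closed {n m : ℕ} (ρ : Fin m → Fin n) (P : Proc m) :
      Canonical ρ 0 ((transC P).rename ρ) P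
  | opens {n m : ℕ} {ρ : Fin m → Fin n} {P : Proc m} {T : Term (m + 2)} (y z : Fin n) :
      Opens T P → Canonical ρ {(y, z)} (.thread .child (T.rename (scons y (scons z ρ)))) P
  | par {n m : ℕ} {ρ : Fin m → Fin n} {Δ₁ Δ₂ : Multiset (Fin n × Fin n)} {C D : Conf n}
      {P Q : Proc m} : Canonical ρ Δ₁ C P → Canonical ρ Δ₂ D Q →
      Canonical ρ (Δ₁ + Δ₂) (.par C D) (.par P Q)
  | res {n m : ℕ} {ρ : Fin m → Fin n} {Δ : Multiset (Fin n × Fin n)} {C : Conf (n + 2)}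
      {P : Proc (m + 2)} : Canonical (lift2 ρ) (pairsMap wk2 Δ) C P →
      Canonical ρ Δ (.res C) (.res P)

namespace Canonical

theorem eq_transC {n m : ℕ} {ρ : Fin m → Fin n} {Δ : Multiset (Fin n × Fin n)} {C : Conf n}
    {P : Proc m} (h : Canonical ρ Δ C P) (hΔ : Δ = 0) : C = (transC P).rename ρ := by
  induction h with
  | closed => rfl
  | opens y z => simp at hΔ
  | par _ _ ih₁ ih₂ =>
    rw [add_eq_zero] at hΔ
    rw [ih₁ hΔ.1, ih₂ hΔ.2]; rfl
  | res _ ih => rw [ih (by rw [hΔ, pairsMap_zero])]; rfl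

/-- Without extra restrictions left to place, `C` uses only names from the range of `σ` and from
`Δ`. With `κ = wk2`, a component that does not use the pair being moved is seen to lie outside its
scope. -/
theorem exists_rename_eq {n m n₀ k : ℕ} {σ : Fin m → Fin n} {Δ : Multiset (Fin n × Fin n)}
    {C : Conf n} {P : Proc m} (h : Canonical σ Δ C P) {τ : Fin n → Fin k} {κ : Fin n₀ → Fin k}
    {ρ : Fin m → Fin n₀} {Δ₀ : Multiset (Fin n₀ × Fin n₀)} (hc : ∀ i, τ (σ i) = κ (ρ i))
    (hΔ : pairsMap κ Δ₀ = pairsMap τ Δ) :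
    ∃ C₀, C.rename τ = C₀.rename κ ∧ Canonical ρ Δ₀ C₀ P := by
  induction h generalizing n₀ k with
  | closed σ P =>
    rw [pairsMap_zero, pairsMap_eq_zero] at hΔ
    rw [hΔ]
    refine ⟨_, ?_, .closed ρ P⟩
    rw [Conf.rename_rename, Conf.rename_rename]
    congr 1; funext i; exact hc i
  | opens y z hT =>
    obtain ⟨y₀, z₀, e, rfl⟩ := pairsMap_eq_singleton hΔ
    obtain ⟨hy, hz⟩ := Prod.mk.inj e
    refine ⟨_, ?_, .opens y₀ z₀ hT⟩
    simp only [Conf.rename, Term.rename_rename]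
    congr 2; funext i; revert i; simpa [forall_fin2, hc] using ⟨hy, hz⟩
  | par _ _ ih₁ ih₂ =>
    rw [pairsMap_add] at hΔ
    obtain ⟨Δ₁, Δ₂, rfl, h₁, h₂⟩ := pairsMap_eq_add hΔ
    obtain ⟨C₁, e₁, c₁⟩ := ih₁ hc h₁
    obtain ⟨C₂, e₂, c₂⟩ := ih₂ hc h₂
    exact ⟨_, by simp only [Conf.rename, e₁, e₂], .par c₁ c₂⟩
  | @res n m σ Δ C P h ih =>
    obtain ⟨C₀, e, c⟩ := ih (τ := lift2 τ) (κ := lift2 κ) (ρ := lift2 ρ) (Δ₀ := pairsMap wk2 Δ₀)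
      (by simp [forall_fin2, hc]) (by rw [pairsMap_wk2_lift2, hΔ, pairsMap_wk2_lift2])
    exact ⟨_, by simp only [Conf.rename, e], .res c⟩

/-- A restriction introduced by the translation can be moved to the thread that uses it. -/
theorem push {n m k : ℕ} {σ : Fin m → Fin n} {Δ₁ Δ₂ : Multiset (Fin n × Fin n)} {C : Conf n}
    {P : Proc m} {y z : Fin n} (h : Canonical σ Δ₁ C P) (h₁ : Δ₁ = (y, z) ::ₘ Δ₂)
    {τ : Fin n → Fin (k + 2)} {ρ : Fin m → Fin k} {Δ : Multiset (Fin k × Fin k)}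
    (hy : τ y = 0) (hz : τ z = 1) (hc : ∀ i, τ (σ i) = wk2 (ρ i))
    (hΔ : pairsMap wk2 Δ = pairsMap τ Δ₂) :
    ∃ C', PGV.SC (.res (C.rename τ)) C' ∧ Canonical ρ Δ C' P := by
  induction h generalizing k with
  | closed => simp at h₁
  | @opens n m σ P T y' z' hT =>
    obtain ⟨e, rfl⟩ := (Multiset.singleton_eq_cons_iff _).1 h₁
    obtain ⟨rfl, rfl⟩ := Prod.mk.inj e
    rw [pairsMap_zero, pairsMap_eq_zero] at hΔ
    have : Conf.res (Conf.rename τ (.thread .child (T.rename (scons y' (scons z' σ))))) =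
        (transC P).rename ρ := by
      simp only [hT.transC_eq, Conf.rename, Term.rename_rename]
      congr 3; funext i; revert i; simp [forall_fin2, hy, hz, hc]
    rw [this, hΔ]
    exact ⟨_, .refl _, .closed ρ P⟩
  | @par n m σ ΔL ΔR C D P Q hC hD ihC ihD =>
    -- The pair is used by exactly one component. The other one avoids both names, so scope
    -- extrusion moves the restriction to the component that uses it.
    have hm : (y, z) ∈ ΔL + ΔR := h₁ ▸ Multiset.mem_cons_self _ _
    rcases Multiset.mem_add.1 hm with hm | hm
    · obtain ⟨ΔL, rfl⟩ := Multiset.exists_cons_of_mem hm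
      rw [Multiset.cons_add, Multiset.cons_inj_right] at h₁
      rw [← h₁, pairsMap_add] at hΔ
      obtain ⟨Δ₁, Δ₂, rfl, hΔ₁, hΔ₂⟩ := pairsMap_eq_add hΔ
      obtain ⟨C', e₁, c₁⟩ := ihC rfl hy hz hc hΔ₁
      obtain ⟨D', e₂, c₂⟩ := hD.exists_rename_eq hc hΔ₂
      refine ⟨_, ?_, .par c₁ c₂⟩
      rw [Conf.rename, e₂]
      exact (PGV.SC.congRes (.parComm _ _)).trans ((PGV.SC.resExt _ _).trans
        ((PGV.SC.parComm _ _).trans (e₁.congPar (.refl _))))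
    · obtain ⟨ΔR, rfl⟩ := Multiset.exists_cons_of_mem hm
      rw [Multiset.add_cons, Multiset.cons_inj_right] at h₁
      rw [← h₁, pairsMap_add] at hΔ
      obtain ⟨Δ₁, Δ₂, rfl, hΔ₁, hΔ₂⟩ := pairsMap_eq_add hΔ
      obtain ⟨C', e₁, c₁⟩ := hC.exists_rename_eq hc hΔ₁
      obtain ⟨D', e₂, c₂⟩ := ihD rfl hy hz hc hΔ₂
      refine ⟨_, ?_, .par c₁ c₂⟩
      rw [Conf.rename, e₁]
      exact (PGV.SC.resExt _ _).trans (.congPar (.refl _) e₂)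
  | @res n m σ Δ' C P h ih =>
    -- Below a restriction of the process, the moving restriction is first commuted inwards, which
    -- composes the renaming with `exch22`.
    obtain ⟨C', e, c⟩ := ih (y := wk2 y) (z := wk2 z) (Δ₂ := pairsMap wk2 Δ₂)
      (τ := exch22 ∘ lift2 τ) (ρ := lift2 ρ) (Δ := pairsMap wk2 Δ) (by rw [h₁, pairsMap_cons])
      (by simp [hy]) (by simp [hz]) (by simp [forall_fin2, hc])
      (by rw [← pairsMap_pairsMap, pairsMap_wk2_lift2, ← hΔ, pairsMap_exch22_wk2])
    refine ⟨_, ?_, .res c⟩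
    rw [← Conf.rename_rename] at e
    exact (PGV.SC.resComm _).trans (.congRes e)

end Canonical

theorem Represents.exists_canonical {n m : ℕ} {ρ : Fin m → Fin n} {Δ : Multiset (Fin n × Fin n)}
    {C : Conf n} {P : Proc m} (h : Represents ρ Δ C P) :
    ∃ C', PGV.SC C C' ∧ Canonical ρ Δ C' P := by
  induction h with
  | @guard n m ρ P hP =>
    have := Canonical.closed ρ P
    rw [hP.transC_eq] at this
    exact ⟨_, .refl _, this⟩
  | opens y z hT => exact ⟨_, .refl _, .opens y z hT⟩
  | par _ _ ih₁ ih₂ =>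
    obtain ⟨C₁, e₁, c₁⟩ := ih₁
    obtain ⟨C₂, e₂, c₂⟩ := ih₂
    exact ⟨_, e₁.congPar e₂, .par c₁ c₂⟩
  | res _ ih =>
    obtain ⟨C, e, c⟩ := ih
    exact ⟨_, .congRes e, .res c⟩
  | hide hd _ ih =>
    obtain ⟨C, e, c⟩ := ih
    rcases hd with rfl | rfl
    · obtain ⟨C', e', c'⟩ := c.push rfl (τ := id) rfl rfl (fun i => rfl) (pairsMap_id _).symm
      rw [Conf.rename_id] at e'
      exact ⟨C', e.congRes.trans e', c'⟩
    -- A pair bound in the opposite order is first swapped.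
    · obtain ⟨C', e', c'⟩ := c.push rfl (τ := swap2) rfl rfl (fun i => rfl)
        (pairsMap_swap2_wk2 _).symm
      exact ⟨C', e.congRes.trans ((PGV.SC.resSwap C).trans e'), c'⟩

/-- A configuration that represents `P`, without pending restrictions, is structurally congruent to
the translation of `P`. -/
theorem Represents.sC_transC {n : ℕ} {C : Conf n} {P : Proc n} (h : Represents id 0 C P) :
    PGV.SC C (transC P) := by
  obtain ⟨C', e, c⟩ := h.exists_canonical
  rwa [c.eq_transC rfl, Conf.rename_id] at e

/-! ### Typed processes are consistent -/

namespace PCP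

theorem Consistent.congr {n : ℕ} {P : Proc n} {Γ Γ' : Fin n → Ty} (h : Consistent P Γ)
    (e : ∀ i ∈ P.fv, Γ i = Γ' i) : Consistent P Γ' := by
  induction P with
  | res P ih =>
    obtain ⟨A, h⟩ := h
    refine ⟨A, ih h ?_⟩
    simp only [forall_fin2]
    exact ⟨fun _ => rfl, fun _ => rfl, fun i hi => e i hi⟩
  | par P Q ihP ihQ =>
    exact ⟨ihP h.1 fun i hi => e i (.inl hi), ihQ h.2.1 fun i hi => e i (.inr hi), h.2.2⟩
  | link x y =>
    simp only [Consistent] at h ⊢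
    rw [← e x (.inl rfl), ← e y (.inr rfl), h]
  | halt => trivial
  | absurd x => simp only [Consistent] at h ⊢; rwa [← e x rfl]
  | _ => simp only [Consistent] at h ⊢; rwa [← e _ (.inl rfl)]

theorem Env.ext_ne_none {n : ℕ} {Γ : Env n} {x i : Fin n} {A : Ty} :
    Γ.ext x A i ≠ none ↔ i = x ∨ Γ i ≠ none := by
  by_cases h : i = x <;> simp [Env.ext, Function.update, h]

theorem Typed.fv_subset {n : ℕ} {P : Proc n} {Γ : Env n} (h : Typed P Γ) :
    ∀ i ∈ P.fv, Γ i ≠ none := by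
  have aux {n} {P : Proc n} {Γ : Env n} {x : Fin n} {A B : Ty}
      (ih : ∀ i ∈ P.fv, Γ.ext x A i ≠ none) : ∀ i ∈ P.fv, Γ.ext x B i ≠ none := by
    simpa only [Env.ext_ne_none] using ih
  induction h with
  | link x y A _ => rintro i (rfl | rfl) <;> simp [Env.ext_ne_none]
  | res A _ ih => exact fun i hi => ih (wk2 i) hi
  | par _ _ _ ih₁ ih₂ =>
    rintro i (hi | hi)
    · have := ih₁ i hi; simp only [Env.union, ne_eq, Option.or_eq_none_iff]; tauto
    · have := ih₂ i hi; simp only [Env.union, ne_eq, Option.or_eq_none_iff]; tauto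
  | halt => nofun
  | send _ _ _ ih =>
    rintro i (rfl | hi)
    · simp [Env.ext_ne_none]
    · have := ih i.succ hi; simp only [Env.bind, scons_succ] at this
      rw [Env.ext_ne_none] at *; exact this
  | recv _ _ _ ih =>
    rintro i (rfl | hi)
    · simp [Env.ext_ne_none]
    · have := ih i.succ hi; simp only [Env.bind, scons_succ] at this
      rw [Env.ext_ne_none] at *; exact this
  | close _ _ _ ih => rintro i (rfl | hi) <;> simp_all [Env.ext_ne_none]
  | wait _ _ _ ih => rintro i (rfl | hi) <;> simp_all [Env.ext_ne_none]
  | inl _ _ _ _ ih =>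
    rintro i (rfl | hi)
    · simp [Env.ext_ne_none]
    · exact aux ih i hi
  | inr _ _ _ _ ih =>
    rintro i (rfl | hi)
    · simp [Env.ext_ne_none]
    · exact aux ih i hi
  | offer _ _ _ _ ih₁ ih₂ =>
    rintro i (rfl | hi | hi)
    · simp [Env.ext_ne_none]
    · exact aux ih₁ i hi
    · exact aux ih₂ i hi
  | absurd _ _ => rintro i rfl; simp [Env.ext_ne_none]

/-- The default type `.one 0` for names outside of `Γ` is irrelevant: the free names are typed by
`Typed.fv_subset`, and consistency depends on the free names only. -/
theorem Typed.consistent {n : ℕ} {P : Proc n} {Γ : Env n} (h : Typed P Γ) :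
    Consistent P fun i => (Γ i).getD (.one 0) := by
  have ext_self {n} {Γ : Env n} {x : Fin n} {A : Ty} : Γ.ext x A x = some A :=
    Function.update_self ..
  induction h with
  | link x y A h =>
    have : (Env.empty.ext x A).ext y A.dual x = some A := by
      rw [Env.ext, Function.update_of_ne h, ext_self]
    simp [Consistent, this, ext_self]
  | res A _ ih =>
    refine ⟨A, ih.congr ?_⟩
    simp only [forall_fin2]
    exact ⟨fun _ => rfl, fun _ => rfl, fun i _ => rfl⟩
  | par hd h₁ h₂ ih₁ ih₂ =>
    refine ⟨ih₁.congr fun i hi => ?_, ih₂.congr fun i hi => ?_, ?_⟩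
    · obtain ⟨A, hA⟩ := Option.ne_none_iff_exists'.1 (h₁.fv_subset i hi)
      simp [Env.union, hA]
    · simp [Env.union, (hd i).resolve_right (h₂.fv_subset i hi)]
    · refine Set.disjoint_left.2 fun i hi hi' => ?_
      exact (hd i).elim (h₁.fv_subset i hi) (h₂.fv_subset i hi')
  | halt => trivial
  | send => simp [Consistent, ext_self]
  | recv => simp [Consistent, ext_self]
  | close => simp [Consistent, ext_self]
  | wait => simp [Consistent, ext_self]
  | inl => simp [Consistent, ext_self]
  | inr => simp [Consistent, ext_self]
  | offer => simp [Consistent, ext_self]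
  | absurd => simp [Consistent, ext_self]

/-! ### Closure properties of reduction in Priority CP -/

/-- The transitive closure of reduction. -/
abbrev Reds {n : ℕ} : Proc n → Proc n → Prop := Relation.TransGen Red

/-- A sequence in `Reds` has at least one step, which absorbs a congruence at either end. -/
theorem SC.reds {n : ℕ} {P P' Q : Proc n} (e : SC P P') (h : Reds P' Q) : Reds P Q := by
  induction h with
  | single h => exact .single (.liftSC e h (.refl _))
  | tail _ h ih => exact .tail ih h

theorem Reds.sC {n : ℕ} {P Q Q' : Proc n} (h : Reds P Q) (e : SC Q Q') : Reds P Q' := by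
  cases h with
  | single h => exact .single (.liftSC (.refl _) h e)
  | tail h h' => exact .tail h (.liftSC (.refl _) h' e)

theorem Reds.res {n : ℕ} {P Q : Proc (n + 2)} (h : Reds P Q) : Reds (.res P) (.res Q) :=
  h.lift Proc.res fun _ _ h => .liftRes h

theorem Reds.par {n : ℕ} {P Q : Proc n} (h : Reds P Q) (R : Proc n) :
    Reds (.par P R) (.par Q R) :=
  h.lift (fun P => Proc.par P R) fun _ _ h => .liftPar R h

end PCP

/-! ### Simulation -/

/-- `C` reduces to a configuration that represents a reduct of `P`. The restriction of one of the
pairs in `Δ` may have become a restriction of that reduct. -/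
def Simulated {n m : ℕ} (ρ : Fin m → Fin n) (Δ : Multiset (Fin n × Fin n)) (C : Conf n)
    (P : Proc m) : Prop :=
  ∃ C', CReds C C' ∧ ((∃ Q, Reds P Q ∧ Represents ρ Δ C' Q) ∨
    ∃ y z Δ' Q, Δ = (y, z) ::ₘ Δ' ∧ Reds P (.res Q) ∧ Represents (scons y (scons z ρ)) Δ' C' Q)

namespace Simulated

theorem sC {n m : ℕ} {ρ : Fin m → Fin n} {Δ : Multiset (Fin n × Fin n)} {C : Conf n}
    {P P' : Proc m} (e : PCP.SC P P') (h : Simulated ρ Δ C P') : Simulated ρ Δ C P := by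
  obtain ⟨C', hC, ⟨Q, hQ, hR⟩ | ⟨y, z, Δ', Q, hΔ, hQ, hR⟩⟩ := h
  · exact ⟨C', hC, .inl ⟨Q, e.reds hQ, hR⟩⟩
  · exact ⟨C', hC, .inr ⟨y, z, Δ', Q, hΔ, e.reds hQ, hR⟩⟩

theorem of_cReds {n m : ℕ} {ρ : Fin m → Fin n} {Δ : Multiset (Fin n × Fin n)} {C C' : Conf n}
    {P : Proc m} (e : CReds C C') (h : Simulated ρ Δ C' P) : Simulated ρ Δ C P := by
  obtain ⟨C'', hC, h⟩ := h
  exact ⟨C'', e.trans hC, h⟩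

theorem par {n m : ℕ} {ρ : Fin m → Fin n} {Δ₁ Δ₂ : Multiset (Fin n × Fin n)} {C D : Conf n}
    {P R : Proc m} (h : Simulated ρ Δ₁ C P) (hD : Represents ρ Δ₂ D R) :
    Simulated ρ (Δ₁ + Δ₂) (.par C D) (.par P R) := by
  obtain ⟨C', hC, ⟨Q, hQ, hR⟩ | ⟨y, z, Δ', Q, rfl, hQ, hR⟩⟩ := h
  · exact ⟨_, hC.par .refl, .inl ⟨_, hQ.par R, .par hR hD⟩⟩
  · refine ⟨_, hC.par .refl, .inr ⟨y, z, Δ' + Δ₂, .par Q (R.rename wk2), ?_, ?_, ?_⟩⟩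
    · rw [Multiset.cons_add]
    -- The new restriction of the reduct is extended over `R` by scope extrusion.
    · exact (hQ.par R).sC ((PCP.SC.parComm _ _).trans ((PCP.SC.resExt _ _).symm.trans
        (.congRes (.parComm _ _))))
    · refine .par hR ?_
      have := hD.rename (ρ' := scons y (scons z ρ)) id wk2 wk2_injective.injOn fun i _ => rfl
      rwa [pairsMap_id, Conf.rename_id] at this

theorem res {n m : ℕ} {ρ : Fin m → Fin n} {Δ : Multiset (Fin n × Fin n)} {C : Conf (n + 2)}
    {P : Proc (m + 2)} (h : Simulated (lift2 ρ) (pairsMap wk2 Δ) C P) :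
    Simulated ρ Δ (.res C) (.res P) := by
  obtain ⟨C', hC, ⟨Q, hQ, hR⟩ | ⟨y, z, Δ', Q, hΔ, hQ, hR⟩⟩ := h
  · exact ⟨_, hC.res, .inl ⟨_, hQ.res, .res hR⟩⟩
  -- The pair consists of names from outside this restriction, so the new restriction of the reduct
  -- can be commuted outwards past it.
  · obtain ⟨y, z, Δ₁, e, rfl, rfl⟩ := pairsMap_eq_cons hΔ
    obtain ⟨rfl, rfl⟩ := Prod.mk.inj e
    refine ⟨_, hC.res, .inr ⟨y, z, Δ₁, .res (Q.rename exch22), rfl, ?_, .res ?_⟩⟩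
    · exact hQ.res.sC (.resComm _)
    · have := hR.rename (ρ' := lift2 (scons y (scons z ρ))) id exch22
        Represents.exch22_injective.injOn (by simp [forall_fin2])
      rwa [pairsMap_id, Conf.rename_id] at this

theorem hide {n m : ℕ} {ρ : Fin m → Fin n} {Δ : Multiset (Fin n × Fin n)} {C : Conf (n + 2)}
    {P : Proc m} {d : Fin (n + 2) × Fin (n + 2)} (hd : d = (0, 1) ∨ d = (1, 0))
    (h : Simulated (wk2 ∘ ρ) (d ::ₘ pairsMap wk2 Δ) C P) : Simulated ρ Δ (.res C) P := by
  obtain ⟨C', hC, ⟨Q, hQ, hR⟩ | ⟨y, z, Δ', Q, hΔ, hQ, hR⟩⟩ := h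
  · exact ⟨_, hC.res, .inl ⟨_, hQ, .hide hd hR⟩⟩
  -- Either the pair that became a channel of the reduct is bound right here, and the extra
  -- restriction turns into one of the process, or it is bound further out and stays pending.
  · rcases Multiset.cons_eq_cons.1 hΔ with ⟨rfl, rfl⟩ | ⟨_, Δ'', hΔ', rfl⟩
    · rcases hd with hd | hd <;> obtain ⟨rfl, rfl⟩ := Prod.mk.inj hd
      · refine ⟨_, hC.res, .inl ⟨_, hQ, .res ?_⟩⟩
        rw [lift2_eq]; exact hR
      · refine ⟨_, hC.res, .inl ⟨_, hQ.sC (.resSwap _), .res ?_⟩⟩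
        have := hR.rename (ρ' := lift2 ρ) id swap2
          Represents.swap2_injective.injOn (by simp [forall_fin2])
        rwa [pairsMap_id, Conf.rename_id] at this
    · obtain ⟨y, z, Δ₁, e, rfl, rfl⟩ := pairsMap_eq_cons hΔ'
      obtain ⟨rfl, rfl⟩ := Prod.mk.inj e
      refine ⟨_, hC.res, .inr ⟨y, z, Δ₁, Q, rfl, hQ, .hide hd ?_⟩⟩
      have : wk2 ∘ scons y (scons z ρ) = scons (wk2 y) (scons (wk2 z) (wk2 ∘ ρ)) := by
        funext i; revert i; simp [forall_fin2]
      rwa [this]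

end Simulated

/-! ### Forwarders and closing signals -/

theorem lift2_eq_zero {n m : ℕ} {ρ : Fin n → Fin m} {i : Fin (n + 2)} : lift2 ρ i = 0 ↔ i = 0 := by
  revert i; simp [forall_fin2]

theorem lift2_eq_one {n m : ℕ} {ρ : Fin n → Fin m} {i : Fin (n + 2)} : lift2 ρ i = 1 ↔ i = 1 := by
  revert i; simp [forall_fin2]

namespace Represents

theorem plug_close {n m : ℕ} {ρ : Fin m → Fin n} {Δ : Multiset (Fin n × Fin n)} {F : TCtx n}
    {x : Fin n} {P : Proc m} (h : Represents ρ Δ (F.plug (.capp .close (.var x))) P) :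
    Δ = 0 ∧ ∃ a P', P = .close a P' ∧ x = ρ a ∧
      F = ⟨.child, .andThen .hole ((transM P').rename ρ)⟩ := by
  obtain ⟨hf, hp⟩ := prefix_of_plug (.var x) h
  obtain ⟨φ, E⟩ := F
  generalize hV : Term.var x = V at hp
  simp only at hf hp
  cases hp
  exact ⟨rfl, _, _, rfl, Term.var.inj hV, by rw [hf]⟩

theorem plug_wait {n m : ℕ} {ρ : Fin m → Fin n} {Δ : Multiset (Fin n × Fin n)} {F : TCtx n}
    {x : Fin n} {P : Proc m} (h : Represents ρ Δ (F.plug (.capp .wait (.var x))) P) :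
    Δ = 0 ∧ ∃ a P', P = .wait a P' ∧ x = ρ a ∧
      F = ⟨.child, .andThen .hole ((transM P').rename ρ)⟩ := by
  obtain ⟨hf, hp⟩ := prefix_of_plug (.var x) h
  obtain ⟨φ, E⟩ := F
  generalize hV : Term.var x = V at hp
  simp only at hf hp
  cases hp
  exact ⟨rfl, _, _, rfl, Term.var.inj hV, by rw [hf]⟩

end Represents

theorem replace_comp_wk2 {n : ℕ} (w : Fin (n + 2)) :
    (replace w 1 : Fin (n + 2) → Fin (n + 2)) ∘ wk2 = wk2 := by
  funext i; simp [replace, Function.update]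

theorem simulated_link {n m : ℕ} {ρ : Fin m → Fin n} {Δ : Multiset (Fin n × Fin n)} {F : TCtx n}
    {w : Fin (n + 2)} {C : Conf (n + 2)} {D : Conf n} {P : Proc m} {Γ : Fin m → Ty}
    (h : C.rename (replace w 1) = D.rename wk2)
    (hR : Represents ρ Δ (.res (.par ((F.rename wk2).plug (.linkVars w 0)) C)) P)
    (hP : Consistent P Γ) : Simulated ρ Δ (.par (F.plug .unit) D) P := by
  obtain ⟨P, rfl, h'⟩ | ⟨d, hd, h'⟩ := hR.res_inv
  · obtain ⟨Δ₁, Δ₂, P₁, P₂, hΔ, rfl, h₁, h₂⟩ := h'.par_inv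
    obtain ⟨hF, rfl, a, b, rfl, rfl, hb⟩ := h₁.plug_link
    obtain rfl := lift2_eq_zero.1 hb.symm
    obtain rfl : F = ⟨.child, .hole⟩ := by
      obtain ⟨φ, E⟩ := F
      simp only [TCtx.rename, TCtx.mk.injEq] at hF
      cases E <;> simp_all [ECtx.rename]
    rw [zero_add] at hΔ
    subst hΔ
    obtain ⟨A, -, -, hd⟩ := hP
    -- As parallel processes share no names, the name that replaces `1` is not free in `P₂`. Hence
    -- the substitution is injective on the free names and commutes with the translation.
    have ha : a ∉ P₂.fv := Set.disjoint_left.1 hd (.inl rfl)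
    have h₃ := h₂.rename (ρ' := lift2 ρ) (replace (lift2 ρ a) 1) (replace a 1)
      (by
        have aux : ∀ i ∈ P₂.fv, replace a 1 i = a → i = 1 := fun i hi e => by
          by_contra hi1
          rw [replace, Function.update_of_ne hi1] at e
          exact ha (e ▸ hi)
        intro i hi j hj e
        by_cases hi1 : i = 1
        · subst hi1
          rw [replace, Function.update_self] at e
          exact (aux j hj e.symm).symm
        · by_cases hj1 : j = 1
          · subst hj1
            rw [replace, Function.update_self] at e
            exact aux i hi e
          · simpa [replace, Function.update_of_ne, hi1, hj1] using e)
      (fun i _ => by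
        by_cases hi1 : i = 1
        · subst hi1; simp [replace]
        · have : lift2 ρ i ≠ 1 := fun e => hi1 (lift2_eq_one.1 e)
          simp [replace, Function.update_of_ne, hi1, this])
    rw [pairsMap_pairsMap, replace_comp_wk2, h] at h₃
    obtain ⟨Q, hQ, hD⟩ := h₃.of_rename (ρ₀ := ρ) wk2_injective wk2_injective (fun k => rfl)
      (by simp only [forall_fin2]; exact ⟨by simp, by simp, fun i _ _ => ⟨i, rfl⟩⟩)
    refine ⟨_, .refl, .inl ⟨.par .halt Q, ?_, zero_add Δ ▸ .par (.halt ρ) hD⟩⟩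
    exact Reds.sC (.single (.link a P₂ Q hQ))
      ((PCP.SC.parNil Q).symm.trans (.parComm _ _))
  -- A forwarder acts on names of the process, never on an end of an extra restriction.
  · obtain ⟨Δ₁, Δ₂, P₁, P₂, hΔ, rfl, h₁, h₂⟩ := h'.par_inv
    obtain ⟨_, _, a, b, _, _, hb⟩ := h₁.plug_link
    exact (zero_ne_wk2 _ hb).elim

theorem cReds_andThen_unit {n : ℕ} (M : Term n) :
    CReds (.thread .child (.andThen .unit M)) (.thread .child M) := (TRed.unit M).cReds

theorem cReds_thread_transC {n m : ℕ} (P : Proc m) (ρ : Fin m → Fin n) :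
    CReds (.thread .child ((transM P).rename ρ)) ((transC P).rename ρ) :=
  (cReds_transC P).rename ρ

theorem simulated_close {n m : ℕ} {ρ : Fin m → Fin n} {Δ : Multiset (Fin n × Fin n)}
    {F F' : TCtx n} {P : Proc m}
    (hR : Represents ρ Δ (.res (.par ((F.rename wk2).plug (.capp .wait (.var 0)))
      ((F'.rename wk2).plug (.capp .close (.var 1))))) P) :
    Simulated ρ Δ (.par (F.plug .unit) (F'.plug .unit)) P := by
  have key {F : TCtx n} {P : Proc (m + 2)}
      (hF : F.rename wk2 = ⟨.child, .andThen .hole ((transM P).rename (lift2 ρ))⟩) :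
      ∃ P', P = P'.rename wk2 ∧ F = ⟨.child, .andThen .hole ((transM P').rename ρ)⟩ := by
    obtain ⟨φ, E⟩ := F
    simp only [TCtx.rename, TCtx.mk.injEq] at hF
    obtain ⟨rfl, hE⟩ := hF
    cases E with
    | andThen E M =>
      simp only [ECtx.rename, ECtx.andThen.injEq] at hE
      obtain ⟨hE, hM⟩ := hE
      cases E <;> simp only [ECtx.rename, reduceCtorEq] at hE
      -- The thread context mentions neither end of the channel, so neither does the continuation
      -- that it contains.
      obtain ⟨P', rfl⟩ := P.exists_eq_rename (ρ := wk2) fun i hi => by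
        have : lift2 ρ i ∈ (M.rename wk2).fv := by
          rw [hM, Term.fv_rename, fv_transM]; exact ⟨i, hi, rfl⟩
        rw [Term.fv_rename] at this
        obtain ⟨j, _, e⟩ := this
        revert e; revert i
        simp only [forall_fin2]
        exact ⟨by simp, by simp, fun i _ _ => ⟨i, rfl⟩⟩
      refine ⟨P', rfl, ?_⟩
      rw [transM_rename _ wk2_injective.injOn, Term.rename_rename, lift2_comp_wk2,
        ← Term.rename_rename] at hM
      rw [Term.rename_injective wk2_injective hM]
    | _ => simp [ECtx.rename] at hE
  obtain ⟨P, rfl, h'⟩ | ⟨d, hd, h'⟩ := hR.res_inv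
  · obtain ⟨Δ₁, Δ₂, P₁, P₂, hΔ, rfl, h₁, h₂⟩ := h'.par_inv
    obtain ⟨rfl, a, P₁, rfl, ha, hF⟩ := h₁.plug_wait
    obtain ⟨rfl, b, P₂, rfl, hb, hF'⟩ := h₂.plug_close
    obtain rfl := lift2_eq_zero.1 ha.symm
    obtain rfl := lift2_eq_one.1 hb.symm
    rw [add_zero, pairsMap_eq_zero] at hΔ
    obtain ⟨P₁, rfl, rfl⟩ := key hF
    obtain ⟨P₂, rfl, rfl⟩ := key hF'
    subst hΔ
    refine ⟨_, .par ((cReds_andThen_unit _).trans (cReds_thread_transC P₁ ρ))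
      ((cReds_andThen_unit _).trans (cReds_thread_transC P₂ ρ)), .inl ⟨.par P₁ P₂, ?_, ?_⟩⟩
    -- The two calculi list the closing and the waiting side in opposite orders, so both the
    -- components and the ends of the channel are exchanged.
    · refine .single (.liftSC ?_ (.close P₂ P₁) (.parComm _ _))
      refine (PCP.SC.congRes (.parComm _ _)).trans ((PCP.SC.resSwap _).trans ?_)
      simp only [Proc.rename, Proc.rename_rename]
      exact .refl _
    · exact .par (.of_transC P₁ ρ) (.of_transC P₂ ρ)
  · obtain ⟨Δ₁, Δ₂, P₁, P₂, hΔ, rfl, h₁, h₂⟩ := h'.par_inv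
    obtain ⟨_, a, _, _, ha, _⟩ := h₁.plug_wait
    exact (zero_ne_wk2 _ ha).elim

/-! ### Communication -/

/-- The sender gets its own end of the channel back and keeps `y` for the bound name; `z` has left
with the message. -/
theorem cReds_output {n m : ℕ} (ρ : Fin m → Fin n) (y z : Fin (n + 2)) (P : Proc (m + 3)) :
    CReds (.thread .child (.app (.lam ((((transM P).rename (lift Fin.succ)).rename
        (rebind (wk2 0))).rename (lift (scons y (scons z (lift2 ρ)))))) (.var 0)))
      ((transC P).rename (scons y (lift2 ρ))) := by
  refine .trans (TRed.lam _ (.var _)).cReds ?_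
  have : ((((transM P).rename (lift Fin.succ)).rename
      (rebind (wk2 0))).rename (lift (scons y (scons z (lift2 ρ))))).inst (.var 0) =
      (transM P).rename (scons y (lift2 ρ)) := by
    rw [Term.inst_var]
    simp only [Term.rename_rename]
    congr 1; funext i; revert i
    have e : ∀ i : Fin (m + 2), lift Fin.succ i.succ = wk2 i := fun _ => rfl
    have e1 : (rebind (wk2 0) 0 : Fin (m + 5)) = Fin.succ 0 := rebind_of_ne (zero_ne_wk2 _)
    simp only [forall_fin1 (n := m + 2), Function.comp_apply, lift_zero, e, e1, lift_succ,
      scons_zero, scons_succ, id, true_and]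
    intro i
    by_cases hi : i = 0
    · subst hi; rw [rebind_self]; rfl
    · rw [rebind_of_ne (by simpa using hi)]; rfl
  rw [this]
  exact cReds_thread_transC P _

theorem cReds_input {n m : ℕ} (ρ : Fin m → Fin n) (z : Fin (n + 2)) (P : Proc (m + 3)) :
    CReds (.thread .child (.letPair (.pair (.var z) (.var 1))
        (((transM P).rename (rebind2 1)).rename (lift2 (lift2 ρ)))))
      ((transC P).rename (scons z (lift2 ρ))) := by
  refine .trans (TRed.pair _ (.var _) (.var _)).cReds ?_
  have : (((transM P).rename (rebind2 1)).rename (lift2 (lift2 ρ))).inst2 (.var z) (.var 1) =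
      (transM P).rename (scons z (lift2 ρ)) := by
    rw [Term.inst2_var]
    simp only [Term.rename_rename]
    congr 1; funext i; revert i
    simp only [forall_fin1 (n := m + 2), Function.comp_apply, rebind2_zero, lift2_zero,
      scons_zero, scons_succ, true_and]
    intro i
    by_cases hi : i = 1
    · subst hi; rw [rebind2_self]; rfl
    · rw [rebind2_of_ne hi]; rfl
  rw [this]
  exact cReds_thread_transC P _

/-- The pending pair `(y, z)` is the channel that the reduct of the process creates: `P` holds `y`
and `Q` holds `z`. The restriction of this channel is commuted outwards, to where the pair is bound.
-/
theorem simulated_output {n m : ℕ} (ρ : Fin m → Fin n) (y z : Fin n) (P Q : Proc (m + 3)) :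
    Simulated ρ {(y, z)}
      (.res (.par ((transC P).rename (scons (wk2 y) (lift2 ρ)))
        ((transC Q).rename (scons (wk2 z) (lift2 ρ)))))
      (.res (.par (.send 0 P) (.recv 1 Q))) := by
  refine ⟨_, .refl, .inr ⟨y, z, 0, .res ((Proc.par (P.rename (lift Fin.succ))
    (Q.rename Fin.succ)).rename exch22), rfl, ?_, .res ?_⟩⟩
  · exact Reds.sC (.single (.send P Q)) (.resComm _)
  · have h₁ := (Represents.of_transC P (scons (wk2 y) (lift2 ρ))).rename
      (ρ' := lift2 (scons y (scons z ρ))) id (exch22 ∘ lift Fin.succ)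
      (Represents.exch22_injective.comp (lift_injective (Fin.succ_injective _))).injOn ?_
    have h₂ := (Represents.of_transC Q (scons (wk2 z) (lift2 ρ))).rename
      (ρ' := lift2 (scons y (scons z ρ))) id (exch22 ∘ Fin.succ)
      (Represents.exch22_injective.comp (Fin.succ_injective _)).injOn ?_
    · rw [pairsMap_zero, Conf.rename_id] at h₁ h₂
      simp only [Proc.rename, Proc.rename_rename]
      exact .par h₁ h₂
    · simp only [forall_fin1 (n := m + 2), forall_fin2]
      exact ⟨fun _ => rfl, fun _ => rfl, fun _ => rfl, fun i _ => rfl⟩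
    · simp only [forall_fin1 (n := m + 2), forall_fin2]
      exact ⟨fun _ => rfl, fun _ => rfl, fun _ => rfl, fun i _ => rfl⟩

/-- The exchange of the closing signal that ends a selection. -/
theorem cRed_close_wait {n : ℕ} (F F' : TCtx n) :
    CRed (.res (.par ((F.rename wk2).plug (.capp .close (.var 0)))
        ((F'.rename wk2).plug (.capp .wait (.var 1)))))
      (.par (F.plug .unit) (F'.plug .unit)) := by
  refine .liftSC ?_ (.close F' F) (.parComm _ _)
  refine (PGV.SC.congRes (.parComm _ _)).trans ((PGV.SC.resSwap _).trans ?_)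
  simp only [Conf.rename, TCtx.rename_plug, TCtx.rename_rename]
  exact .refl _

/-- The continuation of a selection or of a branch, whose channel `0` or `1` is replaced by the
index `0`. -/
def branchCont {n m : ℕ} (ρ : Fin m → Fin n) (M : Term (m + 2)) : Term (n + 1) :=
  M.rename (scons 0 (scons 0 (Fin.succ ∘ ρ)))

theorem branchCont_inst {n m : ℕ} (ρ : Fin m → Fin n) (M : Term (m + 2)) (z : Fin n) :
    (branchCont ρ M).inst (.var z) = M.rename (scons z (scons z ρ)) := by
  rw [branchCont, Term.inst_var, Term.rename_rename]
  congr 1; funext i; revert i; simp [forall_fin2]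

/-- The closing rule requires contexts that do not mention the channel. The selector does not use
the other end, and its own end is shadowed in the continuation, so the latter is a weakening. -/
theorem selectCont_eq {n m : ℕ} (ρ : Fin m → Fin n) (y z : Fin (n + 2)) {M : Term (m + 2)}
    (h : 1 ∉ M.fv) :
    ((M.rename wk2).rename (rebind (wk2 0))).rename (lift (scons y (scons z (lift2 ρ)))) =
      (branchCont ρ M).rename (lift wk2) := by
  simp only [branchCont, Term.rename_rename]
  refine Term.rename_congr _ ?_
  simp only [forall_fin2, Function.comp_apply, rebind_self]
  refine ⟨fun _ => rfl, fun h' => (h h').elim, fun i _ => ?_⟩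
  rw [rebind_of_ne (by simp)]; rfl

/-- A branch uses neither the far end of the channel nor the received pair directly, and its own end
is shadowed. So the substitution of `V` and `W` has no effect beyond removing their binders. -/
theorem offerCont_eq {n m : ℕ} (ρ : Fin m → Fin n) {M : Term (m + 2)} (h : 0 ∉ M.fv)
    (V W : Term (n + 2)) :
    (((M.rename wk2).rename (rebind (wk2 1))).rename (lift (lift2 (lift2 ρ)))).subst
      (liftSubst (scons V (scons W .var))) = (branchCont ρ M).rename (lift wk2) := by
  have e : ((M.rename wk2).rename (rebind (wk2 1))).rename (lift (lift2 (lift2 ρ))) =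
      ((branchCont ρ M).rename (lift wk2)).rename (lift wk2) := by
    simp only [branchCont, Term.rename_rename]
    refine Term.rename_congr _ ?_
    simp only [forall_fin2, Function.comp_apply, rebind_self]
    refine ⟨fun h' => (h h').elim, fun _ => rfl, fun i _ => ?_⟩
    rw [rebind_of_ne (by simp)]; rfl
  rw [e, Term.subst_rename, ← liftSubst_comp_lift]
  have : scons V (scons W Term.var) ∘ wk2 = Term.var ∘ id := rfl
  rw [this, liftSubst_var, Term.subst_var, lift_id, Term.rename_id]

/-- A selection, after the selected branch has been communicated. -/
theorem cReds_select {n m : ℕ} (ρ : Fin m → Fin n) (y z : Fin n) (P Q : Proc (m + 2))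
    {L : Term n} (hL : TRed L ((branchCont ρ (transM Q)).inst (.var y))) :
    CReds (.res (.par (.thread .child (.app (.lam ((branchCont ρ (transM P)).rename (lift wk2)))
          (.andThen (.capp .close (.var 0)) (.var (wk2 z)))))
        (.thread .child (.andThen (.capp .wait (.var 1)) (L.rename wk2)))))
      (.par ((transC P).rename (scons z (scons z ρ)))
        ((transC Q).rename (scons y (scons y ρ)))) := by
  refine .head (cRed_close_wait ⟨.child, .appR (.lam (branchCont ρ (transM P))) (.lam _)
    (.andThen .hole (.var z))⟩ ⟨.child, .andThen .hole L⟩) (CReds.par ?_ ?_)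
  · refine .trans (TRed.lift (.appR _ (.lam _) .hole) (.unit (.var z))).cReds ?_
    refine .trans (TRed.lam _ (.var z)).cReds ?_
    rw [branchCont_inst]
    exact cReds_thread_transC P _
  · refine (cReds_andThen_unit _).trans (hL.cReds.trans ?_)
    rw [branchCont_inst]
    exact cReds_thread_transC Q _

/-- The old channel is gone and the pair `(y, z)` plays its role. The selector holds `z` and the
chosen branch holds `y`, the reverse of the order in the process, hence the swap. -/
theorem simulated_select {n m : ℕ} (ρ : Fin m → Fin n) (y z : Fin n) {P Q : Proc (m + 2)}
    {R : Proc m} (hP : 1 ∉ P.fv) (hQ : 0 ∉ Q.fv) (hR : Red R (.res (.par P Q))) :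
    Simulated ρ {(y, z)} (.par ((transC P).rename (scons z (scons z ρ)))
      ((transC Q).rename (scons y (scons y ρ)))) R := by
  refine ⟨_, .refl, .inr ⟨y, z, 0, (Proc.par P Q).rename swap2, rfl, ?_, ?_⟩⟩
  · exact Reds.sC (.single hR) (.resSwap _)
  · have h₁ := (Represents.of_transC P (scons z (scons z ρ))).rename
      (ρ' := scons y (scons z ρ)) id swap2 Represents.swap2_injective.injOn
      (by simp only [forall_fin2]; exact ⟨fun _ => rfl, fun h => (hP h).elim, fun i _ => rfl⟩)
    have h₂ := (Represents.of_transC Q (scons y (scons y ρ))).rename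
      (ρ' := scons y (scons z ρ)) id swap2 Represents.swap2_injective.injOn
      (by simp only [forall_fin2]; exact ⟨fun h => (hQ h).elim, fun _ => rfl, fun i _ => rfl⟩)
    rw [pairsMap_zero, Conf.rename_id] at h₁ h₂
    exact .par h₁ h₂

/-- Both inputs and branchings are translated to `recv`, and both outputs and selections to `send`,
so the redexes alone allow nine combinations of prefixes. The dual types at the two ends leave
three. -/
theorem simulated_send {n m : ℕ} {ρ : Fin m → Fin n} {Δ : Multiset (Fin n × Fin n)}
    {F F' : TCtx (n + 2)} {V : Term (n + 2)} {P : Proc m} {Γ : Fin m → Ty} (hV : IsValue V)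
    (hR : Represents ρ Δ (.res (.par (F.plug (.capp .send (.pair V (.var 0))))
      (F'.plug (.capp .recv (.var 1))))) P) (hP : Consistent P Γ) :
    Simulated ρ Δ (.res (.par (F.plug (.var 0)) (F'.plug (.pair V (.var 1))))) P := by
  obtain ⟨P, rfl, h'⟩ | ⟨d, hd, h'⟩ := hR.res_inv
  · obtain ⟨Δ₁, Δ₂, P₁, P₂, hΔ, rfl, h₁, h₂⟩ := h'.par_inv
    obtain ⟨hf, hp⟩ := h₁.prefix_of_plug (.pair hV (.var 0))
    obtain ⟨hf', hp'⟩ := h₂.prefix_of_plug (.var 1)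
    obtain ⟨φ, E⟩ := F
    obtain ⟨φ', E'⟩ := F'
    obtain ⟨A, hc, hc', hdj⟩ := hP
    simp only at hf hf' hp hp'
    subst hf hf'
    generalize hW : Term.pair V (.var 0) = W at hp
    generalize hW' : (Term.var 1 : Term (n + 2)) = W' at hp'
    cases hp with
    | send y z x P =>
      obtain ⟨rfl, hx⟩ := (Term.pair.injEq ..).mp hW
      obtain rfl := lift2_eq_zero.1 (Term.var.inj hx).symm
      cases hp' with
      | recv x Q =>
        obtain rfl := lift2_eq_one.1 (Term.var.inj hW').symm
        rw [add_zero] at hΔ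
        obtain ⟨y, z, e, rfl⟩ := pairsMap_eq_singleton hΔ
        obtain ⟨rfl, rfl⟩ := Prod.mk.inj e
        exact .of_cReds (((cReds_output ρ _ _ P).par (cReds_input ρ _ Q)).res)
          (simulated_output ρ y z P Q)
      | offer x Q R =>
        obtain rfl := lift2_eq_one.1 (Term.var.inj hW').symm
        simp only [Consistent, scons_zero, scons_one] at hc hc'
        obtain ⟨o, B, C, rfl⟩ := hc
        simp [Ty.dual] at hc'
      | absurd x =>
        obtain rfl := lift2_eq_one.1 (Term.var.inj hW').symm
        simp only [Consistent, scons_zero, scons_one] at hc hc'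
        obtain ⟨o, B, C, rfl⟩ := hc
        simp [Ty.dual] at hc'
    | inl y z x P =>
      obtain ⟨rfl, hx⟩ := (Term.pair.injEq ..).mp hW
      obtain rfl := lift2_eq_zero.1 (Term.var.inj hx).symm
      cases hp' with
      | recv x Q =>
        obtain rfl := lift2_eq_one.1 (Term.var.inj hW').symm
        simp only [Consistent, scons_zero, scons_one] at hc hc'
        obtain ⟨o, B, C, rfl⟩ := hc
        simp [Ty.dual] at hc'
      | offer x Q R =>
        obtain rfl := lift2_eq_one.1 (Term.var.inj hW').symm
        rw [add_zero] at hΔ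
        obtain ⟨y, z, e, rfl⟩ := pairsMap_eq_singleton hΔ
        obtain ⟨rfl, rfl⟩ := Prod.mk.inj e
        -- Each of the two parallel processes uses one end of the channel in its prefix, so the
        -- other does not mention that end.
        have hP : 1 ∉ P.fv := fun h => Set.disjoint_left.1 hdj (.inr h) (.inl rfl)
        have hQ : 0 ∉ Q.fv := fun h => Set.disjoint_left.1 hdj (.inl rfl) (.inr (.inl h))
        have hR : 0 ∉ R.fv := fun h => Set.disjoint_left.1 hdj (.inl rfl) (.inr (.inr h))
        refine .of_cReds (.trans (CReds.res (CReds.par .refl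
          (TRed.pair _ (.inl (.var _)) (.var _)).cReds)) ?_)
          (simulated_select ρ y z hP hQ (.selectInl P Q R))
        have := cReds_select ρ y z P Q (.inl (branchCont ρ (transM Q)) (branchCont ρ (transM R))
          (.var y))
        rw [← selectCont_eq ρ (wk2 y) (wk2 z) (by rwa [fv_transM])] at this
        simp only [Term.rename] at this
        rw [← offerCont_eq ρ (by rwa [fv_transM]) (.inl (.var (wk2 y))) (.var 1),
          ← offerCont_eq ρ (by rwa [fv_transM]) (.inl (.var (wk2 y))) (.var 1)] at this
        exact this
      | absurd x =>
        obtain rfl := lift2_eq_one.1 (Term.var.inj hW').symm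
        simp only [Consistent, scons_zero, scons_one] at hc hc'
        obtain ⟨o, B, C, rfl⟩ := hc
        simp [Ty.dual] at hc'
    | inr y z x P =>
      obtain ⟨rfl, hx⟩ := (Term.pair.injEq ..).mp hW
      obtain rfl := lift2_eq_zero.1 (Term.var.inj hx).symm
      cases hp' with
      | recv x Q =>
        obtain rfl := lift2_eq_one.1 (Term.var.inj hW').symm
        simp only [Consistent, scons_zero, scons_one] at hc hc'
        obtain ⟨o, B, C, rfl⟩ := hc
        simp [Ty.dual] at hc'
      | offer x Q R =>
        obtain rfl := lift2_eq_one.1 (Term.var.inj hW').symm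
        rw [add_zero] at hΔ
        obtain ⟨y, z, e, rfl⟩ := pairsMap_eq_singleton hΔ
        obtain ⟨rfl, rfl⟩ := Prod.mk.inj e
        have hP : 1 ∉ P.fv := fun h => Set.disjoint_left.1 hdj (.inr h) (.inl rfl)
        have hQ : 0 ∉ Q.fv := fun h => Set.disjoint_left.1 hdj (.inl rfl) (.inr (.inl h))
        have hR : 0 ∉ R.fv := fun h => Set.disjoint_left.1 hdj (.inl rfl) (.inr (.inr h))
        refine .of_cReds (.trans (CReds.res (CReds.par .refl
          (TRed.pair _ (.inr (.var _)) (.var _)).cReds)) ?_)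
          (simulated_select ρ y z hP hR (.selectInr P Q R))
        have := cReds_select ρ y z P R (.inr (branchCont ρ (transM Q)) (branchCont ρ (transM R))
          (.var y))
        rw [← selectCont_eq ρ (wk2 y) (wk2 z) (by rwa [fv_transM])] at this
        simp only [Term.rename] at this
        rw [← offerCont_eq ρ (by rwa [fv_transM]) (.inr (.var (wk2 y))) (.var 1),
          ← offerCont_eq ρ (by rwa [fv_transM]) (.inr (.var (wk2 y))) (.var 1)] at this
        exact this
      | absurd x =>
        obtain rfl := lift2_eq_one.1 (Term.var.inj hW').symm
        simp only [Consistent, scons_zero, scons_one] at hc hc'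
        obtain ⟨o, B, C, rfl⟩ := hc
        simp [Ty.dual] at hc'
  -- A thread receives only on a name of the process, never on an end of an extra restriction.
  · obtain ⟨Δ₁, Δ₂, P₁, P₂, hΔ, rfl, h₁, h₂⟩ := h'.par_inv
    obtain ⟨_, hp'⟩ := h₂.prefix_of_plug (.var 1)
    generalize hW' : (Term.var 1 : Term (n + 2)) = W' at hp'
    generalize F'.ctx = E' at hp'
    cases hp' <;> exact (one_ne_wk2 _ (Term.var.inj hW')).elim

/-- Every reduction of a configuration that represents a consistent process is the start of a
sequence of reductions that simulates reductions of the process. -/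
theorem simulated_of_cRed {n : ℕ} {C C' : Conf n} (h : CRed C C') {m : ℕ} {ρ : Fin m → Fin n}
    {Δ : Multiset (Fin n × Fin n)} {P : Proc m} {Γ : Fin m → Ty} (hR : Represents ρ Δ C P)
    (hP : Consistent P Γ) : Simulated ρ Δ C' P := by
  induction h generalizing m with
  | link F w C D h => exact simulated_link h hR hP
  -- `new` is not the redex of any prefix; the same applies to `spawn`.
  | new F =>
    obtain ⟨_, hp⟩ := hR.prefix_of_plug .unit
    generalize F.ctx = E at hp
    cases hp
  | spawn F hV =>
    obtain ⟨_, hp⟩ := hR.prefix_of_plug hV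
    generalize F.ctx = E at hp
    cases hp
  | send F F' hV => exact simulated_send hV hR hP
  | close F F' => exact simulated_close hR
  | liftPar D _ ih =>
    obtain ⟨Δ₁, Δ₂, P₁, P₂, rfl, rfl, h₁, h₂⟩ := hR.par_inv
    exact (ih h₁ hP.1).par h₂
  | liftRes _ ih =>
    obtain ⟨P, rfl, h'⟩ | ⟨d, hd, h'⟩ := hR.res_inv
    · obtain ⟨A, hA⟩ := hP
      exact (ih h' hA).res
    · exact (ih h' hP).hide hd
  | liftM F h => exact (hR.not_tRed (.lift F.ctx h)).elim
  -- The congruence before the reduction is matched in the process by `Represents.sC`; the one after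
  -- it is undone by a reduction step, `SC.cRed`.
  | liftSC e₁ _ e₂ ih =>
    obtain ⟨P', e, hR'⟩ := (Represents.sC e₁).1 hR
    exact .of_cReds (.single e₂.symm.cRed) ((ih hR' ((e.consistent_iff Γ).1 hP)).sC e)

/-! ### The soundness theorem -/

theorem mainTheorem7 {n : ℕ} (P : PCP.Proc n) (Γ : PCP.Env n) (C : PGV.Conf n)
    (hP : PCP.Typed P Γ) (hC : PGV.CRed (transC P) C) :
    ∃ Q : PCP.Proc n, Relation.TransGen PCP.Red P Q ∧
      Relation.ReflTransGen PGV.CRed C (transC Q) := by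
  have hR := Represents.of_transC P id
  rw [Conf.rename_id] at hR
  obtain ⟨C', hC', ⟨Q, hQ, hR'⟩ | ⟨y, z, Δ', Q, hΔ, _⟩⟩ := simulated_of_cRed hC hR hP.consistent
  -- The remaining congruence with `transC Q` is one more reduction.
  · exact ⟨Q, hQ, hC'.tail hR'.sC_transC.cRed⟩
  -- No pair is pending outside of the whole configuration.
  · simp at hΔ
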